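/- **Setting.** Fix a horizon $T$, a number $M$ of covariates and a real $k\ge 2$. Let $\mathcal P_k$ be the class of continuous real functions $f$ on a Euclidean space with $|f(x)|\le c(1+\|x\|^k)$ for some constant $c$. For every $N$ consider the outcomes in $\mathbb R^N$ $$Y^{t+1}=(A+B_t)\,U_t+\varepsilon_t,\qquad U_t=g_t(Y^t,W,X)=\big(g_t(Y^t_n,W_n,X_n)\big)_{n\le N},\qquad 0\le t<T,$$ with given initial outcomes $Y^0\in\mathbb R^N$, treatments $W_n\in\mathbb R^T$ and covariates $X_n\in\mathbb R^M$. The entries of $A$ are $N(\mu/N,\sigma^2/N)$, those of $B_t$ are $N(\mu_t/N,\sigma_t^2/N)$, those of $\varepsilon_t$ are $N(0,\sigma_e^2)$; for each $N$ all of them are independent, and independent of $(Y^0,W,X)$. The treatments $W_1,W_2,\dots$ of the units are i.i.d. with law $\Pi$ and independent of the covariates; $Y^0$ and $X$ may change with $N$ and may be random or deterministic. **Assumptions.** (i) $g_t\in\mathcal P_{k/2}$ for all $t$. (ii) Almost surely, the empirical distribution of $X_1,\dots,X_N$ converges weakly to a probability measure $p_X$ with finite $k$-th moment, and its $k$-th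 absolute moments converge to that of $p_X$. (iii) $\Pi$ has a finite $k$-th moment. (iv) There are deterministic $\nu_1$ and $\rho_1^2>\sigma_e^2$ such that almost surely $\frac{\mu+\mu_0}{N}\sum_n U_{0,n}\to\nu_1$ and $\frac{\sigma^2+\sigma_0^2}{N}\sum_n U_{0,n}^2\to\rho_1^2-\sigma_e^2$. (v) There is $\bar g_0\in\mathcal P_{k/2}$ on $\mathbb R^{T+M}$ such that for each $\varphi\in\mathcal P_{k/2}$, almost surely $\frac1N\sum_n U_{0,n}\varphi(W_n,X_n)\to E[\bar g_0(W,X)\varphi(W,X)]$, and $E[\bar g_0(W,X)^2]\le(\rho_1^2-\sigma_e^2)/(\sigma^2+\sigma_0^2)$, where $(W,X)\sim\Pi\times p_X$. **State evolution.** For $1\le t<T$, with $Z\sim N(0,1)$ independent of $(W,X)\sim\Pi\times p_X$ and $\rho_t\ge 0$, $$\nu_{t+1}=(\mu+\mu_t)E[g_t(\nu_t+\rho_tZ,W,X)],\qquad \rho_{t+1}^2=(\sigma^2+\sigma_t^2)E[g_t(\nu_t+\rho_tZ,W,X)^2]+\sigma_e^2 .$$ **Conclusion.** There is a Gaussian vector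 $(Z_1,\dots,Z_T)$, independent of $(W,X)\sim\Pi\times p_X$, with $Z_s\sim N(0,1)$ for each $s$ (the $Z_s$ are in general correlated), such that, with $G_0=\bar g_0(W,X)$, $G_s=g_s(\nu_s+\rho_sZ_s,W,X)$ for $1\le s<T$, $m_s=E[G_s]$, $q_{00}=(\rho_1^2-\sigma_e^2)/(\sigma^2+\sigma_0^2)$ and $q_{sr}=E[G_sG_r]$ for $(s,r)\ne(0,0)$, $$\rho_{s+1}\rho_{r+1}E[Z_{s+1}Z_{r+1}]=\sigma^2q_{sr}\qquad(0\le s\ne r<T),$$ and the following holds, all limits being for $N\to\infty$. (a) For $0\le t<T$ and every $\psi\in\mathcal P_k$ on $\mathbb R^{t+1+T+M}$, $\psi(\nu_1+\rho_1Z_1,\dots,\nu_{t+1}+\rho_{t+1}Z_{t+1},W,X)$ is integrable and almost surely $$\frac1N\sum_{n=1}^N\psi(Y^1_n,\dots,Y^{t+1}_n,W_n,X_n)\to E\big[\psi(\nu_1+\rho_1Z_1,\dots,\nu_{t+1}+\rho_{t+1}Z_{t+1},W,X)\big].$$ (b) Write $\langle u,v\rangle=\frac1N\sum_nu_nv_n$,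 $\mathbf 1=(1,\dots,1)$ and $R_s=Y^{s+1}-B_sU_s-\varepsilon_s$. For $0\le s,r<T$, almost surely: $\langle Y^{s+1},\mathbf 1\rangle\to\nu_{s+1}$; $\langle U_s,\mathbf 1\rangle\to m_s$; $\langle R_s,\mathbf 1\rangle\to\mu m_s$; $\langle Y^{s+1},Y^{s+1}\rangle\to\nu_{s+1}^2+\rho_{s+1}^2$; $\langle Y^{s+1},Y^{r+1}\rangle\to\nu_{s+1}\nu_{r+1}+\sigma^2q_{sr}$ if $s\ne r$; $\langle U_s,U_r\rangle\to q_{sr}$; $\langle R_s,Y^{r+1}\rangle\to\mu(\mu+\mu_r)m_sm_r+\sigma^2q_{sr}$; $\langle R_s,R_r\rangle\to\mu^2m_sm_r+\sigma^2q_{sr}$. Moreover $(\mu+\mu_s)m_s=\nu_{s+1}$ and $(\sigma^2+\sigma_s^2)q_{ss}+\sigma_e^2=\rho_{s+1}^2$. (c) Let $t\le T$, and call (NC) the condition that for each $1\le s<t$, with positive probability with respect to $(W,X)\sim\Pi\times p_X$, the function $y\mapsto g_s(y,W,X)$ is not constant. If $\sigma_e>0$, or if $\sigma>0$ and (NC)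 holds, then with $V_t=[Y^1|\cdots|Y^t]$ the limits of $V_t^\top V_t/N$ and $V_t^\top\mathbf 1/N$ exist almost surely, are deterministic, and the matrix $$\lim\frac{V_t^\top V_t}{N}-\lim\frac{V_t^\top\mathbf 1}{N}\,\lim\frac{\mathbf 1^\top V_t}{N}$$ is positive definite. If (NC) holds and $\sigma_e>0$ or $\sigma>0$, then with $Q_t=[U_0|\cdots|U_{t-1}]$ the almost sure limit of $Q_t^\top Q_t/N$ exists, is deterministic, and is positive definite. -/

import Mathlib

open MeasureTheory ProbabilityTheory Filter Topology
open scoped BoundedContinuousFunction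

namespace CausalMP

/-- `ℝ^d` with its Euclidean norm and Borel `σ`-algebra. -/
abbrev Vec (d : ℕ) := EuclideanSpace ℝ (Fin d)

/-- Continuous functions of polynomial growth of order `k`, that is `|f x| ≤ c (1 + ‖x‖ ^ k)`.
On a product of finite-dimensional spaces the choice of the norm only affects the constant `c`. -/
def PolyGrowth {E : Type*} [NormedAddCommGroup E] (k : ℝ) (f : E → ℝ) : Prop :=
  Continuous f ∧ ∃ c : ℝ, ∀ x, |f x| ≤ c * (1 + ‖x‖ ^ k)

/-- The average `(1 / N) ∑ₙ f n` over the `N` units. -/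
noncomputable def avg {N : ℕ} (f : Fin N → ℝ) : ℝ := (∑ n, f n) / N

/-- The parameters of the model over the horizon `{0, …, T}` with `M` covariates.
Only the values `μt t`, `σt t`, `g t` with `t < T` enter the outcomes up to time `T`. -/
structure Params (T M : ℕ) where
  /-- `μ / N` is the mean of the entries of `A` -/
  μ : ℝ
  /-- `σ ^ 2 / N` is the variance of the entries of `A` -/
  σ : ℝ
  /-- `μt t / N` is the mean of the entries of `B_t` -/
  μt : ℕ → ℝ
  /-- `(σt t) ^ 2 / N` is the variance of the entries of `B_t` -/
  σt : ℕ → ℝ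
  /-- `σe ^ 2` is the variance of the noise -/
  σe : ℝ
  /-- the outcome functions `g_t (y, w, x)` -/
  g : ℕ → ℝ × Vec T × Vec M → ℝ

/-- The random objects, for every system size `N`. The treatment `W n` of unit `n` does not depend
on `N`: the treatment matrix of the `N`-th system has the columns `W 0, …, W (N - 1)`. -/
structure Systems (Ω : Type*) (T M : ℕ) where
  /-- fixed interference matrix -/
  A : (N : ℕ) → Ω → Matrix (Fin N) (Fin N) ℝ
  /-- time-dependent interference matrices -/
  B : (N : ℕ) → ℕ → Ω → Matrix (Fin N) (Fin N) ℝ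
  /-- noise vectors -/
  ε : (N : ℕ) → ℕ → Ω → Fin N → ℝ
  /-- initial outcomes -/
  Y₀ : (N : ℕ) → Ω → Fin N → ℝ
  /-- treatment vectors of the units -/
  W : ℕ → Ω → Vec T
  /-- covariate vectors of the units -/
  X : (N : ℕ) → Ω → Fin N → Vec M

section Model

variable {Ω : Type*} {T M : ℕ}

/-- The outcomes: `Y⁰` is given and `Y^{t+1} = (A + B_t) g_t(Y^t, W, X) + ε_t`. -/
def Systems.Y (S : Systems Ω T M) (θ : Params T M) (N : ℕ) (ω : Ω) : ℕ → Fin N → ℝ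
  | 0 => S.Y₀ N ω
  | t + 1 => (S.A N ω + S.B N t ω).mulVec
      (fun j => θ.g t (S.Y θ N ω t j, S.W j ω, S.X N ω j)) + S.ε N t ω

/-- The messages `U_t = g_t(Y^t, W, X)`. -/
def Systems.U (S : Systems Ω T M) (θ : Params T M) (N : ℕ) (ω : Ω) (t : ℕ) : Fin N → ℝ :=
  fun j => θ.g t (S.Y θ N ω t j, S.W j ω, S.X N ω j)

/-- `R_{t+1} = Y^{t+1} - B_t U_t - ε_t`, the part of the outcome due to the fixed matrix. -/
def Systems.R (S : Systems Ω T M) (θ : Params T M) (N : ℕ) (ω : Ω) (t : ℕ) : Fin N → ℝ :=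
  S.Y θ N ω (t + 1) - (S.B N t ω).mulVec (S.U θ N ω t) - S.ε N t ω

/-- All Gaussian inputs of the system of size `N` up to the horizon. -/
def Systems.noise (S : Systems Ω T M) (N : ℕ) (ω : Ω) :
    (Fin N → Fin N → ℝ) × (Fin T → Fin N → Fin N → ℝ) × (Fin T → Fin N → ℝ) :=
  (fun i j => S.A N ω i j, fun t i j => S.B N t ω i j, fun t i => S.ε N t ω i)

/-- The given inputs of the system of size `N`: initial outcomes, treatments, covariates. -/
def Systems.data (S : Systems Ω T M) (N : ℕ) (ω : Ω) :
    (Fin N → ℝ) × (Fin N → Vec T) × (Fin N → Vec M) :=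
  (S.Y₀ N ω, fun n => S.W n ω, S.X N ω)

/-- The product law under which all entries of `A`, `B_t`, `ε_t` are independent Gaussians. -/
noncomputable def noiseLaw (θ : Params T M) (N : ℕ) :
    Measure ((Fin N → Fin N → ℝ) × (Fin T → Fin N → Fin N → ℝ) × (Fin T → Fin N → ℝ)) :=
  (Measure.pi fun _ => Measure.pi fun _ => gaussianReal (θ.μ / N) (θ.σ ^ 2 / N).toNNReal).prod
    ((Measure.pi fun t : Fin T => Measure.pi fun _ => Measure.pi fun _ =>
        gaussianReal (θ.μt t / N) (θ.σt t ^ 2 / N).toNNReal).prod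
      (Measure.pi fun _ => Measure.pi fun _ => gaussianReal 0 (θ.σe ^ 2).toNNReal))

variable [MeasurableSpace Ω]

/-- The interference matrices and the noise have independent Gaussian entries, and they are
independent of the initial outcomes, the treatments and the covariates. -/
structure GaussianInterference (P : Measure Ω) (θ : Params T M) (S : Systems Ω T M) : Prop where
  law : ∀ N, HasLaw (S.noise N) (noiseLaw θ N) P
  aemeasurable_data : ∀ N, AEMeasurable (S.data N) P
  indep : ∀ N, IndepFun (S.noise N) (S.data N) P

/-- The units draw their treatment vectors independently from `Pi`, independently of the
covariates. -/
structure RandomizedDesign (P : Measure Ω) (Pi : Measure (Vec T)) (S : Systems Ω T M) : Prop where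
  law : ∀ n, HasLaw (S.W n) Pi P
  iIndep : iIndepFun S.W P
  indep_covariates : IndepFun (fun ω n => S.W n ω) (fun ω N => S.X N ω) P

/-- The regularity assumptions, with `ν₁`, `v₁` the mean and the variance `ρ₁²` after one step,
and `gbar` the function through which `g₀(Y⁰, W, X)` averages against functions of `(W, X)`. -/
structure Regularity (k : ℝ) (P : Measure Ω) (θ : Params T M) (S : Systems Ω T M)
    (Pi : Measure (Vec T)) (pX : Measure (Vec M)) (ν₁ v₁ : ℝ)
    (gbar : Vec T × Vec M → ℝ) : Prop where
  growth : ∀ t < T, PolyGrowth (k / 2) (θ.g t)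
  covariates_moment : Integrable (fun x : Vec M => ‖x‖ ^ k) pX
  covariates_weak : ∀ᵐ ω ∂P, ∀ f : Vec M →ᵇ ℝ,
    Tendsto (fun N => avg fun n => f (S.X N ω n)) atTop (𝓝 (∫ x, f x ∂pX))
  covariates_tendsto_moment : ∀ᵐ ω ∂P,
    Tendsto (fun N => avg fun n => ‖S.X N ω n‖ ^ k) atTop (𝓝 (∫ x, ‖x‖ ^ k ∂pX))
  treatment_moment : Integrable (fun w : Vec T => ‖w‖ ^ k) Pi
  initial_mean : ∀ᵐ ω ∂P,
    Tendsto (fun N => (θ.μ + θ.μt 0) * avg fun n => S.U θ N ω 0 n) atTop (𝓝 ν₁)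
  initial_var_pos : 0 < v₁ - θ.σe ^ 2
  initial_var : ∀ᵐ ω ∂P,
    Tendsto (fun N => (θ.σ ^ 2 + θ.σt 0 ^ 2) * avg fun n => S.U θ N ω 0 n ^ 2) atTop
      (𝓝 (v₁ - θ.σe ^ 2))
  gbar_growth : PolyGrowth (k / 2) gbar
  gbar_tendsto : ∀ φ : Vec T × Vec M → ℝ, PolyGrowth (k / 2) φ → ∀ᵐ ω ∂P,
    Tendsto (fun N => avg fun n => S.U θ N ω 0 n * φ (S.W n ω, S.X N ω n)) atTop
      (𝓝 (∫ q, gbar q * φ q ∂(Pi.prod pX)))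
  gbar_sq : ∫ q, gbar q ^ 2 ∂(Pi.prod pX) ≤ (v₁ - θ.σe ^ 2) / (θ.σ ^ 2 + θ.σt 0 ^ 2)

end Model

section StateEvolution

variable {T M : ℕ} (θ : Params T M) (Pi : Measure (Vec T)) (pX : Measure (Vec M)) (ν₁ v₁ : ℝ)

/-- State evolution: the pair `(ν_t, ρ_t²)` for `t ≥ 1` (the value at `t = 0` is not used). -/
noncomputable def stateEvolution : ℕ → ℝ × ℝ
  | 0 => (0, 0)
  | 1 => (ν₁, v₁)
  | t + 2 =>
    ((θ.μ + θ.μt (t + 1)) *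
        ∫ q, θ.g (t + 1) ((stateEvolution (t + 1)).1 + √(stateEvolution (t + 1)).2 * q.1, q.2)
          ∂((gaussianReal 0 1).prod (Pi.prod pX)),
      (θ.σ ^ 2 + θ.σt (t + 1) ^ 2) *
        ∫ q, θ.g (t + 1) ((stateEvolution (t + 1)).1 + √(stateEvolution (t + 1)).2 * q.1, q.2) ^ 2
          ∂((gaussianReal 0 1).prod (Pi.prod pX)) + θ.σe ^ 2)

/-- `ν_t` -/
noncomputable def nu (t : ℕ) : ℝ := (stateEvolution θ Pi pX ν₁ v₁ t).1

/-- `ρ_t²` -/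
noncomputable def rhoSq (t : ℕ) : ℝ := (stateEvolution θ Pi pX ν₁ v₁ t).2

/-- `ρ_t` -/
noncomputable def rho (t : ℕ) : ℝ := √(rhoSq θ Pi pX ν₁ v₁ t)

/-- The limiting outcome `ν_{s+1} + ρ_{s+1} Z_{s+1}`; the coordinate `z s` stands for `Z_{s+1}`. -/
noncomputable def limY (z : Fin T → ℝ) (s : Fin T) : ℝ :=
  nu θ Pi pX ν₁ v₁ (s + 1) + rho θ Pi pX ν₁ v₁ (s + 1) * z s

variable (gbar : Vec T × Vec M → ℝ)

/-- The limiting message at time `s`: `g_s(ν_s + ρ_s Z_s, W, X)` for `s ≥ 1`, and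
`gbar (W, X)` for `s = 0`. -/
noncomputable def limU (s : Fin T) (z : Fin T → ℝ) (q : Vec T × Vec M) : ℝ :=
  if s.val = 0 then gbar q
  else θ.g s (limY θ Pi pX ν₁ v₁ z ⟨s.val - 1, (Nat.sub_le _ _).trans_lt s.isLt⟩, q)

/-- The mean of the limiting message at time `s`. -/
noncomputable def limMean (γ : Measure (Fin T → ℝ)) (s : Fin T) : ℝ :=
  ∫ p, limU θ Pi pX ν₁ v₁ gbar s p.1 p.2 ∂(γ.prod (Pi.prod pX))

/-- The limit of `⟨U_s, U_r⟩ / N`. -/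
noncomputable def limGram (γ : Measure (Fin T → ℝ)) (s r : Fin T) : ℝ :=
  if s.val = 0 ∧ r.val = 0 then (v₁ - θ.σe ^ 2) / (θ.σ ^ 2 + θ.σt 0 ^ 2)
  else ∫ p, limU θ Pi pX ν₁ v₁ gbar s p.1 p.2 * limU θ Pi pX ν₁ v₁ gbar r p.1 p.2
    ∂(γ.prod (Pi.prod pX))

/-- `γ` is the law of a Gaussian vector `(Z_1, …, Z_T)` with standard normal coordinates and
`ρ_{s+1} ρ_{r+1} E[Z_{s+1} Z_{r+1}] = σ² lim ⟨U_s, U_r⟩ / N` for `s ≠ r`. -/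
structure IsLimitNoise (γ : Measure (Fin T → ℝ)) : Prop where
  gaussian : IsGaussian γ
  marginal : ∀ s, γ.map (fun z => z s) = gaussianReal 0 1
  cov : ∀ s r : Fin T, s ≠ r →
    rho θ Pi pX ν₁ v₁ (s + 1) * rho θ Pi pX ν₁ v₁ (r + 1) * ∫ z, z s * z r ∂γ
      = θ.σ ^ 2 * limGram θ Pi pX ν₁ v₁ gbar γ s r

/-- For every time `1 ≤ s < t`, with positive probability with respect to `(W, X) ∼ Pi × pX`, the
function `y ↦ g_s(y, W, X)` is not constant. -/
def NonConstant (t : ℕ) : Prop :=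
  ∀ s, 1 ≤ s → s < t → ¬ ∀ᵐ q ∂(Pi.prod pX), ∀ y y' : ℝ, θ.g s (y, q) = θ.g s (y', q)

end StateEvolution

end CausalMP

/-! All Gaussian inputs of the system of size $N$ form one standard Gaussian matrix $G$ whose rows
are the units and whose columns are those of $A$, those of all $B_t$, the noise vectors, and $2T$
fresh ones. Up to a multiple of $\mathbf 1$, the outcome $Y^{t+1}$ is $G$ applied to a direction
built from $U_t$, and $R_t$ is $G$ applied to a direction supported on the columns of $A$. These
$2T$ directions are random, but each is determined by the data and the images of the previous ones.
Gram-Schmidt, padded by the fresh columns in degenerate cases, makes them an adaptively chosen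
orthonormal system, and by rotation invariance (`measurePreserving_adaptive`) their images are
exactly independent standard Gaussian vectors, independent of the data. Hence
(`exists_gaussian_representation`) the outcomes of unit $n$ are $c+L\zeta_n$ with $\zeta_n$ i.i.d.
standard Gaussian in $\mathbb R^{2T}$; the random $c$ and $L$ are common to all units, and the Gram
matrix of the rows of $L$ is an explicit function of the empirical Gram matrix of the messages. No
conditioning on the past and no invertibility is needed.

Since $c$ and $L$ depend on the $\zeta_n$, a law of large numbers uniform in them is required.
Fourth moments and Borel-Cantelli, on a countable family of test functions, show that almost surely
the empirical law of $(\zeta_n,W_n,X_n)$ converges weakly, whatever the coupling between different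
$N$; the $k$-th powers of the norms are uniformly integrable (`ae_sampleLimit`). Then averages of
locally uniformly convergent test functions converge too. The matrices $L$ need not converge, only
their Gram matrices do; but they are bounded, so they converge along every ultrafilter, and the
limiting integral depends only on the limiting Gram matrix, because a centred Gaussian law is
determined by its covariance (`SampleLimit.tendsto_avg`).

Now induct on time: limits of the moments of $U_0,\dots,U_{t-1}$ give the limits of $c$ and of the
Gram matrix of $L$, hence limits of averages of functions of $Y^1,\dots,Y^t$, hence the moments of
$U_t$ (`exists_momentLimits_of_le`). The message $U_0$ is not a function of $(W,X)$; it enters as a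
weight bounded in mean square, through $\bar g_0$. State evolution is the one-dimensional marginal
of this recursion, and normalizing the rows of a limiting coefficient matrix yields
$(Z_1,\dots,Z_T)$.

For positive definiteness, the limiting quadratic form of the messages dominates $E[(\sum_i
x_iG_i)^2]$. If it is not positive, the sum vanishes, by continuity for every value of the Gaussian
vector. When the covariance of $Y^1,\dots,Y^t$ is positive definite, the last of them can be varied
alone, which forces $x_t=0$ unless $g_t$ is constant in $y$. The Gram matrix of the messages and the
covariance of the outcomes are thus treated in alternation. -/

namespace CausalMP

/-! ### Averages over units and uniform integrability. -/

section Avg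

lemma avg_add {N : ℕ} (f g : Fin N → ℝ) : avg (fun n => f n + g n) = avg f + avg g := by
  simp [avg, Finset.sum_add_distrib, add_div]

lemma avg_sub {N : ℕ} (f g : Fin N → ℝ) : avg (fun n => f n - g n) = avg f - avg g := by
  simp [avg, Finset.sum_sub_distrib, sub_div]

lemma avg_const_mul {N : ℕ} (c : ℝ) (f : Fin N → ℝ) : avg (fun n => c * f n) = c * avg f := by
  rw [avg, avg, ← Finset.mul_sum, mul_div_assoc]

lemma avg_mono {N : ℕ} {f g : Fin N → ℝ} (h : ∀ n, f n ≤ g n) : avg f ≤ avg g := by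
  unfold avg
  gcongr
  exact h _

lemma avg_const_of_pos {N : ℕ} (hN : 0 < N) (c : ℝ) : avg (fun _ : Fin N => c) = c := by
  have : (N : ℝ) ≠ 0 := by positivity
  simp [avg]
  field_simp

lemma avg_const_le {N : ℕ} {c : ℝ} (hc : 0 ≤ c) : avg (fun _ : Fin N => c) ≤ c := by
  rcases Nat.eq_zero_or_pos N with rfl | h
  · simpa [avg] using hc
  · exact (avg_const_of_pos h c).le

lemma abs_avg_le {N : ℕ} (f : Fin N → ℝ) : |avg f| ≤ avg fun n => |f n| := by
  unfold avg
  rw [abs_div, Nat.abs_cast]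
  gcongr
  exact Finset.abs_sum_le_sum_abs _ _

lemma avg_nonneg {N : ℕ} {f : Fin N → ℝ} (h : ∀ n, 0 ≤ f n) : 0 ≤ avg f :=
  div_nonneg (Finset.sum_nonneg fun n _ => h n) (Nat.cast_nonneg _)

end Avg

/-- Uniform integrability of the empirical distributions of a triangular array. -/
def UnifInt (a : ∀ N, Fin N → ℝ) : Prop :=
  ∀ ε > 0, ∃ R : ℝ, ∀ᶠ N in atTop, avg (fun n => max (a N n - R) 0) ≤ ε

lemma UnifInt.mono {a b : ∀ N, Fin N → ℝ} (hb : UnifInt b) (h : ∀ N n, a N n ≤ b N n) :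
    UnifInt a := by
  intro ε hε
  obtain ⟨R, hR⟩ := hb ε hε
  refine ⟨R, hR.mono fun N hN => (avg_mono fun n => ?_).trans hN⟩
  gcongr
  exact h N n

lemma UnifInt.exists_ge {a : ∀ N, Fin N → ℝ} (ha : UnifInt a) {ε : ℝ} (hε : 0 < ε) :
    ∃ R : ℝ, ∀ R' ≥ R, ∀ᶠ N in atTop, avg (fun n => max (a N n - R') 0) ≤ ε := by
  obtain ⟨R, hR⟩ := ha ε hε
  refine ⟨R, fun R' h => hR.mono fun N hN => (avg_mono fun n => ?_).trans hN⟩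
  gcongr

lemma UnifInt.add {a b : ∀ N, Fin N → ℝ} (ha : UnifInt a) (hb : UnifInt b) :
    UnifInt fun N n => a N n + b N n := by
  intro ε hε
  obtain ⟨R, hR⟩ := ha (ε / 2) (by positivity)
  obtain ⟨R', hR'⟩ := hb (ε / 2) (by positivity)
  refine ⟨R + R', (hR.and hR').mono fun N hN => ?_⟩
  calc _ ≤ avg (fun n => max (a N n - R) 0 + max (b N n - R') 0) := avg_mono fun n => by
          have h1 := le_max_left (a N n - R) 0
          have h2 := le_max_left (b N n - R') 0
          have h3 := le_max_right (a N n - R) 0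
          have h4 := le_max_right (b N n - R') 0
          exact max_le (by linarith) (by linarith)
    _ ≤ ε := by rw [avg_add]; linarith [hN.1, hN.2]

lemma UnifInt.const_mul {a : ∀ N, Fin N → ℝ} (ha : UnifInt a) {C : ℝ} (hC : 0 ≤ C) :
    UnifInt fun N n => C * a N n := by
  intro ε hε
  obtain ⟨R, hR⟩ := ha (ε / (C + 1)) (by positivity)
  refine ⟨C * R, hR.mono fun N hN => ?_⟩
  calc _ ≤ avg (fun n => C * max (a N n - R) 0) := avg_mono fun n => by
          refine max_le ?_ (by positivity)
          rw [← mul_sub]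
          gcongr
          exact le_max_left _ _
    _ = C * avg (fun n => max (a N n - R) 0) := avg_const_mul _ _
    _ ≤ C * (ε / (C + 1)) := by gcongr
    _ ≤ ε := by
      rw [mul_div_assoc', div_le_iff₀ (by positivity)]
      nlinarith

lemma unifInt_const (c : ℝ) : UnifInt fun _ _ => c := by
  intro ε hε
  refine ⟨c, .of_forall fun N => ?_⟩
  simpa [avg] using hε.le

/-- Bounded second moments imply uniform integrability. -/
lemma unifInt_of_sq_bounded {a : ∀ N, Fin N → ℝ} {C : ℝ}
    (h : ∀ᶠ N in atTop, avg (fun n => a N n ^ 2) ≤ C) : UnifInt a := by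
  intro ε hε
  -- For $R>0$ one has $(a-R)^+\le a^2/R$, so $R\ge|C|/\varepsilon$ suffices; the added $1$ keeps
  -- $R$ positive.
  refine ⟨|C| / ε + 1, h.mono fun N hN => ?_⟩
  have hR : 0 < |C| / ε + 1 := by positivity
  calc _ ≤ avg (fun n => (|C| / ε + 1)⁻¹ * a N n ^ 2) := avg_mono fun n => by
          refine max_le ?_ (by positivity)
          rw [inv_mul_eq_div, le_div_iff₀ hR]
          nlinarith [sq_nonneg (a N n - (|C| / ε + 1))]
    _ ≤ ε := by
      rw [avg_const_mul, inv_mul_eq_div, div_le_iff₀ hR, mul_add, mul_div_cancel₀ _ hε.ne']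
      linarith [le_abs_self C]

/-- Expand $(\delta|p|-|q|)^2\ge0$. It serves as Cauchy-Schwarz when one factor is only bounded in
mean square and the other is small. -/
lemma abs_mul_le_young {δ : ℝ} (hδ : 0 < δ) (p q : ℝ) :
    |p * q| ≤ δ * p ^ 2 / 2 + q ^ 2 / (2 * δ) := by
  have h4 : |p * q| * (2 * δ) ≤ δ ^ 2 * p ^ 2 + q ^ 2 := by
    have := sq_nonneg (δ * |p| - |q|)
    rw [abs_mul]
    nlinarith [sq_abs p, sq_abs q]
  rw [← le_div_iff₀ (by positivity)] at h4
  refine h4.trans_eq ?_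
  field_simp

/-! ### Weak convergence of empirical measures and classes of test functions. -/

section Empirical

section

variable {E : Type*} [NormedAddCommGroup E]

/-- Truncation of a real number to `[-R, R]`. -/
def clip (R x : ℝ) : ℝ := max (-R) (min x R)

lemma continuous_clip (R : ℝ) : Continuous (clip R) := by unfold clip; fun_prop

lemma abs_clip_le {R : ℝ} (hR : 0 ≤ R) (x : ℝ) : |clip R x| ≤ R := by
  unfold clip
  rw [abs_le]
  exact ⟨le_max_left _ _, max_le (by linarith) (min_le_right _ _)⟩

lemma clip_of_abs_le {R x : ℝ} (h : |x| ≤ R) : clip R x = x := by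
  rw [abs_le] at h
  unfold clip
  rw [min_eq_left h.2, max_eq_right h.1]

lemma abs_clip_sub_clip_le (R x y : ℝ) : |clip R x - clip R y| ≤ |x - y| := by
  unfold clip
  refine (abs_max_sub_max_le_max _ _ _ _).trans ?_
  simp only [sub_self, abs_zero]
  refine max_le (abs_nonneg _) ((abs_min_sub_min_le_max _ _ _ _).trans ?_)
  simp

lemma abs_sub_clip_le {R x : ℝ} (hR : 0 ≤ R) : |x - clip R x| ≤ max (|x| - R) 0 := by
  rcases le_total |x| R with h | h
  · rw [clip_of_abs_le h]; simp
  · rcases le_total 0 x with hx | hx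
    · rw [abs_of_nonneg hx] at h ⊢
      unfold clip
      rw [min_eq_right h, max_eq_right (by linarith), abs_of_nonneg (by linarith)]
      exact le_max_left _ _
    · rw [abs_of_nonpos hx] at h ⊢
      unfold clip
      rw [min_eq_left (by linarith), max_eq_left (by linarith), abs_of_nonpos (by linarith)]
      exact le_max_of_le_left (by linarith)

lemma abs_sub_clip_le_abs {R x : ℝ} (hR : 0 ≤ R) : |x - clip R x| ≤ |x| :=
  (abs_sub_clip_le hR).trans (max_le (by linarith) (abs_nonneg _))

/-- A continuous function truncated to `[-R, R]`. -/
noncomputable def clipBCF (R : ℝ) (hR : 0 ≤ R) (f : E → ℝ) (hf : Continuous f) : E →ᵇ ℝ :=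
  BoundedContinuousFunction.ofNormedAddCommGroup (fun x => clip R (f x))
    ((continuous_clip R).comp hf) R fun x => abs_clip_le hR (f x)

/-- A countable family of bounded continuous functions that approximates all of them. -/
lemma exists_dense_boundedContinuous [ProperSpace E] :
    ∃ φ : ℕ → ℕ → (E →ᵇ ℝ), (∀ R i x, |φ R i x| ≤ R) ∧
      ∀ (R : ℕ) (f : E → ℝ), Continuous f → (∀ x, |f x| ≤ R) → ∀ ρ ε : ℝ, 0 < ε →
        ∃ i, ∀ x, ‖x‖ ≤ ρ → |φ R i x - f x| ≤ ε := by
  -- Since $E$ is proper, $C(E,\mathbb R)$ with the compact-open topology is separable; a dense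
  -- sequence, truncated at every level $R$, gives the family.
  have := ContinuousMap.instSeparableSpace (X := E) (Y := ℝ)
  let d := TopologicalSpace.denseSeq C(E, ℝ)
  refine ⟨fun R i => clipBCF R (by positivity) (d i) (d i).continuous,
    fun R i x => abs_clip_le (by positivity) _, fun R f hf hfR ρ ε hε => ?_⟩
  let f' : C(E, ℝ) := ⟨f, hf⟩
  have hmem : {g : C(E, ℝ) | ∀ x ∈ Metric.closedBall (0 : E) ρ, dist (f' x) (g x) < ε} ∈ 𝓝 f' := by
    have := ContinuousMap.tendsto_iff_forall_isCompact_tendstoUniformlyOn.1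
      (tendsto_id (α := C(E, ℝ)) (x := 𝓝 f')) (Metric.closedBall 0 ρ) (isCompact_closedBall _ _)
    rw [Metric.tendstoUniformlyOn_iff] at this
    exact this ε hε
  obtain ⟨g, hg⟩ := (TopologicalSpace.denseRange_denseSeq C(E, ℝ)).exists_mem_open
    isOpen_interior ⟨f', mem_interior_iff_mem_nhds.2 hmem⟩
  refine ⟨g, fun x hx => ?_⟩
  have := interior_subset hg x (by simpa using hx)
  change |clip R (d g x) - f x| ≤ ε
  -- As $f$ is its own truncation and truncation is 1-Lipschitz, truncating the approximant does not
  -- increase the error.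
  rw [← clip_of_abs_le (hfR x)]
  refine (abs_clip_sub_clip_le _ _ _).trans ?_
  rw [Real.dist_eq, abs_sub_comm] at this
  exact this.le

/-- The truncated distance from the ball of radius `r`. -/
noncomputable def outside (r : ℝ) (x : E) : ℝ := min 1 (max (‖x‖ - r) 0)

lemma continuous_outside (r : ℝ) : Continuous (outside r : E → ℝ) := by unfold outside; fun_prop

lemma outside_nonneg (r : ℝ) (x : E) : 0 ≤ outside r x :=
  le_min zero_le_one (le_max_right _ _)

lemma outside_le_one (r : ℝ) (x : E) : outside r x ≤ 1 := min_le_left _ _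

lemma outside_eq_one {r : ℝ} {x : E} (h : r + 1 ≤ ‖x‖) : outside r x = 1 :=
  min_eq_left (le_max_of_le_left (by linarith))

end

variable {E : Type*} [NormedAddCommGroup E] [MeasurableSpace E] [BorelSpace E]

/-- Weak convergence of the empirical distributions of a triangular array. -/
def WeakConv (z : ∀ N, Fin N → E) (μ : Measure E) : Prop :=
  ∀ f : E →ᵇ ℝ, Tendsto (fun N => avg fun n => f (z N n)) atTop (𝓝 (∫ x, f x ∂μ))

lemma bcf_integrable (μ : Measure E) [IsFiniteMeasure μ] (f : E →ᵇ ℝ) : Integrable f μ :=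
  BoundedContinuousFunction.integrable μ f

/-- Bounds on the empirical tails of a continuous function pass to the weak limit. -/
lemma WeakConv.integral_tail_le {z : ∀ N, Fin N → E} {μ : Measure E} [IsProbabilityMeasure μ]
    (hz : WeakConv z μ) {h : E → ℝ} (hc : Continuous h) {ε R : ℝ}
    (hR : ∀ᶠ N in atTop, avg (fun n => max (h (z N n) - R) 0) ≤ ε) :
    Integrable (fun x => max (h x - R) 0) μ ∧ ∫ x, max (h x - R) 0 ∂μ ≤ ε := by
  set q : E → ℝ := fun x => max (h x - R) 0 with hq
  have hqc : Continuous q := by fun_prop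
  have hq0 : ∀ x, 0 ≤ q x := fun x => le_max_right _ _
  have hε : 0 ≤ ε := by
    obtain ⟨N, hN⟩ := hR.exists
    exact (avg_nonneg fun n => hq0 _).trans hN
  have hclip (m : ℕ) (x : E) : clip m (q x) = min (q x) m := by
    unfold clip
    exact max_eq_right ((by simp : (-(m : ℝ)) ≤ 0).trans (le_min (hq0 x) (by positivity)))
  -- Weak convergence only sees bounded functions: the tail is cut at height $m$, the bound passes
  -- to the limit for each $m$, and monotone convergence removes the cut. The same bound gives
  -- integrability.
  have hb (m : ℕ) : ∫ x, clip m (q x) ∂μ ≤ ε := by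
    have := hz (clipBCF m (by positivity) q hqc)
    refine le_of_tendsto this (hR.mono fun N hN => (avg_mono fun n => ?_).trans hN)
    change clip m (q (z N n)) ≤ q (z N n)
    rw [hclip]
    exact min_le_left _ _
  have hlim : Tendsto (fun m : ℕ => ∫⁻ x, ENNReal.ofReal (clip m (q x)) ∂μ) atTop
      (𝓝 (∫⁻ x, ENNReal.ofReal (q x) ∂μ)) := by
    refine lintegral_tendsto_of_tendsto_of_monotone (fun m => ?_) (.of_forall fun x => ?_)
      (.of_forall fun x => ?_)
    · exact (((continuous_clip _).comp hqc).measurable.ennreal_ofReal).aemeasurable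
    · intro m m' hm
      simp only [hclip]
      gcongr
    · refine tendsto_const_nhds.congr' ?_
      filter_upwards [eventually_ge_atTop ⌈q x⌉₊] with m hm
      rw [clip_of_abs_le]
      rw [abs_of_nonneg (hq0 x)]
      exact (Nat.le_ceil _).trans (by exact_mod_cast hm)
  have hle : ∫⁻ x, ENNReal.ofReal (q x) ∂μ ≤ ENNReal.ofReal ε := by
    refine le_of_tendsto' hlim fun m => ?_
    rw [← ofReal_integral_eq_lintegral_ofReal]
    · exact ENNReal.ofReal_le_ofReal (hb m)
    · exact bcf_integrable μ (clipBCF m (by positivity) q hqc)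
    · exact .of_forall fun x => by
        simp only [hclip, Pi.zero_apply]; exact le_min (hq0 x) (by positivity)
  have hint : Integrable q μ := by
    refine ⟨hqc.aestronglyMeasurable, ?_⟩
    rw [hasFiniteIntegral_iff_ofReal (.of_forall hq0)]
    exact hle.trans_lt ENNReal.ofReal_lt_top
  refine ⟨hint, ?_⟩
  rw [integral_eq_lintegral_of_nonneg_ae (.of_forall hq0) hqc.aestronglyMeasurable]
  exact ENNReal.toReal_le_of_le_ofReal hε hle

lemma WeakConv.integrable {z : ∀ N, Fin N → E} {μ : Measure E} [IsProbabilityMeasure μ]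
    (hz : WeakConv z μ) {h : E → ℝ} (hc : Continuous h) (h0 : ∀ x, 0 ≤ h x)
    (hu : UnifInt fun N n => h (z N n)) : Integrable h μ := by
  obtain ⟨R, hR⟩ := hu 1 one_pos
  have h1 := (hz.integral_tail_le hc hR).1
  refine (h1.add (integrable_const |R|)).mono' hc.aestronglyMeasurable (.of_forall fun x => ?_)
  rw [Real.norm_of_nonneg (h0 x)]
  simp only [Pi.add_apply]
  linarith [le_max_left (h x - R) 0, le_abs_self R]

/-- Weak convergence together with uniform integrability gives convergence of the averages of
dominated continuous functions. -/
lemma WeakConv.tendsto_avg {z : ∀ N, Fin N → E} {μ : Measure E} [IsProbabilityMeasure μ]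
    (hz : WeakConv z μ) {h f : E → ℝ} (hc : Continuous h)
    (hu : UnifInt fun N n => h (z N n)) (hf : Continuous f) (hfh : ∀ x, |f x| ≤ h x) :
    Integrable f μ ∧ Tendsto (fun N => avg fun n => f (z N n)) atTop (𝓝 (∫ x, f x ∂μ)) := by
  have h0 : ∀ x, 0 ≤ h x := fun x => (abs_nonneg _).trans (hfh x)
  have hint : Integrable f μ :=
    (hz.integrable hc h0 hu).mono' hf.aestronglyMeasurable (.of_forall hfh)
  refine ⟨hint, ?_⟩
  rw [Metric.tendsto_atTop']
  intro ε hε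
  obtain ⟨R₀, hR₀⟩ := hu.exists_ge (show 0 < ε / 4 by positivity)
  set R := max R₀ 0
  have hRpos : 0 ≤ R := le_max_right _ _
  have hR := hR₀ R (le_max_left _ _)
  obtain ⟨hti, htl⟩ := hz.integral_tail_le hc hR
  have hcl := hz (clipBCF R hRpos f hf)
  rw [Metric.tendsto_atTop'] at hcl
  obtain ⟨N₁, hN₁⟩ := hcl (ε / 4) (by positivity)
  obtain ⟨N₂, hN₂⟩ := eventually_atTop.1 hR
  -- One tail function of $h$ controls the truncation error of $f$ both in the empirical average and
  -- in the limit.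
  have hb (x : E) : |f x - clip R (f x)| ≤ max (h x - R) 0 :=
    (abs_sub_clip_le hRpos).trans (by gcongr; exact hfh x)
  refine ⟨max N₁ N₂, fun N hN => ?_⟩
  have h1 : |avg (fun n => f (z N n)) - avg (fun n => clip R (f (z N n)))| ≤ ε / 4 := by
    rw [← avg_sub]
    exact (abs_avg_le _).trans ((avg_mono fun n => hb _).trans
      (hN₂ N ((le_max_right _ _).trans hN.le)))
  have h2 := hN₁ N ((le_max_left _ _).trans_lt hN)
  have hci : Integrable (fun x => clip R (f x)) μ := bcf_integrable μ (clipBCF R hRpos f hf)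
  have h3 : |∫ x, clip R (f x) ∂μ - ∫ x, f x ∂μ| ≤ ε / 4 := by
    rw [abs_sub_comm, ← integral_sub hint hci]
    exact (abs_integral_le_integral_abs).trans
      ((integral_mono (hint.sub hci).abs hti hb).trans htl)
  rw [Real.dist_eq] at h2 ⊢
  change |avg (fun n => clip R (f (z N n))) - ∫ x, clip R (f x) ∂μ| < ε / 4 at h2
  rw [abs_le] at h1 h3
  rw [abs_lt] at h2 ⊢
  constructor <;> linarith [h1.1, h1.2, h2.1, h2.2, h3.1, h3.2]

/-- Averages of locally uniformly convergent, dominated continuous functions converge. -/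
lemma WeakConv.tendsto_avg_continuousMap [ProperSpace E] {z : ∀ N, Fin N → E} {μ : Measure E}
    [IsProbabilityMeasure μ]
    (hz : WeakConv z μ) {h : E → ℝ} (hc : Continuous h) (hn : ∀ x, ‖x‖ ≤ h x)
    (hu : UnifInt fun N n => h (z N n)) {l : Filter ℕ} (hl : l ≤ atTop) {F : ℕ → C(E, ℝ)}
    {F₀ : C(E, ℝ)} (hF : Tendsto F l (𝓝 F₀)) (hFh : ∀ N x, |F N x| ≤ h x) :
    Tendsto (fun N => avg fun n => F N (z N n)) l (𝓝 (∫ x, F₀ x ∂μ)) := by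
  rcases l.eq_or_neBot with rfl | hne
  · simp
  have hF₀ : ∀ x, |F₀ x| ≤ h x := fun x =>
    le_of_tendsto' ((((continuous_eval_const x).tendsto F₀).comp hF).abs) fun N => hFh N x
  have hlim := ((hz.tendsto_avg hc hu F₀.continuous hF₀).2).mono_left hl
  suffices hd : Tendsto (fun N => avg (fun n => F N (z N n)) - avg (fun n => F₀ (z N n))) l
      (𝓝 0) by simpa using hd.add hlim
  rw [Metric.tendsto_nhds]
  intro ε hε
  obtain ⟨R₀, hR₀⟩ := hu.exists_ge (show 0 < ε / 10 by positivity)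
  set R := max R₀ 0
  have hR := hl (hR₀ R (le_max_left _ _))
  -- Radius $2R$: where $h\le2R$ the point lies in this ball, and where $h>2R$ one has
  -- $|F_N-F_0|\le2h\le4(h-R)$, a multiple of the tail.
  have hcomp := ContinuousMap.tendsto_iff_forall_isCompact_tendstoUniformlyOn.1 hF
    (Metric.closedBall 0 (2 * R)) (isCompact_closedBall _ _)
  rw [Metric.tendstoUniformlyOn_iff] at hcomp
  filter_upwards [hR, hcomp (ε / 10) (by positivity)] with N hN hNc
  rw [Real.dist_eq, sub_zero, ← avg_sub]
  calc _ ≤ avg (fun n => |F N (z N n) - F₀ (z N n)|) := abs_avg_le _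
    _ ≤ avg (fun n => ε / 10 + 4 * max (h (z N n) - R) 0) := avg_mono fun n => by
        rcases le_or_gt (h (z N n)) (2 * R) with hle | hgt
        · have := hNc (z N n) (by simpa using (hn _).trans hle)
          rw [Real.dist_eq, abs_sub_comm] at this
          linarith [le_max_right (h (z N n) - R) 0]
        · have h1 := hFh N (z N n)
          have h2 := hF₀ (z N n)
          have h3 := abs_sub (F N (z N n)) (F₀ (z N n))
          linarith [le_max_left (h (z N n) - R) 0]
    _ ≤ ε / 10 + 4 * (ε / 10) := by
        rw [avg_add, avg_const_mul]
        gcongr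
        exact avg_const_le (by positivity)
    _ < ε := by linarith

lemma integrable_outside (μ : Measure E) [IsProbabilityMeasure μ] (r : ℝ) :
    Integrable (outside r) μ :=
  (integrable_const 1).mono' (continuous_outside r).aestronglyMeasurable
    (.of_forall fun x => by
      rw [Real.norm_of_nonneg (outside_nonneg r x)]; exact outside_le_one r x)

lemma tendsto_integral_outside (μ : Measure E) [IsProbabilityMeasure μ] :
    Tendsto (fun r : ℝ => ∫ x, outside r x ∂μ) atTop (𝓝 0) := by
  have : Tendsto (fun r : ℝ => ∫ x, outside r x ∂μ) atTop (𝓝 (∫ _, (0 : ℝ) ∂μ)) := by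
    refine tendsto_integral_filter_of_dominated_convergence (fun _ => 1)
      (.of_forall fun r => (continuous_outside r).aestronglyMeasurable)
      (.of_forall fun r => .of_forall fun x => ?_) (integrable_const 1) (.of_forall fun x => ?_)
    · rw [Real.norm_of_nonneg (outside_nonneg r x)]; exact outside_le_one r x
    · refine tendsto_const_nhds.congr' ?_
      filter_upwards [eventually_ge_atTop ‖x‖] with r hr
      simp [outside, max_eq_right (sub_nonpos.2 hr)]
  simpa using this

/-- Weak convergence may be tested on a countable approximating family. -/
lemma weakConv_of_dense {φ : ℕ → ℕ → (E →ᵇ ℝ)} (hφb : ∀ R i x, |φ R i x| ≤ R)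
    (hφ : ∀ (R : ℕ) (f : E → ℝ), Continuous f → (∀ x, |f x| ≤ R) → ∀ ρ ε : ℝ, 0 < ε →
        ∃ i, ∀ x, ‖x‖ ≤ ρ → |φ R i x - f x| ≤ ε)
    {z : ∀ N, Fin N → E} {μ : Measure E} [IsProbabilityMeasure μ]
    (hz : ∀ R i, Tendsto (fun N => avg fun n => φ R i (z N n)) atTop (𝓝 (∫ x, φ R i x ∂μ)))
    (hu : UnifInt fun N n => ‖z N n‖) : WeakConv z μ := by
  intro f
  obtain ⟨R, hR⟩ := exists_nat_ge ‖f‖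
  have hfR : ∀ x, |f x| ≤ R := fun x => (f.norm_coe_le_norm x).trans hR
  rw [Metric.tendsto_atTop']
  intro ε hε
  -- The three errors below are at most $(1+2R)\delta$, $\delta$ and $(1+2R)\delta$, with sum
  -- $(4R+3)\delta<\varepsilon$.
  set δ := ε / (4 * R + 4) with hδ
  have hδpos : 0 < δ := by positivity
  have hδε : (4 * R + 4) * δ = ε := by rw [hδ]; field_simp
  obtain ⟨r₀, hr₀⟩ := hu.exists_ge hδpos
  obtain ⟨r, hr, hrr⟩ := (((tendsto_integral_outside μ).eventually_le_const hδpos).and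
    (eventually_ge_atTop r₀)).exists
  obtain ⟨i, hi⟩ := hφ R f f.continuous hfR (r + 1) δ hδpos
  have hpt (x : E) : |f x - φ R i x| ≤ δ + 2 * R * outside r x := by
    rcases le_or_gt ‖x‖ (r + 1) with h | h
    · rw [abs_sub_comm]
      have := outside_nonneg r x
      have h2 : 0 ≤ 2 * R * outside r x := by positivity
      linarith [hi x h]
    · rw [outside_eq_one h.le]
      linarith [abs_sub (f x) (φ R i x), hfR x, hφb R i x]
  obtain ⟨N₁, hN₁⟩ := (Metric.tendsto_atTop'.1 (hz R i)) δ hδpos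
  obtain ⟨N₂, hN₂⟩ := eventually_atTop.1 (hr₀ r hrr)
  refine ⟨max N₁ N₂, fun N hN => ?_⟩
  have h1 : |avg (fun n => f (z N n)) - avg (fun n => φ R i (z N n))| ≤ δ + 2 * R * δ := by
    rw [← avg_sub]
    refine (abs_avg_le _).trans ((avg_mono fun n => hpt _).trans ?_)
    rw [avg_add, avg_const_mul]
    gcongr
    · exact avg_const_le hδpos.le
    · exact (avg_mono fun n => min_le_right _ _).trans (hN₂ N ((le_max_right _ _).trans hN.le))
  have h2 := hN₁ N ((le_max_left _ _).trans_lt hN)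
  have h3 : |∫ x, φ R i x ∂μ - ∫ x, f x ∂μ| ≤ δ + 2 * R * δ := by
    rw [abs_sub_comm, ← integral_sub (bcf_integrable μ f) (bcf_integrable μ _)]
    have hint := ((bcf_integrable μ f).sub (bcf_integrable μ (φ R i))).abs
    refine abs_integral_le_integral_abs.trans ((integral_mono hint
      ((integrable_const δ).add ((integrable_outside μ r).const_mul (2 * R))) hpt).trans ?_)
    rw [integral_add' (integrable_const δ) ((integrable_outside μ r).const_mul _),
      integral_const_mul]
    simp only [integral_const, probReal_univ, one_smul]
    gcongr
  rw [Real.dist_eq] at h2 ⊢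
  rw [abs_le] at h1 h3
  rw [abs_lt] at h2 ⊢
  constructor <;> nlinarith [h1.1, h1.2, h2.1, h2.2, h3.1, h3.2]

/-- A continuous square-integrable function is approximated in mean square by the family. -/
lemma exists_integral_sq_sub_le {φ : ℕ → ℕ → (E →ᵇ ℝ)} (hφb : ∀ R i x, |φ R i x| ≤ R)
    (hφ : ∀ (R : ℕ) (f : E → ℝ), Continuous f → (∀ x, |f x| ≤ R) → ∀ ρ ε : ℝ, 0 < ε →
        ∃ i, ∀ x, ‖x‖ ≤ ρ → |φ R i x - f x| ≤ ε)
    {μ : Measure E} [IsProbabilityMeasure μ] {f : E → ℝ} (hf : Continuous f)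
    (hf2 : Integrable (fun x => f x ^ 2) μ) {ε : ℝ} (hε : 0 < ε) :
    ∃ R i, ∫ x, (f x - φ R i x) ^ 2 ∂μ ≤ ε := by
  have hlim : Tendsto (fun R : ℕ => ∫ x, (f x - clip R (f x)) ^ 2 ∂μ) atTop
      (𝓝 (∫ _, (0 : ℝ) ∂μ)) := by
    refine tendsto_integral_of_dominated_convergence (fun x => f x ^ 2)
      (fun R => ((hf.sub ((continuous_clip _).comp hf)).pow 2).aestronglyMeasurable) hf2
      (fun R => .of_forall fun x => ?_) (.of_forall fun x => ?_)
    · rw [Real.norm_of_nonneg (sq_nonneg _)]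
      exact sq_le_sq.2 (abs_sub_clip_le_abs (Nat.cast_nonneg R))
    · refine tendsto_const_nhds.congr' ?_
      filter_upwards [eventually_ge_atTop ⌈|f x|⌉₊] with R hR
      rw [clip_of_abs_le ((Nat.le_ceil _).trans (by exact_mod_cast hR))]
      simp
  rw [integral_zero] at hlim
  -- With $(a+b)^2\le2a^2+2b^2$: truncation costs $\varepsilon/4$ in mean square, and the family
  -- approximates the truncation up to $\varepsilon/8$ inside a ball and $\varepsilon/8$ outside.
  obtain ⟨R, hR⟩ := (hlim.eventually_le_const (show 0 < ε / 4 by positivity)).exists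
  have hcl : Continuous fun x => clip R (f x) := (continuous_clip _).comp hf
  have hclb : ∀ x, |clip R (f x)| ≤ R := fun x => abs_clip_le (Nat.cast_nonneg R) _
  have hlim2 : Tendsto (fun r => 4 * (R : ℝ) ^ 2 * ∫ x, outside r x ∂μ) atTop (𝓝 0) := by
    simpa using (tendsto_integral_outside μ).const_mul (4 * (R : ℝ) ^ 2)
  obtain ⟨r, hr⟩ := (hlim2.eventually_le_const (show 0 < ε / 8 by positivity)).exists
  obtain ⟨i, hi⟩ := hφ R _ hcl hclb (r + 1) (√(ε / 8)) (by positivity)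
  refine ⟨R, i, ?_⟩
  have hpt (x : E) : (clip R (f x) - φ R i x) ^ 2 ≤ ε / 8 + 4 * (R : ℝ) ^ 2 * outside r x := by
    rcases le_or_gt ‖x‖ (r + 1) with h | h
    · have h1 := hi x h
      rw [abs_sub_comm] at h1
      have h2 : (clip R (f x) - φ R i x) ^ 2 ≤ (√(ε / 8)) ^ 2 := by
        rw [sq_le_sq, abs_of_nonneg (Real.sqrt_nonneg _)]; exact h1
      rw [Real.sq_sqrt (by positivity)] at h2
      have h3 : 0 ≤ 4 * (R : ℝ) ^ 2 * outside r x := by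
        have := outside_nonneg r x
        positivity
      linarith
    · rw [outside_eq_one h.le]
      have h1 : |clip R (f x) - φ R i x| ≤ |2 * (R : ℝ)| := by
        rw [abs_of_nonneg (by positivity : (0 : ℝ) ≤ 2 * R)]
        linarith [abs_sub (clip R (f x)) (φ R i x), hclb x, hφb R i x]
      have := sq_le_sq.2 h1
      nlinarith
  have hd1 : Integrable (fun x => (f x - clip R (f x)) ^ 2) μ :=
    hf2.mono' ((hf.sub hcl).pow 2).aestronglyMeasurable (.of_forall fun x => by
      rw [Real.norm_of_nonneg (sq_nonneg _)]
      exact sq_le_sq.2 (abs_sub_clip_le_abs (Nat.cast_nonneg R)))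
  have hdom : Integrable (fun x => ε / 8 + 4 * (R : ℝ) ^ 2 * outside r x) μ :=
    (integrable_const _).add ((integrable_outside μ r).const_mul _)
  calc ∫ x, (f x - φ R i x) ^ 2 ∂μ
      ≤ ∫ x, (2 * (f x - clip R (f x)) ^ 2
          + 2 * (ε / 8 + 4 * (R : ℝ) ^ 2 * outside r x)) ∂μ := by
        refine integral_mono_of_nonneg (.of_forall fun x => sq_nonneg _)
          ((hd1.const_mul 2).add (hdom.const_mul 2)) (.of_forall fun x => ?_)
        have := hpt x
        simp only
        nlinarith [sq_nonneg ((f x - clip R (f x)) - (clip R (f x) - φ R i x))]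
    _ = 2 * (∫ x, (f x - clip R (f x)) ^ 2 ∂μ)
          + 2 * (ε / 8 + 4 * (R : ℝ) ^ 2 * ∫ x, outside r x ∂μ) := by
        rw [integral_add (hd1.const_mul 2) (hdom.const_mul 2), integral_const_mul,
          integral_const_mul, integral_add (integrable_const _)
            ((integrable_outside μ r).const_mul _), integral_const_mul]
        simp
    _ ≤ ε := by linarith

set_option maxHeartbeats 800000 in
/-- Convergence of weighted averages of locally uniformly convergent functions, when the weights
are bounded in mean square. -/
lemma WeakConv.tendsto_avg_mul_continuousMap [ProperSpace E]
    {φ : ℕ → ℕ → (E →ᵇ ℝ)} (hφb : ∀ R i x, |φ R i x| ≤ R)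
    (hφ : ∀ (R : ℕ) (f : E → ℝ), Continuous f → (∀ x, |f x| ≤ R) → ∀ ρ ε : ℝ, 0 < ε →
        ∃ i, ∀ x, ‖x‖ ≤ ρ → |φ R i x - f x| ≤ ε)
    {z : ∀ N, Fin N → E} {μ : Measure E} [IsProbabilityMeasure μ]
    (hz : WeakConv z μ) {h : E → ℝ} (hc : Continuous h) (hn : ∀ x, ‖x‖ ≤ h x)
    (hu : UnifInt fun N n => h (z N n)) {a : ∀ N, Fin N → ℝ} {A : ℝ}
    (ha : ∀ᶠ N in atTop, avg (fun n => a N n ^ 2) ≤ A) {b : E → ℝ} (hb : Continuous b)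
    (hb2 : Integrable (fun x => b x ^ 2) μ)
    (hab : ∀ R i, Tendsto (fun N => avg fun n => a N n * φ R i (z N n)) atTop
      (𝓝 (∫ x, b x * φ R i x ∂μ)))
    {l : Filter ℕ} (hl : l ≤ atTop) {F : ℕ → C(E, ℝ)}
    {F₀ : C(E, ℝ)} (hF : Tendsto F l (𝓝 F₀)) (hFh : ∀ N x, F N x ^ 2 ≤ h x) :
    Tendsto (fun N => avg fun n => a N n * F N (z N n)) l (𝓝 (∫ x, b x * F₀ x ∂μ)) := by
  rcases l.eq_or_neBot with rfl | hne
  · simp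
  have hF₀ : ∀ x, F₀ x ^ 2 ≤ h x := fun x =>
    le_of_tendsto' ((((continuous_eval_const x).tendsto F₀).comp hF).pow 2) fun N => hFh N x
  have hh := hz.integrable hc (fun x => (norm_nonneg x).trans (hn x)) hu
  have hF₀2 : Integrable (fun x => F₀ x ^ 2) μ :=
    hh.mono' (F₀.continuous.pow 2).aestronglyMeasurable (.of_forall fun x => by
      rw [Real.norm_of_nonneg (sq_nonneg _)]; exact hF₀ x)
  set B := ∫ x, b x ^ 2 ∂μ with hB
  have hB0 : 0 ≤ B := integral_nonneg fun x => sq_nonneg _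
  rw [Metric.tendsto_nhds]
  intro ε hε
  -- The weighted averages of $F_N$ are compared with those of a fixed member $G$ of the family,
  -- close to $F_0$ in mean square. The three errors add up to at most $\delta(|A|/2+B/2+3)$.
  set δ := ε / (|A| + B + 10) with hδ
  have hδpos : 0 < δ := by positivity
  have hδε : δ * (|A| + B + 10) = ε := by rw [hδ]; field_simp
  obtain ⟨R, i, hRi⟩ := exists_integral_sq_sub_le hφb hφ F₀.continuous hF₀2
    (show 0 < δ ^ 2 by positivity)
  set G : C(E, ℝ) := ⟨φ R i, (φ R i).continuous⟩ with hG
  have hGb : ∀ x, G x ^ 2 ≤ (R : ℝ) ^ 2 := fun x =>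
    sq_le_sq.2 ((hφb R i x).trans (le_abs_self _))
  -- The squared difference is itself a locally uniformly convergent dominated test function, so the
  -- unweighted statement bounds the empirical mean square of $F_N-G$ by $2\delta^2$.
  have hT : Tendsto (fun N => (F N - G) * (F N - G)) l (𝓝 ((F₀ - G) * (F₀ - G))) :=
    (hF.sub_const G).mul (hF.sub_const G)
  have hu' : UnifInt fun N n => 2 * h (z N n) + 2 * (R : ℝ) ^ 2 :=
    (hu.const_mul (by norm_num : (0 : ℝ) ≤ 2)).add (unifInt_const _)
  have hn' (x : E) : ‖x‖ ≤ 2 * h x + 2 * (R : ℝ) ^ 2 := by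
    have := hn x
    have := norm_nonneg x
    nlinarith [sq_nonneg (R : ℝ)]
  have hbd (N : ℕ) (x : E) : |((F N - G) * (F N - G)) x| ≤ 2 * h x + 2 * (R : ℝ) ^ 2 := by
    change |(F N x - G x) * (F N x - G x)| ≤ _
    rw [abs_mul_self]
    nlinarith [hFh N x, hGb x, sq_nonneg (F N x + G x)]
  have hsq := hz.tendsto_avg_continuousMap (h := fun x => 2 * h x + 2 * (R : ℝ) ^ 2)
    (by fun_prop) hn' hu' hl hT hbd
  have hsq' : ∀ᶠ N in l, avg (fun n => (F N (z N n) - G (z N n)) ^ 2) ≤ 2 * δ ^ 2 := by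
    have h2 : ∫ x, ((F₀ - G) * (F₀ - G)) x ∂μ < 2 * δ ^ 2 := by
      have h3 : ∫ x, ((F₀ - G) * (F₀ - G)) x ∂μ = ∫ x, (F₀ x - φ R i x) ^ 2 ∂μ :=
        integral_congr_ae (.of_forall fun x => (sq (F₀ x - φ R i x)).symm)
      rw [h3]
      exact hRi.trans_lt (by nlinarith [sq_pos_of_pos hδpos])
    filter_upwards [hsq.eventually_lt_const h2] with N hN
    refine le_of_eq_of_le ?_ hN.le
    congr 1
    funext n
    exact sq (F N (z N n) - G (z N n))
  have hG' := (hab R i).mono_left hl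
  rw [Metric.tendsto_nhds] at hG'
  filter_upwards [hsq', hG' δ hδpos, hl ha] with N h1 h2 h3
  have e1 : |avg (fun n => a N n * F N (z N n)) - avg (fun n => a N n * G (z N n))|
      ≤ δ * A / 2 + δ := by
    rw [← avg_sub]
    calc _ ≤ avg (fun n => |a N n * F N (z N n) - a N n * G (z N n)|) := abs_avg_le _
      _ ≤ avg (fun n => δ / 2 * a N n ^ 2
            + 1 / (2 * δ) * (F N (z N n) - G (z N n)) ^ 2) := avg_mono fun n => by
          rw [← mul_sub]
          refine (abs_mul_le_young hδpos _ _).trans_eq ?_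
          ring
      _ ≤ δ / 2 * A + 1 / (2 * δ) * (2 * δ ^ 2) := by
          rw [avg_add, avg_const_mul, avg_const_mul]
          gcongr
      _ = δ * A / 2 + δ := by field_simp
  have hGi : Integrable (fun x => b x * G x) μ := by
    have := hb2.add (integrable_const ((R : ℝ) ^ 2))
    refine this.mono' (hb.mul G.continuous).aestronglyMeasurable (.of_forall fun x => ?_)
    rw [Real.norm_eq_abs, abs_mul]
    simp only [Pi.add_apply]
    nlinarith [sq_abs (b x), sq_abs (G x), hGb x, sq_nonneg (|b x| - |G x|), sq_nonneg (b x)]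
  have hFi : Integrable (fun x => b x * F₀ x) μ := by
    refine (hb2.add hF₀2).mono' (hb.mul F₀.continuous).aestronglyMeasurable
      (.of_forall fun x => ?_)
    rw [Real.norm_eq_abs, abs_mul]
    simp only [Pi.add_apply]
    nlinarith [sq_abs (b x), sq_abs (F₀ x), sq_nonneg (|b x| - |F₀ x|), sq_nonneg (b x),
      sq_nonneg (F₀ x)]
  have hdi : Integrable (fun x => (F₀ x - G x) ^ 2) μ := by
    refine ((hF₀2.const_mul 2).add (integrable_const (2 * (R : ℝ) ^ 2))).mono'
      ((F₀.continuous.sub G.continuous).pow 2).aestronglyMeasurable (.of_forall fun x => ?_)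
    rw [Real.norm_of_nonneg (sq_nonneg _)]
    simp only [Pi.add_apply]
    nlinarith [hGb x, sq_nonneg (F₀ x + G x)]
  have e3 : |∫ x, b x * G x ∂μ - ∫ x, b x * F₀ x ∂μ| ≤ δ * B / 2 + δ := by
    rw [abs_sub_comm, ← integral_sub hFi hGi]
    calc _ ≤ ∫ x, |b x * F₀ x - b x * G x| ∂μ := abs_integral_le_integral_abs
      _ ≤ ∫ x, (δ / 2 * b x ^ 2 + 1 / (2 * δ) * (F₀ x - G x) ^ 2) ∂μ := by
          refine integral_mono (hFi.sub hGi).abs ((hb2.const_mul _).add (hdi.const_mul _))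
            fun x => ?_
          simp only
          rw [← mul_sub]
          refine (abs_mul_le_young hδpos _ _).trans_eq ?_
          ring
      _ = δ / 2 * B + 1 / (2 * δ) * ∫ x, (F₀ x - G x) ^ 2 ∂μ := by
          rw [integral_add (hb2.const_mul _) (hdi.const_mul _), integral_const_mul,
            integral_const_mul]
      _ ≤ δ / 2 * B + 1 / (2 * δ) * δ ^ 2 := by gcongr; exact hRi
      _ ≤ δ * B / 2 + δ := by
          have : 1 / (2 * δ) * δ ^ 2 = δ / 2 := by field_simp
          rw [this]; linarith
  rw [Real.dist_eq] at h2 ⊢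
  change |avg (fun n => a N n * G (z N n)) - ∫ x, b x * G x ∂μ| < δ at h2
  have hA : δ * A ≤ δ * |A| := by gcongr; exact le_abs_self A
  have hA' : 0 ≤ δ * |A| := by positivity
  have hB' : 0 ≤ δ * B := by positivity
  rw [abs_le] at e1 e3
  rw [abs_lt] at h2 ⊢
  constructor <;> nlinarith [e1.1, e1.2, h2.1, h2.2, e3.1, e3.2]

end Empirical

/-! ### Fourth moments of sums of independent centred variables. -/

section FourthMoment

variable {Ω : Type*} [MeasurableSpace Ω] {P : Measure Ω} [IsProbabilityMeasure P]

lemma integrable_pow_of_pow_four {f : Ω → ℝ} (hf : Measurable f)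
    (h4 : Integrable (fun ω => f ω ^ 4) P) {a : ℕ} (ha : a ≤ 4) :
    Integrable (fun ω => f ω ^ a) P := by
  refine ((integrable_const (1 : ℝ)).add h4).mono' (hf.pow_const a).aestronglyMeasurable
    (.of_forall fun ω => ?_)
  rw [norm_pow, Real.norm_eq_abs, Pi.add_apply]
  rw [← Even.pow_abs (by decide : Even 4) (f ω)]
  have h0 := abs_nonneg (f ω)
  rcases le_total |f ω| 1 with h | h
  · linarith [pow_le_one₀ (n := a) h0 h, pow_nonneg h0 4]
  · linarith [pow_le_pow_right₀ h ha]

/-- The fourth moment of a sum of independent centred variables. -/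
lemma integral_sum_pow_four_le {ι : Type*} {Y : ι → Ω → ℝ} (hi : iIndepFun Y P)
    (hm : ∀ i, Measurable (Y i)) (h4 : ∀ i, Integrable (fun ω => Y i ω ^ 4) P)
    (h0 : ∀ i, ∫ ω, Y i ω ∂P = 0) {v : ι → ℝ} (hv2 : ∀ i, ∫ ω, Y i ω ^ 2 ∂P ≤ v i)
    (hv4 : ∀ i, ∫ ω, Y i ω ^ 4 ∂P ≤ 3 * v i ^ 2) (s : Finset ι) :
    Integrable (fun ω => (∑ i ∈ s, Y i ω) ^ 4) P ∧ ∫ ω, (∑ i ∈ s, Y i ω) ∂P = 0 ∧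
      ∫ ω, (∑ i ∈ s, Y i ω) ^ 2 ∂P ≤ ∑ i ∈ s, v i ∧
      ∫ ω, (∑ i ∈ s, Y i ω) ^ 4 ∂P ≤ 3 * (∑ i ∈ s, v i) ^ 2 := by
  classical
  have hv0 (i : ι) : 0 ≤ v i := (integral_nonneg fun ω => sq_nonneg _).trans (hv2 i)
  induction s using Finset.induction_on with
  | empty => simp
  | insert j s hj ih =>
    obtain ⟨i4, e1, e2, e4⟩ := ih
    set S : Ω → ℝ := fun ω => ∑ i ∈ s, Y i ω with hS
    have hSm : Measurable S := Finset.measurable_sum _ fun i _ => hm i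
    have hind : IndepFun S (Y j) P := by
      have := hi.indepFun_finsetSum_of_notMem hm hj
      convert this using 1
      ext ω
      simp [hS]
    have hprod (a b : ℕ) : IndepFun (fun ω => S ω ^ a) (fun ω => Y j ω ^ b) P :=
      hind.comp (φ := fun x => x ^ a) (ψ := fun x => x ^ b) (by fun_prop) (by fun_prop)
    have hSi {a : ℕ} (ha : a ≤ 4) := integrable_pow_of_pow_four hSm i4 ha
    have hYi {a : ℕ} (ha : a ≤ 4) := integrable_pow_of_pow_four (hm j) (h4 j) ha
    have hpi {a b : ℕ} (ha : a ≤ 4) (hb : b ≤ 4) :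
        Integrable (fun ω => S ω ^ a * Y j ω ^ b) P :=
      (hprod a b).integrable_mul (hSi ha) (hYi hb)
    have hpe (a b : ℕ) : ∫ ω, S ω ^ a * Y j ω ^ b ∂P
        = (∫ ω, S ω ^ a ∂P) * ∫ ω, Y j ω ^ b ∂P :=
      (hprod a b).integral_mul_eq_mul_integral (hSm.pow_const a).aestronglyMeasurable
        ((hm j).pow_const b).aestronglyMeasurable
    have hsum (ω : Ω) : ∑ i ∈ insert j s, Y i ω = S ω + Y j ω := by
      rw [Finset.sum_insert hj, add_comm]
    simp only [hsum, Finset.sum_insert hj]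
    have hS1 : ∫ ω, S ω ∂P = 0 := e1
    -- The terms $S^3Y$ and $SY^3$ have mean zero. With $s=\sum_i v_i$ what remains is at most
    -- $3s^2+6sv_j+3v_j^2=3(s+v_j)^2$, so the constant $3$ reproduces itself.
    have x4 (ω : Ω) : (S ω + Y j ω) ^ 4 = S ω ^ 4 * Y j ω ^ 0 + 4 * (S ω ^ 3 * Y j ω ^ 1)
        + 6 * (S ω ^ 2 * Y j ω ^ 2) + 4 * (S ω ^ 1 * Y j ω ^ 3) + S ω ^ 0 * Y j ω ^ 4 := by ring
    have x2 (ω : Ω) : (S ω + Y j ω) ^ 2 = S ω ^ 2 * Y j ω ^ 0 + 2 * (S ω ^ 1 * Y j ω ^ 1)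
        + S ω ^ 0 * Y j ω ^ 2 := by ring
    have j1 := hpi (a := 4) (b := 0) (by norm_num) (by norm_num)
    have j2 := (hpi (a := 3) (b := 1) (by norm_num) (by norm_num)).const_mul 4
    have j3 := (hpi (a := 2) (b := 2) (by norm_num) (by norm_num)).const_mul 6
    have j4 := (hpi (a := 1) (b := 3) (by norm_num) (by norm_num)).const_mul 4
    have j5 := hpi (a := 0) (b := 4) (by norm_num) (by norm_num)
    have k1 := hpi (a := 2) (b := 0) (by norm_num) (by norm_num)
    have k2 := (hpi (a := 1) (b := 1) (by norm_num) (by norm_num)).const_mul 2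
    have k3 := hpi (a := 0) (b := 2) (by norm_num) (by norm_num)
    have h0j := h0 j
    refine ⟨?_, ?_, ?_, ?_⟩
    · simp only [x4]
      exact (((j1.add j2).add j3).add j4).add j5
    · rw [integral_add (by simpa using hSi (a := 1) (by norm_num))
        (by simpa using hYi (a := 1) (by norm_num)), hS1, h0 j, add_zero]
    · simp only [x2]
      rw [integral_add (by exact k1.add k2) k3, integral_add k1 k2, integral_const_mul, hpe, hpe,
        hpe]
      simp only [pow_one, pow_zero, hS1, h0j, integral_const, probReal_univ, smul_eq_mul]
      linarith [hv2 j]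
    · simp only [x4]
      rw [integral_add (by exact ((j1.add j2).add j3).add j4) j5,
        integral_add (by exact (j1.add j2).add j3) j4, integral_add (by exact j1.add j2) j3,
        integral_add j1 j2, integral_const_mul, integral_const_mul,
        integral_const_mul, hpe, hpe, hpe, hpe, hpe]
      simp only [pow_one, pow_zero, hS1, h0j, integral_const, probReal_univ, smul_eq_mul]
      have hsv : 0 ≤ ∑ i ∈ s, v i := Finset.sum_nonneg fun i _ => hv0 i
      have : (∫ ω, S ω ^ 2 ∂P) * ∫ ω, Y j ω ^ 2 ∂P ≤ (∑ i ∈ s, v i) * v j :=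
        mul_le_mul e2 (hv2 j) (integral_nonneg fun ω => sq_nonneg _) hsv
      nlinarith [hv4 j]

end FourthMoment

/-! ### Almost sure convergence for triangular arrays without any coupling assumption. -/

section Concentration

/-- Tail bound for the weighted averages of independent centred variables. -/
lemma measure_avg_ge_le {E : Type*} [MeasurableSpace E] (μ : Measure E) [IsProbabilityMeasure μ]
    {N : ℕ} (F : Fin N → E → ℝ) (hF : ∀ n, Measurable (F n))
    (h4 : ∀ n, Integrable (fun x => F n x ^ 4) μ) (h0 : ∀ n, ∫ x, F n x ∂μ = 0) {m : ℝ}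
    (hm2 : ∀ n, ∫ x, F n x ^ 2 ∂μ ≤ m) (hm4 : ∀ n, ∫ x, F n x ^ 4 ∂μ ≤ 3 * m ^ 2)
    (a : Fin N → ℝ) {A : ℝ} (hA : avg (fun n => a n ^ 2) ≤ A) {ε : ℝ} (hε : 0 < ε) :
    (Measure.pi fun _ : Fin N => μ) {x | ε ≤ |avg fun n => a n * F n (x n)|}
      ≤ ENNReal.ofReal (3 * A ^ 2 * m ^ 2 / ε ^ 4 * (1 / (N : ℝ) ^ 2)) := by
  rcases Nat.eq_zero_or_pos N with rfl | hN
  · have : {x : Fin 0 → E | ε ≤ |avg fun n => a n * F n (x n)|} = ∅ := by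
      ext x
      simp [avg, hε]
    simp [this]
  have hNR : (0 : ℝ) < N := by exact_mod_cast hN
  set Q := Measure.pi fun _ : Fin N => μ
  have hi : iIndepFun (fun (n : Fin N) (x : Fin N → E) => a n * F n (x n)) Q :=
    iIndepFun_pi (X := fun n x => a n * F n x) fun n => ((hF n).const_mul _).aemeasurable
  have hmeas (n : Fin N) : Measurable fun x : Fin N → E => a n * F n (x n) := by
    have := hF n
    fun_prop
  have hmp (n : Fin N) : MeasurePreserving (fun x : Fin N → E => x n) Q μ :=
    measurePreserving_eval (fun _ : Fin N => μ) n
  have hint (n : Fin N) (f : E → ℝ) (hf : Measurable f) :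
      ∫ x, f (x n) ∂Q = ∫ y, f y ∂μ := by
    rw [← (hmp n).map_eq, integral_map (hmp n).measurable.aemeasurable
      hf.aestronglyMeasurable]
  have h4' (n : Fin N) : Integrable (fun x : Fin N → E => (a n * F n (x n)) ^ 4) Q := by
    have := (hmp n).integrable_comp_of_integrable ((h4 n).const_mul (a n ^ 4))
    simpa [mul_pow, Function.comp_def] using this
  obtain ⟨i4, -, -, e4⟩ := integral_sum_pow_four_le hi hmeas h4'
    (fun n => by
      rw [hint n (fun y => a n * F n y) ((hF n).const_mul _), integral_const_mul, h0, mul_zero])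
    -- The variance bounds sum to at most $NAm$, so Markov at order four gives
    -- $3(NAm)^2/(\varepsilon N)^4$, which is summable in $N$.
    (v := fun n => a n ^ 2 * m)
    (fun n => by
      rw [hint n (fun y => (a n * F n y) ^ 2) (((hF n).const_mul _).pow_const 2)]
      simp only [mul_pow]
      rw [integral_const_mul]
      gcongr
      exact hm2 n)
    (fun n => by
      rw [hint n (fun y => (a n * F n y) ^ 4) (((hF n).const_mul _).pow_const 4)]
      simp only [mul_pow]
      rw [integral_const_mul]
      calc _ ≤ a n ^ 4 * (3 * m ^ 2) := by gcongr; exact hm4 n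
        _ = _ := by ring) Finset.univ
  have hm0 : 0 ≤ m := (integral_nonneg fun x => sq_nonneg _).trans (hm2 ⟨0, hN⟩)
  have hsum : ∑ n, a n ^ 2 * m ≤ N * A * m := by
    rw [← Finset.sum_mul]
    gcongr
    rw [avg, div_le_iff₀ hNR] at hA
    linarith
  have hsum0 : 0 ≤ ∑ n, a n ^ 2 * m := Finset.sum_nonneg fun n _ => by positivity
  have hsub : {x : Fin N → E | ε ≤ |avg fun n => a n * F n (x n)|}
      ⊆ {x | (ε * N) ^ 4 ≤ (∑ n, a n * F n (x n)) ^ 4} := by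
    intro x hx
    simp only [Set.mem_ofPred_eq, avg, abs_div, Nat.abs_cast] at hx ⊢
    rw [le_div_iff₀ hNR] at hx
    rw [← Even.pow_abs (by decide : Even 4) (∑ n, a n * F n (x n))]
    gcongr
  have hmk := mul_meas_ge_le_integral_of_nonneg (μ := Q)
    (f := fun x => (∑ n, a n * F n (x n)) ^ 4)
    (.of_forall fun x => Even.pow_nonneg (by decide) _) i4 ((ε * N) ^ 4)
  have hpos : 0 < (ε * N) ^ 4 := by positivity
  refine (measure_mono hsub).trans ?_
  rw [← ofReal_measureReal]
  refine ENNReal.ofReal_le_ofReal ?_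
  have h5 : Q.real {x | (ε * N) ^ 4 ≤ (∑ n, a n * F n (x n)) ^ 4} ≤
      3 * (N * A * m) ^ 2 / (ε * N) ^ 4 := by
    rw [le_div_iff₀ hpos, mul_comm]
    refine hmk.trans (e4.trans ?_)
    gcongr
  refine h5.trans_eq ?_
  field_simp

/-- **Averages of independent centred variables tend to zero almost surely**, whatever the coupling
between different system sizes. -/
lemma ae_tendsto_avg_zero {Ω : Type*} [MeasurableSpace Ω] {P : Measure Ω} [IsProbabilityMeasure P]
    {E : Type*} [MeasurableSpace E] (μ : Measure E) [IsProbabilityMeasure μ]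
    {D : ℕ → Type*} [∀ N, MeasurableSpace (D N)] {δ : ∀ N, Measure (D N)}
    [∀ N, IsProbabilityMeasure (δ N)] {ξ : ∀ N, Ω → Fin N → E} {d : ∀ N, Ω → D N}
    (hlaw : ∀ N, HasLaw (fun ω => (d N ω, ξ N ω)) ((δ N).prod (Measure.pi fun _ => μ)) P)
    {F : ∀ N, D N → Fin N → E → ℝ}
    (hF : ∀ N n, Measurable fun p : D N × E => F N p.1 n p.2) {m : ℝ}
    (h4 : ∀ N e n, Integrable (fun x => F N e n x ^ 4) μ) (h0 : ∀ N e n, ∫ x, F N e n x ∂μ = 0)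
    (hm2 : ∀ N e n, ∫ x, F N e n x ^ 2 ∂μ ≤ m) (hm4 : ∀ N e n, ∫ x, F N e n x ^ 4 ∂μ ≤ 3 * m ^ 2)
    {a : ∀ N, D N → Fin N → ℝ} (ham : ∀ N n, Measurable fun e => a N e n)
    (ha : ∀ᵐ ω ∂P, ∃ A : ℝ, ∀ᶠ N in atTop, avg (fun n => a N (d N ω) n ^ 2) ≤ A) :
    ∀ᵐ ω ∂P, Tendsto (fun N => avg fun n => a N (d N ω) n * F N (d N ω) n (ξ N ω n)) atTop
      (𝓝 0) := by
  -- The bound on the weights is part of the event, so given the data either the event is empty or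
  -- the tail bound applies. Fubini and Borel-Cantelli follow; only the law for each single $N$
  -- matters. Integer $A$ and $r$ keep the exceptional sets countable in number.
  have key (A r : ℕ) : ∀ᵐ ω ∂P, ∀ᶠ N in atTop, ¬ (avg (fun n => a N (d N ω) n ^ 2) ≤ A ∧
      1 / (r + 1 : ℝ) ≤ |avg fun n => a N (d N ω) n * F N (d N ω) n (ξ N ω n)|) := by
    set ε : ℝ := 1 / (r + 1) with hε
    have hεpos : 0 < ε := by positivity
    set C : ℝ := 3 * (A : ℝ) ^ 2 * m ^ 2 / ε ^ 4 with hC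
    have hC0 : 0 ≤ C := by positivity
    refine ae_eventually_notMem (μ := P) (s := fun N => {ω |
      avg (fun n => a N (d N ω) n ^ 2) ≤ A ∧
      ε ≤ |avg fun n => a N (d N ω) n * F N (d N ω) n (ξ N ω n)|}) (ne_of_lt ?_)
    have hbound (N : ℕ) : P {ω | avg (fun n => a N (d N ω) n ^ 2) ≤ A ∧
        ε ≤ |avg fun n => a N (d N ω) n * F N (d N ω) n (ξ N ω n)|}
        ≤ ENNReal.ofReal (C * (1 / (N : ℝ) ^ 2)) := by
      set B : Set (D N × (Fin N → E)) := {p | avg (fun n => a N p.1 n ^ 2) ≤ A ∧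
        ε ≤ |avg fun n => a N p.1 n * F N p.1 n (p.2 n)|}
      have hBm : MeasurableSet B := by
        have h1 : Measurable fun p : D N × (Fin N → E) => avg fun n => a N p.1 n ^ 2 := by
          unfold avg
          refine (Finset.measurable_sum _ fun n _ => ?_).div_const _
          exact ((ham N n).comp measurable_fst).pow_const 2
        have h2 : Measurable fun p : D N × (Fin N → E) =>
            avg fun n => a N p.1 n * F N p.1 n (p.2 n) := by
          unfold avg
          refine (Finset.measurable_sum _ fun n _ => ?_).div_const _
          refine ((ham N n).comp measurable_fst).mul ?_
          exact (hF N n).comp (measurable_fst.prodMk ((measurable_pi_apply n).comp measurable_snd))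
        exact (measurableSet_le h1 measurable_const).inter
          (measurableSet_le measurable_const (measurable_norm.comp h2))
      have h1 : P {ω | avg (fun n => a N (d N ω) n ^ 2) ≤ A ∧
          ε ≤ |avg fun n => a N (d N ω) n * F N (d N ω) n (ξ N ω n)|}
          = ((δ N).prod (Measure.pi fun _ => μ)) B := by
        rw [← (hlaw N).map_eq, Measure.map_apply_of_aemeasurable (hlaw N).aemeasurable hBm]
        rfl
      rw [h1, Measure.prod_apply hBm]
      calc _ ≤ ∫⁻ _, ENNReal.ofReal (C * (1 / (N : ℝ) ^ 2)) ∂(δ N) := by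
            refine lintegral_mono fun e => ?_
            by_cases hA : avg (fun n => a N e n ^ 2) ≤ A
            · refine (measure_mono fun x hx => ?_).trans
                (measure_avg_ge_le μ (F N e) (fun n => (hF N n).comp measurable_prodMk_left)
                  (h4 N e) (h0 N e) (hm2 N e) (hm4 N e) (a N e) hA hεpos)
              exact hx.2
            · have : Prod.mk e ⁻¹' B = ∅ := by
                ext x
                simp [B, hA]
              simp [this]
        _ = _ := by simp
    have hsum : Summable fun N : ℕ => C * (1 / (N : ℝ) ^ 2) :=
      (Real.summable_one_div_nat_pow.2 one_lt_two).mul_left C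
    exact (ENNReal.tsum_le_tsum hbound).trans_lt hsum.tsum_ofReal_lt_top
  have key' := ae_all_iff.2 fun A => ae_all_iff.2 fun r => key A r
  filter_upwards [key', ha] with ω hω ⟨A, hA⟩
  rw [Metric.tendsto_nhds]
  intro ε hε
  obtain ⟨r, hr⟩ := exists_nat_one_div_lt hε
  obtain ⟨A', hA'⟩ := exists_nat_ge A
  filter_upwards [hω A' r, hA] with N h1 h2
  rw [Real.dist_eq, sub_zero]
  by_contra hcon
  exact h1 ⟨h2.trans hA', hr.le.trans (not_lt.1 hcon)⟩

end Concentration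

/-- The standard Gaussian measure on `κ → ℝ`. -/
noncomputable abbrev stdPi (κ : Type*) [Fintype κ] : Measure (κ → ℝ) :=
  Measure.pi fun _ => gaussianReal 0 1

/-! ### Linear images of a standard Gaussian vector. -/

section LinearImages

variable {ι κ κ' : Type*} [Fintype κ] [Fintype κ']

/-- The linear map with a given matrix. -/
noncomputable def linMap (L : ι → κ → ℝ) : (κ → ℝ) →L[ℝ] (ι → ℝ) :=
  ContinuousLinearMap.pi fun i => ∑ q, L i q • ContinuousLinearMap.proj q

lemma linMap_apply (L : ι → κ → ℝ) (x : κ → ℝ) (i : ι) : linMap L x i = ∑ q, L i q * x q := by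
  simp [linMap]

lemma charFunDual_stdPi (Λ : StrongDual ℝ (κ → ℝ)) [DecidableEq κ] :
    charFunDual (stdPi κ) Λ = Complex.exp (-(∑ q, Λ (Pi.single q 1) ^ 2 : ℝ) / 2) := by
  rw [charFunDual_pi]
  have (q : κ) : charFunDual (gaussianReal 0 1) (Λ.comp (.single ℝ (fun _ : κ => ℝ) q))
      = Complex.exp (-(Λ (Pi.single q 1) ^ 2 : ℝ) / 2) := by
    rw [charFunDual_eq_charFun_map_one, gaussianReal_map_continuousLinearMap, charFun_gaussianReal]
    congr 1
    simp only [ContinuousLinearMap.comp_apply, ContinuousLinearMap.single_apply,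
      map_zero, mul_one, Real.coe_toNNReal _ (sq_nonneg _)]
    push_cast
    ring
  simp only [this]
  rw [← Complex.exp_sum]
  congr 1
  push_cast
  rw [neg_div, Finset.sum_div, ← Finset.sum_neg_distrib]
  exact Finset.sum_congr rfl fun q _ => by ring

/-- Written as a quadratic form in the Gram matrix of the rows of $L$, so that the law visibly
depends on $L$ only through that matrix. -/
lemma charFunDual_map_linMap [Fintype ι] [DecidableEq ι] (L : ι → κ → ℝ)
    (Λ : StrongDual ℝ (ι → ℝ)) :
    charFunDual ((stdPi κ).map (linMap L)) Λ = Complex.exp (-(∑ i, ∑ j,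
      Λ (Pi.single i 1) * Λ (Pi.single j 1) * ∑ q, L i q * L j q : ℝ) / 2) := by
  classical
  rw [charFunDual_map, charFunDual_stdPi]
  congr 4
  have h1 (q : κ) : (Λ.comp (linMap L)) (Pi.single q 1) = ∑ i, Λ (Pi.single i 1) * L i q := by
    have h2 : linMap L (Pi.single q 1) = ∑ i, L i q • Pi.single i (1 : ℝ) := by
      ext i
      simp [linMap_apply, Finset.sum_apply, Pi.single_apply]
    rw [ContinuousLinearMap.comp_apply, h2, map_sum]
    simp [mul_comm]
  simp only [h1, sq, Finset.sum_mul_sum]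
  rw [Finset.sum_comm]
  refine Finset.sum_congr rfl fun i _ => ?_
  rw [Finset.sum_comm]
  refine Finset.sum_congr rfl fun j _ => ?_
  rw [Finset.mul_sum]
  exact Finset.sum_congr rfl fun q _ => by ring

/-- The law of a linear image of a standard Gaussian vector depends only on the Gram matrix of the
rows. -/
lemma map_linMap_eq [Fintype ι] (L : ι → κ → ℝ) (L' : ι → κ' → ℝ)
    (h : ∀ i j, ∑ q, L i q * L j q = ∑ q, L' i q * L' j q) :
    (stdPi κ).map (linMap L) = (stdPi κ').map (linMap L') := by
  classical
  refine Measure.ext_of_charFunDual ?_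
  ext Λ
  rw [charFunDual_map_linMap, charFunDual_map_linMap]
  simp only [h]

end LinearImages

/-! ### Rotation invariance with adaptively chosen directions. -/

section Adaptive

variable {R J : Type*} [Fintype J]

/-- The action of the matrix with entries `G (i, j)` on the vector `v`. -/
def mulv (G : R × J → ℝ) (v : J → ℝ) : R → ℝ := fun i => ∑ j, G (i, j) * v j

/-- The matrix is $ze^\top+\xi(1-ee^\top)$: along the unit vector $e$ it acts as $z$. On vectors
orthogonal to $e$ it acts as $\xi$, which is the companion lemma. -/
lemma mulv_replace_self {e : J → ℝ} (he : ∑ j, e j * e j = 1) (z : R → ℝ) (ξ : R × J → ℝ) :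
    mulv (fun k : R × J => z k.1 * e k.2 + (ξ k - mulv ξ e k.1 * e k.2)) e = z := by
  ext i
  have : ∀ j, (z i * e j + (ξ (i, j) - mulv ξ e i * e j)) * e j
      = (z i - mulv ξ e i) * (e j * e j) + ξ (i, j) * e j := fun j => by ring
  simp only [mulv, this] at this ⊢
  rw [Finset.sum_add_distrib, ← Finset.mul_sum, he]
  simp

lemma mulv_replace_of_orthogonal {e w : J → ℝ} (h : ∑ j, e j * w j = 0) (z : R → ℝ)
    (ξ : R × J → ℝ) :
    mulv (fun k : R × J => z k.1 * e k.2 + (ξ k - mulv ξ e k.1 * e k.2)) w = mulv ξ w := by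
  ext i
  have : ∀ j, (z i * e j + (ξ (i, j) - mulv ξ e i * e j)) * w j
      = (z i - mulv ξ e i) * (e j * w j) + ξ (i, j) * w j := fun j => by ring
  simp only [mulv, this] at this ⊢
  rw [Finset.sum_add_distrib, ← Finset.mul_sum, h]
  simp

lemma measurable_mulv {X : Type*} [MeasurableSpace X] {G : X → R × J → ℝ} {v : X → J → ℝ}
    (hG : Measurable G) (hv : Measurable v) : Measurable fun x => mulv (G x) (v x) := by
  unfold mulv
  fun_prop

variable [Fintype R]

/-- Replacing the component of a standard Gaussian matrix along a unit vector by an independent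
one. -/
lemma measurePreserving_replace (e : J → ℝ) (he : ∑ j, e j * e j = 1) :
    MeasurePreserving (fun p : (R → ℝ) × (R × J → ℝ) => fun k : R × J =>
      p.1 k.1 * e k.2 + (p.2 k - mulv p.2 e k.1 * e k.2))
      ((stdPi R).prod (stdPi (R × J))) (stdPi (R × J)) := by
  classical
  -- `L` is the coefficient array of the replacement as a linear map of $(z,\xi)$. Within a matrix
  -- row, $ee^\top+(1-ee^\top)^2=1$, so its Gram matrix is the identity, that of `L'`.
  let L : R × J → R ⊕ (R × J) → ℝ := fun k s => Sum.elim (fun i => if k.1 = i then e k.2 else 0)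
    (fun l => if k.1 = l.1 then (if k.2 = l.2 then 1 else 0) - e l.2 * e k.2 else 0) s
  let L' : R × J → R × J → ℝ := fun k l => if k = l then 1 else 0
  have hL : ∀ k l, ∑ q, L k q * L l q = ∑ q, L' k q * L' l q := by
    rintro ⟨i, j⟩ ⟨i', j'⟩
    simp only [L, L', Fintype.sum_sum_type, Sum.elim_inl, Sum.elim_inr, Fintype.sum_prod_type,
      Prod.mk.injEq]
    by_cases hi : i = i'
    · subst hi
      have e1 : ∀ x : J, ((if j = x then (1 : ℝ) else 0) - e x * e j)
          * ((if j' = x then 1 else 0) - e x * e j')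
          = (if j = x then (if j' = x then 1 else 0) else 0)
            - (if j = x then e x * e j' else 0) - (if j' = x then e x * e j else 0)
            + (e x * e x) * (e j * e j') := by
        intro x
        split_ifs <;> ring
      simp [Finset.sum_ite_eq, ite_and, e1, Finset.sum_add_distrib, Finset.sum_sub_distrib,
        ← Finset.sum_mul, he]
      by_cases hj : j = j'
      · subst hj
        simp
      · have hj' : ¬ j' = j := fun h => hj h.symm
        simp [hj, hj']
        ring
    · simp [ite_and, hi, Finset.sum_ite_eq]
  have hlin' : (stdPi (R × J)).map (linMap L') = stdPi (R × J) := by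
    have : (linMap L' : (R × J → ℝ) → R × J → ℝ) = id := by
      ext x k
      simp [linMap_apply, L']
    rw [this, Measure.map_id]
  have h1 : MeasurePreserving (linMap L) (stdPi (R ⊕ (R × J))) (stdPi (R × J)) :=
    ⟨(linMap L).continuous.measurable, by rw [map_linMap_eq L L' hL, hlin']⟩
  have h2 := h1.comp (measurePreserving_sumPiEquivProdPi_symm
    (X := fun _ : R ⊕ (R × J) => ℝ) (fun _ => gaussianReal 0 1))
  convert h2 using 1
  ext p k
  obtain ⟨i, j⟩ := k
  have hr (r : R × J) : (MeasurableEquiv.sumPiEquivProdPi fun _ : R ⊕ R × J => ℝ).symm p (.inr r)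
      = p.2 r := rfl
  have hl (r : R) : (MeasurableEquiv.sumPiEquivProdPi fun _ : R ⊕ R × J => ℝ).symm p (.inl r)
      = p.1 r := rfl
  simp only [Function.comp_apply, linMap_apply, Fintype.sum_sum_type, hl, hr, L, Sum.elim_inl,
    Sum.elim_inr, Fintype.sum_prod_type]
  simp [ite_mul, Finset.sum_ite_eq, mulv, sub_mul, Finset.sum_sub_distrib, Finset.sum_mul]
  congr 1
  · ring
  · congr 1
    exact Finset.sum_congr rfl fun l _ => by ring

/-- **Adaptive orthonormal directions.** If `e j` is an orthonormal system that is chosen adaptively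
from the images of the previous directions under a standard Gaussian matrix, then the images are
independent standard Gaussian vectors. -/
theorem measurePreserving_adaptive (K : ℕ) (e : ℕ → (R × J → ℝ) → J → ℝ)
    (hm : ∀ j < K, Measurable (e j))
    (ho : ∀ G, ∀ i < K, ∀ j < K, ∑ l, e i G l * e j G l = if i = j then 1 else 0)
    (ha : ∀ j < K, ∀ G G', (∀ q < j, mulv G (e q G) = mulv G' (e q G)) → e j G' = e j G) :
    MeasurePreserving (fun G => fun q : Fin K => mulv G (e q G)) (stdPi (R × J))
      (Measure.pi fun _ : Fin K => stdPi R) := by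
  induction K generalizing e with
  | zero =>
    refine ⟨measurable_pi_lambda _ fun q => q.elim0, ?_⟩
    refine (Measure.pi_eq fun s _ => ?_).symm
    have : (Set.univ.pi s : Set (Fin 0 → R → ℝ)) = Set.univ := by
      ext x
      simp
    rw [this, Measure.map_apply (measurable_pi_lambda _ fun q => q.elim0) MeasurableSet.univ]
    simp
  | succ K ih =>
    -- Nothing precedes the first direction, so it is deterministic; its value at the zero matrix is
    -- as good as any.
    set e₀ := e 0 0 with he₀
    have h0 (G : R × J → ℝ) : e 0 G = e₀ := ha 0 K.succ_pos 0 G (by simp)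
    have hunit : ∑ l, e₀ l * e₀ l = 1 := by
      simpa using ho 0 0 K.succ_pos 0 K.succ_pos
    let Θ : (R → ℝ) × (R × J → ℝ) → R × J → ℝ := fun p k =>
      p.1 k.1 * e₀ k.2 + (p.2 k - mulv p.2 e₀ k.1 * e₀ k.2)
    have hΘ : MeasurePreserving Θ ((stdPi R).prod (stdPi (R × J))) (stdPi (R × J)) :=
      measurePreserving_replace e₀ hunit
    have hperp (G : R × J → ℝ) (j : ℕ) (hj : j < K) : ∑ l, e₀ l * e (j + 1) G l = 0 := by
      have := ho G 0 K.succ_pos (j + 1) (by omega)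
      simpa [h0] using this
    have hstep (z : R → ℝ) (ξ : R × J → ℝ) (G : R × J → ℝ) (j : ℕ) (hj : j < K) :
        mulv (Θ (z, ξ)) (e (j + 1) G) = mulv ξ (e (j + 1) G) :=
      mulv_replace_of_orthogonal (hperp G j hj) z ξ
    -- Replace $G$ by $\Theta(z,\xi)$, which has the same law. Its image of $e_0$ is $z$, and on all
    -- later directions it acts as $\xi$.
    let g : (R → ℝ) → (R × J → ℝ) → Fin K → R → ℝ := fun z ξ q =>
      mulv ξ (e (q + 1) (Θ (z, ξ)))
    have hgm : Measurable (Function.uncurry g) := by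
      refine measurable_pi_lambda _ fun q => ?_
      exact measurable_mulv measurable_snd ((hm (q + 1) (by omega)).comp hΘ.measurable)
    have hg (z : R → ℝ) : (stdPi (R × J)).map (g z) = Measure.pi fun _ : Fin K => stdPi R := by
      -- For fixed $z$ the later directions are an adaptive orthonormal system for $\xi$: the image
      -- of $e_0$ is frozen at $z$ and the others are images under $\xi$. Their law does not depend
      -- on $z$, hence the product structure.
      refine (ih (fun j ξ => e (j + 1) (Θ (z, ξ)))
        (fun j hj => (hm (j + 1) (by omega)).comp (hΘ.measurable.comp measurable_prodMk_left))
        (fun ξ i hi j hj => by simpa using ho (Θ (z, ξ)) (i + 1) (by omega) (j + 1) (by omega))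
        (fun j hj ξ ξ' h => ha (j + 1) (by omega) _ _ fun q hq => ?_)).map_eq
      rcases q with _ | q
      · rw [h0]
        exact (mulv_replace_self hunit z ξ).trans (mulv_replace_self hunit z ξ').symm
      · rw [hstep z ξ _ q (by omega), hstep z ξ' _ q (by omega)]
        exact h q (by omega)
    have h1 := (MeasurePreserving.id (stdPi R)).skew_product hgm (.of_forall hg)
    have h2 := ((measurePreserving_piFinSuccAbove (fun _ : Fin (K + 1) => stdPi R) 0).symm).comp h1
    have hmeas : Measurable fun G : R × J → ℝ => fun q : Fin (K + 1) => mulv G (e q G) :=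
      measurable_pi_lambda _ fun q => measurable_mulv measurable_id (hm q q.2)
    refine ⟨hmeas, ?_⟩
    rw [← hΘ.map_eq, Measure.map_map hmeas hΘ.measurable, ← h2.map_eq]
    congr 1
    funext p
    refine funext fun q => ?_
    refine Fin.cases ?_ (fun q => ?_) q
    · simp only [Function.comp_apply, Fin.val_zero, h0]
      exact mulv_replace_self hunit p.1 p.2
    · simp only [Function.comp_apply, Fin.val_succ]
      exact hstep p.1 p.2 _ q q.2

end Adaptive

/-! ### The Gaussian inputs as one standard Gaussian matrix. -/

section NoiseLaw

variable {T M : ℕ}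

/-- The indices of the columns of all Gaussian inputs: columns of `A`, columns of the `B_t`, and
the noise vectors. -/
abbrev NoiseCols (T N : ℕ) := (Fin N ⊕ (Fin T × Fin N)) ⊕ Fin T

/-- The means of the Gaussian inputs. -/
noncomputable def noiseMean (θ : Params T M) (N : ℕ) : NoiseCols T N → ℝ :=
  Sum.elim (Sum.elim (fun _ => θ.μ / N) (fun p => θ.μt p.1 / N)) (fun _ => 0)

/-- The (signed) standard deviations of the Gaussian inputs. -/
noncomputable def noiseSd (θ : Params T M) (N : ℕ) : NoiseCols T N → ℝ :=
  Sum.elim (Sum.elim (fun _ => θ.σ / √N) (fun p => θ.σt p.1 / √N)) (fun _ => θ.σe)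

/-- All Gaussian inputs as one matrix. -/
def flatNoise (T N : ℕ)
    (x : (Fin N → Fin N → ℝ) × (Fin T → Fin N → Fin N → ℝ) × (Fin T → Fin N → ℝ)) :
    Fin N × NoiseCols T N → ℝ := fun k =>
  Sum.elim (Sum.elim (fun j => x.1 k.1 j) (fun p => x.2.1 p.1 k.1 p.2)) (fun t => x.2.2 t k.1) k.2

lemma measurable_flatNoise (T N : ℕ) : Measurable (flatNoise T N) := by
  refine measurable_pi_lambda _ ?_
  rintro ⟨i, (j | p) | t⟩ <;> simp only [flatNoise, Sum.elim_inl, Sum.elim_inr] <;> fun_prop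

lemma measurePreserving_flatNoise (θ : Params T M) (N : ℕ) :
    MeasurePreserving (flatNoise T N) (noiseLaw θ N) (Measure.pi fun k : Fin N × NoiseCols T N =>
      gaussianReal (noiseMean θ N k.2) (noiseSd θ N k.2 ^ 2).toNNReal) := by
  refine ⟨measurable_flatNoise T N, (Measure.pi_eq fun s hs => ?_).symm⟩
  have hpre : flatNoise T N ⁻¹' (Set.univ.pi s) =
      (Set.univ.pi fun i => Set.univ.pi fun j => s (i, .inl (.inl j))) ×ˢ
      ((Set.univ.pi fun t => Set.univ.pi fun i => Set.univ.pi fun j => s (i, .inl (.inr (t, j)))) ×ˢ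
      (Set.univ.pi fun t => Set.univ.pi fun i => s (i, .inr t))) := by
    ext ⟨a, b, c⟩
    simp only [Set.mem_preimage, Set.mem_pi, Set.mem_univ, true_imp_iff, Set.mem_prod, Prod.forall,
      Sum.forall, flatNoise, Sum.elim_inl, Sum.elim_inr]
    constructor
    · intro h
      exact ⟨fun i j => (h i).1.1 j, fun t i j => (h i).1.2 t j, fun t i => (h i).2 t⟩
    · rintro ⟨h1, h2, h3⟩ i
      exact ⟨⟨fun j => h1 i j, fun t j => h2 t i j⟩, fun t => h3 t i⟩
  rw [Measure.map_apply (measurable_flatNoise T N) (MeasurableSet.univ_pi hs), hpre, noiseLaw,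
    Measure.prod_prod, Measure.prod_prod]
  simp only [Measure.pi_pi, Fintype.prod_prod_type, Fintype.prod_sum_type, noiseMean, noiseSd,
    Sum.elim_inl, Sum.elim_inr, div_pow, Real.sq_sqrt (Nat.cast_nonneg N)]
  rw [Finset.prod_mul_distrib, Finset.prod_mul_distrib, mul_assoc]
  congr 2
  · rw [Finset.prod_comm]
  · rw [Finset.prod_comm]

/-- Normalization of a Gaussian input, with a fresh variable in the degenerate case. -/
noncomputable def normalizeEntry (m s x a : ℝ) : ℝ := if s = 0 then a else (x - m) / s

lemma measurePreserving_normalizeEntry (m s : ℝ) :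
    MeasurePreserving (fun p : ℝ × ℝ => normalizeEntry m s p.1 p.2)
      ((gaussianReal m (s ^ 2).toNNReal).prod (gaussianReal 0 1)) (gaussianReal 0 1) := by
  by_cases hs : s = 0
  · simp only [normalizeEntry, hs, if_true]
    exact measurePreserving_snd
  · simp only [normalizeEntry, hs, if_false]
    have h1 : MeasurePreserving (fun x => (x - m) / s) (gaussianReal m (s ^ 2).toNNReal)
        (gaussianReal 0 1) := by
      refine ⟨by fun_prop, ?_⟩
      have : (fun x : ℝ => (x - m) / s) = (fun x => x / s) ∘ fun x => x - m := rfl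
      rw [this, ← Measure.map_map (by fun_prop) (by fun_prop), gaussianReal_map_sub_const,
        gaussianReal_map_div_const]
      congr 1
      · simp
      · ext
        push_cast
        rw [Real.coe_toNNReal _ (sq_nonneg s)]
        simp [hs]
    exact h1.comp measurePreserving_fst

/-- The standard Gaussian matrix behind the inputs, completed by fresh columns. -/
noncomputable def fillNoise {N : ℕ} {C Q : Type*} (m s : C → ℝ)
    (p : (Fin N × C → ℝ) × (Fin N × C → ℝ) × (Fin N × Q → ℝ)) : Fin N × (C ⊕ Q) → ℝ := fun k =>
  Sum.elim (fun c => normalizeEntry (m c) (s c) (p.1 (k.1, c)) (p.2.1 (k.1, c)))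
    (fun q => p.2.2 (k.1, q)) k.2

lemma measurePreserving_fillNoise {N : ℕ} {C Q : Type*} [Fintype C] [Fintype Q] (m s : C → ℝ) :
    MeasurePreserving (fillNoise (N := N) (Q := Q) m s)
      ((Measure.pi fun k : Fin N × C => gaussianReal (m k.2) (s k.2 ^ 2).toNNReal).prod
        ((stdPi (Fin N × C)).prod (stdPi (Fin N × Q)))) (stdPi (Fin N × (C ⊕ Q))) := by
  have h1 := (measurePreserving_pi _ _ fun k : Fin N × C =>
      measurePreserving_normalizeEntry (m k.2) (s k.2)).comp
    (measurePreserving_arrowProdEquivProdArrow ℝ ℝ (Fin N × C)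
      (fun k => gaussianReal (m k.2) (s k.2 ^ 2).toNNReal) (fun _ => gaussianReal 0 1)).symm
  have h2 := (h1.prod (MeasurePreserving.id (stdPi (Fin N × Q)))).comp
    (measurePreserving_prodAssoc
      (Measure.pi fun k : Fin N × C => gaussianReal (m k.2) (s k.2 ^ 2).toNNReal)
      (stdPi (Fin N × C)) (stdPi (Fin N × Q))).symm
  let g : (Fin N × C → ℝ) × (Fin N × Q → ℝ) → Fin N × (C ⊕ Q) → ℝ := fun p k =>
    Sum.elim (fun c => p.1 (k.1, c)) (fun q => p.2 (k.1, q)) k.2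
  have hgm : Measurable g := by
    refine measurable_pi_lambda _ ?_
    rintro ⟨i, c | q⟩ <;> simp only [g, Sum.elim_inl, Sum.elim_inr] <;> fun_prop
  have h3 : MeasurePreserving g ((stdPi (Fin N × C)).prod (stdPi (Fin N × Q)))
      (stdPi (Fin N × (C ⊕ Q))) := by
    refine ⟨hgm, (Measure.pi_eq fun t ht => ?_).symm⟩
    have hpre : g ⁻¹' (Set.univ.pi t) = (Set.univ.pi fun k => t (k.1, .inl k.2)) ×ˢ
        (Set.univ.pi fun k => t (k.1, .inr k.2)) := by
      ext ⟨a, b⟩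
      simp only [Set.mem_preimage, Set.mem_pi, Set.mem_univ, true_imp_iff, Set.mem_prod,
        Prod.forall, Sum.forall, g, Sum.elim_inl, Sum.elim_inr]
      exact ⟨fun h => ⟨fun i c => (h i).1 c, fun i q => (h i).2 q⟩,
        fun h i => ⟨h.1 i, h.2 i⟩⟩
    rw [Measure.map_apply hgm (MeasurableSet.univ_pi ht), hpre, Measure.prod_prod]
    simp only [Measure.pi_pi, Fintype.prod_prod_type, Fintype.prod_sum_type]
    rw [Finset.prod_mul_distrib]
  exact h3.comp h2

/-- Each Gaussian input is an affine function of the entry of the standard Gaussian matrix. -/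
lemma ae_flatNoise_eq (θ : Params T M) (N : ℕ) :
    ∀ᵐ x ∂(noiseLaw θ N), ∀ k : Fin N × NoiseCols T N, ∀ a : ℝ,
      flatNoise T N x k = noiseMean θ N k.2 + noiseSd θ N k.2 *
        normalizeEntry (noiseMean θ N k.2) (noiseSd θ N k.2) (flatNoise T N x k) a := by
  rw [ae_all_iff]
  intro k
  -- A degenerate input equals its mean almost surely, and the factor zero removes the fresh
  -- variable $a$, whatever its value.
  by_cases hs : noiseSd θ N k.2 = 0
  · have h1 := (measurePreserving_eval (fun k : Fin N × NoiseCols T N =>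
      gaussianReal (noiseMean θ N k.2) (noiseSd θ N k.2 ^ 2).toNNReal) k).comp
      (measurePreserving_flatNoise θ N)
    have h2 : ∀ᵐ y ∂(gaussianReal (noiseMean θ N k.2) (noiseSd θ N k.2 ^ 2).toNNReal),
        y = noiseMean θ N k.2 := by
      rw [hs]
      simp only [ne_eq, OfNat.ofNat_ne_zero, not_false_eq_true, zero_pow, Real.toNNReal_zero,
        gaussianReal_zero_var]
      simp [ae_dirac_eq]
    filter_upwards [h1.quasiMeasurePreserving.ae h2] with x hx a
    simp only [Function.comp_apply, Function.eval] at hx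
    rw [hx, hs]
    simp
  · refine .of_forall fun x a => ?_
    simp only [normalizeEntry, hs, if_false]
    field_simp
    ring

end NoiseLaw

/-! ### Gram-Schmidt with padding. -/

section Orthonormalization

variable {J : Type*} [Fintype J]

open Classical in
/-- Gram-Schmidt orthonormalization; degenerate directions are replaced by those in `pad`. -/
noncomputable def orth (pad v : ℕ → J → ℝ) (j : ℕ) : J → ℝ :=
  if v j - ∑ q : Fin j, (orth pad v q ⬝ᵥ v j) • orth pad v q = 0 then pad j
  else (√((v j - ∑ q : Fin j, (orth pad v q ⬝ᵥ v j) • orth pad v q) ⬝ᵥ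
      (v j - ∑ q : Fin j, (orth pad v q ⬝ᵥ v j) • orth pad v q)))⁻¹ •
    (v j - ∑ q : Fin j, (orth pad v q ⬝ᵥ v j) • orth pad v q)
termination_by j
decreasing_by all_goals exact q.2

/-- The part of `v j` orthogonal to the previous directions. -/
noncomputable def resid (pad v : ℕ → J → ℝ) (j : ℕ) : J → ℝ :=
  v j - ∑ q ∈ Finset.range j, (orth pad v q ⬝ᵥ v j) • orth pad v q

open Classical in
lemma orth_eq (pad v : ℕ → J → ℝ) (j : ℕ) : orth pad v j =
    if resid pad v j = 0 then pad j
    else (√(resid pad v j ⬝ᵥ resid pad v j))⁻¹ • resid pad v j := by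
  have h : v j - ∑ q : Fin j, (orth pad v q ⬝ᵥ v j) • orth pad v q = resid pad v j := by
    rw [resid, Finset.sum_range]
  rw [orth, h]

/-- Causality of Gram-Schmidt: adaptivity of the directions passes to the orthonormalized ones. -/
lemma orth_congr {pad v v' : ℕ → J → ℝ} {j : ℕ} (h : ∀ q ≤ j, v q = v' q) :
    orth pad v j = orth pad v' j := by
  induction j using Nat.strong_induction_on with
  | _ j ih =>
    have hr : resid pad v j = resid pad v' j := by
      unfold resid
      rw [h j le_rfl]
      congr 1
      refine Finset.sum_congr rfl fun q hq => ?_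
      rw [ih q (Finset.mem_range.1 hq) fun r hr => h r (hr.trans (Finset.mem_range.1 hq).le)]
    rw [orth_eq, orth_eq, hr]

lemma measurable_orth {X : Type*} [MeasurableSpace X] {pad : ℕ → J → ℝ} {v : ℕ → X → J → ℝ}
    {j : ℕ} (hv : ∀ q ≤ j, Measurable (v q)) :
    Measurable fun x => orth pad (fun q => v q x) j := by
  induction j using Nat.strong_induction_on with
  | _ j ih =>
    have ih' (q : ℕ) (hq : q ∈ Finset.range j) :=
      ih q (Finset.mem_range.1 hq) fun r hr => hv r (hr.trans (Finset.mem_range.1 hq).le)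
    have hj := hv j le_rfl
    have hdot {f g : X → J → ℝ} (hf : Measurable f) (hg : Measurable g) :
        Measurable fun x => f x ⬝ᵥ g x := by
      unfold dotProduct
      fun_prop
    have hr : Measurable fun x => resid pad (fun q => v q x) j := by
      unfold resid
      exact hj.sub (Finset.measurable_sum _ fun q hq => (hdot (ih' q hq) hj).smul (ih' q hq))
    simp only [orth_eq]
    refine Measurable.ite (measurableSet_eq_fun hr measurable_const) measurable_const ?_
    exact ((hdot hr hr).sqrt.inv).smul hr

lemma dot_sum_smul {ι : Type*} (s : Finset ι) (u : J → ℝ) (c : ι → ℝ) (w : ι → J → ℝ) :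
    u ⬝ᵥ (∑ q ∈ s, c q • w q) = ∑ q ∈ s, c q * (u ⬝ᵥ w q) := by
  rw [dotProduct_sum]
  exact Finset.sum_congr rfl fun q _ => by rw [dotProduct_smul, smul_eq_mul]

variable {pad v : ℕ → J → ℝ} {K : ℕ}

/-- The three claims need a joint induction: orthogonality to all later padding vectors is what
allows one of them to be inserted when a residual vanishes. -/
lemma orth_aux (hp : ∀ i < K, ∀ j < K, pad i ⬝ᵥ pad j = if i = j then 1 else 0)
    (hpv : ∀ i < K, ∀ j < K, pad i ⬝ᵥ v j = 0) (j : ℕ) (hj : j < K) :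
    orth pad v j ⬝ᵥ orth pad v j = 1 ∧ (∀ q < j, orth pad v q ⬝ᵥ orth pad v j = 0) ∧
      ∀ i, j < i → i < K → pad i ⬝ᵥ orth pad v j = 0 := by
  induction j using Nat.strong_induction_on with
  | _ j ih =>
    have hon (q q' : ℕ) (hq : q < j) (hq' : q' < j) :
        orth pad v q ⬝ᵥ orth pad v q' = if q = q' then 1 else 0 := by
      rcases lt_trichotomy q q' with h | h | h
      · rw [(ih q' hq' (hq'.trans hj)).2.1 q h, if_neg h.ne]
      · subst h
        rw [(ih q hq (hq.trans hj)).1, if_pos rfl]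
      · rw [dotProduct_comm, (ih q hq (hq.trans hj)).2.1 q' h, if_neg h.ne']
    have hrq (q : ℕ) (hq : q < j) : orth pad v q ⬝ᵥ resid pad v j = 0 := by
      rw [resid, dotProduct_sub, dot_sum_smul]
      rw [Finset.sum_eq_single_of_mem q (Finset.mem_range.2 hq), hon q q hq hq]
      · simp
      · intro q' hq' hne
        rw [hon q q' hq (Finset.mem_range.1 hq'), if_neg hne.symm, mul_zero]
    have hrp (i : ℕ) (hi : j < i) (hiK : i < K) : pad i ⬝ᵥ resid pad v j = 0 := by
      rw [resid, dotProduct_sub, dot_sum_smul, hpv i hiK j hj, Finset.sum_eq_zero, sub_zero]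
      intro q hq
      have hq' := Finset.mem_range.1 hq
      rw [(ih q hq' (hq'.trans hj)).2.2 i (hq'.trans hi) hiK, mul_zero]
    rw [orth_eq]
    split_ifs with h0
    · refine ⟨by simpa using hp j hj j hj, fun q hq => ?_, fun i hi hiK => ?_⟩
      · rw [dotProduct_comm]
        exact (ih q hq (hq.trans hj)).2.2 j hq hj
      · rw [hp i hiK j hj, if_neg hi.ne']
    · have hpos : 0 < resid pad v j ⬝ᵥ resid pad v j := by
        refine lt_of_le_of_ne (Finset.sum_nonneg fun l _ => mul_self_nonneg _) fun h => h0 ?_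
        exact dotProduct_self_eq_zero.1 h.symm
      refine ⟨?_, fun q hq => ?_, fun i hi hiK => ?_⟩
      · rw [smul_dotProduct, dotProduct_smul, smul_eq_mul, smul_eq_mul, ← mul_assoc, ← mul_inv,
          Real.mul_self_sqrt hpos.le, inv_mul_cancel₀ hpos.ne']
      · rw [dotProduct_smul, hrq q hq, smul_zero]
      · rw [dotProduct_smul, hrp i hi hiK, smul_zero]

lemma orth_orthonormal (hp : ∀ i < K, ∀ j < K, pad i ⬝ᵥ pad j = if i = j then 1 else 0)
    (hpv : ∀ i < K, ∀ j < K, pad i ⬝ᵥ v j = 0) {i j : ℕ} (hi : i < K) (hj : j < K) :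
    orth pad v i ⬝ᵥ orth pad v j = if i = j then 1 else 0 := by
  rcases lt_trichotomy i j with h | h | h
  · rw [(orth_aux hp hpv j hj).2.1 i h, if_neg h.ne]
  · subst h
    rw [(orth_aux hp hpv i hi).1, if_pos rfl]
  · rw [dotProduct_comm, (orth_aux hp hpv i hi).2.1 j h, if_neg h.ne']

/-- The residual is the component along the last orthonormal vector. In the degenerate case that
vector is a padding vector, but its coefficient is zero, so the expansion holds without linear
independence. -/
lemma eq_sum_orth (hp : ∀ i < K, ∀ j < K, pad i ⬝ᵥ pad j = if i = j then 1 else 0)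
    (hpv : ∀ i < K, ∀ j < K, pad i ⬝ᵥ v j = 0) {j : ℕ} (hj : j < K) :
    v j = ∑ q ∈ Finset.range (j + 1), (orth pad v q ⬝ᵥ v j) • orth pad v q := by
  have hv : v j = ∑ q ∈ Finset.range j, (orth pad v q ⬝ᵥ v j) • orth pad v q
      + resid pad v j := by
    simp [resid]
  have hlast : (orth pad v j ⬝ᵥ v j) • orth pad v j = resid pad v j := by
    have hjr : orth pad v j ⬝ᵥ v j = orth pad v j ⬝ᵥ resid pad v j := by
      conv_lhs => rw [hv]
      rw [dotProduct_add, dot_sum_smul, Finset.sum_eq_zero, zero_add]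
      intro q hq
      have hq' := Finset.mem_range.1 hq
      rw [orth_orthonormal hp hpv hj (hq'.trans hj), if_neg hq'.ne', mul_zero]
    rw [hjr, orth_eq]
    split_ifs with h0
    · simp [h0]
    · have hpos : 0 < resid pad v j ⬝ᵥ resid pad v j := by
        refine lt_of_le_of_ne (Finset.sum_nonneg fun l _ => mul_self_nonneg _) fun h => h0 ?_
        exact dotProduct_self_eq_zero.1 h.symm
      rw [smul_dotProduct, smul_smul, smul_eq_mul, mul_right_comm, ← mul_inv,
        Real.mul_self_sqrt hpos.le, inv_mul_cancel₀ hpos.ne', one_smul]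
  rw [Finset.sum_range_succ, hlast]
  exact hv

lemma orth_dot_eq_zero (hp : ∀ i < K, ∀ j < K, pad i ⬝ᵥ pad j = if i = j then 1 else 0)
    (hpv : ∀ i < K, ∀ j < K, pad i ⬝ᵥ v j = 0) {j q : ℕ} (hjq : j < q) (hq : q < K) :
    orth pad v q ⬝ᵥ v j = 0 := by
  rw [eq_sum_orth hp hpv (hjq.trans hq), dot_sum_smul]
  refine Finset.sum_eq_zero fun r hr => ?_
  have hr' : r < q := by
    have := Finset.mem_range.1 hr
    omega
  rw [orth_orthonormal hp hpv hq (hr'.trans hq), if_neg hr'.ne', mul_zero]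

lemma eq_sum_orth_fin (hp : ∀ i < K, ∀ j < K, pad i ⬝ᵥ pad j = if i = j then 1 else 0)
    (hpv : ∀ i < K, ∀ j < K, pad i ⬝ᵥ v j = 0) {j : ℕ} (hj : j < K) :
    v j = ∑ q : Fin K, (orth pad v q ⬝ᵥ v j) • orth pad v q := by
  rw [← Finset.sum_range fun q => (orth pad v q ⬝ᵥ v j) • orth pad v q]
  conv_lhs => rw [eq_sum_orth hp hpv hj]
  refine Finset.sum_subset (Finset.range_subset_range.2 hj) fun q hq hq' => ?_
  rw [orth_dot_eq_zero hp hpv (by simpa using hq') (Finset.mem_range.1 hq), zero_smul]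

lemma dot_eq_sum_orth (hp : ∀ i < K, ∀ j < K, pad i ⬝ᵥ pad j = if i = j then 1 else 0)
    (hpv : ∀ i < K, ∀ j < K, pad i ⬝ᵥ v j = 0) {i j : ℕ} (hj : j < K) :
    v i ⬝ᵥ v j = ∑ q : Fin K, (orth pad v q ⬝ᵥ v i) * (orth pad v q ⬝ᵥ v j) := by
  conv_lhs => rw [eq_sum_orth_fin hp hpv hj, dot_sum_smul]
  exact Finset.sum_congr rfl fun q _ => by rw [dotProduct_comm (v i), mul_comm]

end Orthonormalization

/-! ### Reindexing product measures. -/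

section Reshape

variable {ι κ : Type*} [Fintype ι] [Fintype κ]

lemma measurePreserving_uncurry (μ : Measure ℝ) [IsProbabilityMeasure μ] :
    MeasurePreserving (MeasurableEquiv.curry ι κ ℝ).symm
      (Measure.pi fun _ : ι => Measure.pi fun _ : κ => μ) (Measure.pi fun _ : ι × κ => μ) := by
  refine ⟨(MeasurableEquiv.curry ι κ ℝ).symm.measurable, (Measure.pi_eq fun s hs => ?_).symm⟩
  have hpre : (MeasurableEquiv.curry ι κ ℝ).symm ⁻¹' (Set.univ.pi s) =
      Set.univ.pi fun i => Set.univ.pi fun j => s (i, j) := by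
    ext x
    simp only [Set.mem_preimage, Set.mem_pi, Set.mem_univ, true_imp_iff, Prod.forall]
    rfl
  rw [MeasurableEquiv.map_apply, hpre]
  simp only [Measure.pi_pi, Fintype.prod_prod_type]

lemma measurePreserving_transpose (μ : Measure ℝ) [IsProbabilityMeasure μ] :
    MeasurePreserving (fun (x : ι → κ → ℝ) j i => x i j)
      (Measure.pi fun _ : ι => Measure.pi fun _ : κ => μ)
      (Measure.pi fun _ : κ => Measure.pi fun _ : ι => μ) := by
  have h1 : MeasurePreserving (fun (x : ι → κ → ℝ) (k : κ × ι) => x k.2 k.1)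
      (Measure.pi fun _ : ι => Measure.pi fun _ : κ => μ) (Measure.pi fun _ : κ × ι => μ) := by
    have hm : Measurable fun (x : ι → κ → ℝ) (k : κ × ι) => x k.2 k.1 := by fun_prop
    refine ⟨hm, (Measure.pi_eq fun s hs => ?_).symm⟩
    have hpre : (fun (x : ι → κ → ℝ) (k : κ × ι) => x k.2 k.1) ⁻¹' (Set.univ.pi s) =
        Set.univ.pi fun i => Set.univ.pi fun j => s (j, i) := by
      ext x
      simp only [Set.mem_preimage, Set.mem_pi, Set.mem_univ, true_imp_iff, Prod.forall]
      exact forall_comm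
    rw [Measure.map_apply hm (MeasurableSet.univ_pi hs), hpre]
    simp only [Measure.pi_pi, Fintype.prod_prod_type]
    rw [Finset.prod_comm]
  exact ((measurePreserving_uncurry (ι := κ) (κ := ι) μ).symm).comp h1

end Reshape

/-! ### The outcomes as a function of the data and the Gaussian matrix. -/

section Run

variable {T M : ℕ}

/-- The columns of the standard Gaussian matrix: the inputs and fresh columns. -/
abbrev Cols (T N : ℕ) := NoiseCols T N ⊕ Fin (2 * T)

/-- The type of the given inputs. -/
abbrev DataSp (T M N : ℕ) := (Fin N → ℝ) × (Fin N → Vec T) × (Fin N → Vec M)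

/-- The messages as a function of the outcomes. -/
def msg (θ : Params T M) {N : ℕ} (d : DataSp T M N) (t : ℕ) (y : Fin N → ℝ) : Fin N → ℝ :=
  fun j => θ.g t (y j, d.2.1 j, d.2.2 j)

/-- The direction in which the standard Gaussian matrix is applied to get `A u`. -/
noncomputable def fixedDir (θ : Params T M) {N : ℕ} (u : Fin N → ℝ) : Cols T N → ℝ :=
  Sum.elim (Sum.elim (Sum.elim (fun j => θ.σ / √N * u j) (fun _ => 0)) (fun _ => 0)) (fun _ => 0)

/-- The direction in which the standard Gaussian matrix is applied to get `(A + B_t) u + ε_t`. -/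
noncomputable def fullDir (θ : Params T M) {N : ℕ} (t : ℕ) (u : Fin N → ℝ) : Cols T N → ℝ :=
  Sum.elim (Sum.elim (Sum.elim (fun j => θ.σ / √N * u j)
    (fun p => if p.1.val = t then θ.σt t / √N * u p.2 else 0))
    (fun s => if s.val = t then θ.σe else 0)) (fun _ => 0)

/-- The outcomes as a function of the data and of the standard Gaussian matrix. -/
noncomputable def run (θ : Params T M) {N : ℕ} (d : DataSp T M N) (G : Fin N × Cols T N → ℝ) :
    ℕ → Fin N → ℝ
  | 0 => d.1
  | t + 1 => fun i => (θ.μ + θ.μt t) * avg (msg θ d t (run θ d G t))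
      + mulv G (fullDir θ t (msg θ d t (run θ d G t))) i

/-- All directions, in the order in which they are used. -/
noncomputable def dir (θ : Params T M) {N : ℕ} (d : DataSp T M N) (j : ℕ)
    (G : Fin N × Cols T N → ℝ) : Cols T N → ℝ :=
  if j % 2 = 0 then fixedDir θ (msg θ d (j / 2) (run θ d G (j / 2)))
  else fullDir θ (j / 2) (msg θ d (j / 2) (run θ d G (j / 2)))

/-- The fresh directions. -/
def padDir (T N : ℕ) (j : ℕ) : Cols T N → ℝ :=
  Sum.elim (fun _ => 0) (fun q => if q.val = j then 1 else 0)

/-- The orthonormal directions. -/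
noncomputable def onDir (θ : Params T M) {N : ℕ} (d : DataSp T M N) (j : ℕ)
    (G : Fin N × Cols T N → ℝ) : Cols T N → ℝ :=
  orth (padDir T N) (fun q => dir θ d q G) j

lemma dir_even (θ : Params T M) {N : ℕ} (d : DataSp T M N) (t : ℕ) (G : Fin N × Cols T N → ℝ) :
    dir θ d (2 * t) G = fixedDir θ (msg θ d t (run θ d G t)) := by
  simp [dir]

lemma dir_odd (θ : Params T M) {N : ℕ} (d : DataSp T M N) (t : ℕ) (G : Fin N × Cols T N → ℝ) :
    dir θ d (2 * t + 1) G = fullDir θ t (msg θ d t (run θ d G t)) := by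
  have h1 : (2 * t + 1) % 2 = 1 := by omega
  have h2 : (2 * t + 1) / 2 = t := by omega
  simp [dir, h1, h2]

lemma padDir_dot (T N : ℕ) : ∀ i < 2 * T, ∀ j < 2 * T,
    padDir T N i ⬝ᵥ padDir T N j = if i = j then 1 else 0 := by
  intro i hi j hj
  simp only [dotProduct, padDir, Fintype.sum_sum_type, Sum.elim_inl, Sum.elim_inr, mul_zero,
    Finset.sum_const_zero, zero_add]
  rw [Finset.sum_eq_single (⟨i, hi⟩ : Fin (2 * T))]
  · simp
  · intro q _ hq
    rw [if_neg fun h => hq (Fin.ext h), zero_mul]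
  · simp

lemma padDir_dot_dir (θ : Params T M) {N : ℕ} (d : DataSp T M N) (G : Fin N × Cols T N → ℝ) :
    ∀ i < 2 * T, ∀ j < 2 * T, padDir T N i ⬝ᵥ dir θ d j G = 0 := by
  intro i _ j _
  unfold dir
  split_ifs <;> simp [dotProduct, padDir, fixedDir, fullDir, Fintype.sum_sum_type]

lemma fixedDir_dot_fixedDir (θ : Params T M) {N : ℕ} (u u' : Fin N → ℝ) :
    fixedDir θ u ⬝ᵥ fixedDir θ u' = θ.σ ^ 2 * avg (u * u') := by
  have h : ∀ j, θ.σ / √N * u j * (θ.σ / √N * u' j) = θ.σ ^ 2 / N * (u j * u' j) := fun j => by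
    rw [← Real.sq_sqrt (Nat.cast_nonneg N), ← div_pow, Real.sqrt_sq (Real.sqrt_nonneg _)]
    ring
  simp only [dotProduct, fixedDir, Fintype.sum_sum_type, Sum.elim_inl, Sum.elim_inr, mul_zero,
    Finset.sum_const_zero, add_zero, h]
  rw [← Finset.mul_sum, avg]
  simp only [Pi.mul_apply]
  ring

lemma fixedDir_dot_fullDir (θ : Params T M) {N : ℕ} (t : ℕ) (u u' : Fin N → ℝ) :
    fixedDir θ u ⬝ᵥ fullDir θ t u' = θ.σ ^ 2 * avg (u * u') := by
  rw [← fixedDir_dot_fixedDir]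
  simp [dotProduct, fixedDir, fullDir, Fintype.sum_sum_type]

/-- Different times use disjoint blocks of columns for $B_t$ and $\varepsilon_t$, so off the
diagonal only the common block of $A$ contributes. The bound $s<T$ ensures that these blocks exist.
-/
lemma fullDir_dot_fullDir (θ : Params T M) {N : ℕ} {s t : ℕ} (hs : s < T) (u u' : Fin N → ℝ) :
    fullDir θ s u ⬝ᵥ fullDir θ t u' = θ.σ ^ 2 * avg (u * u')
      + if s = t then θ.σt s ^ 2 * avg (u * u') + θ.σe ^ 2 else 0 := by
  rw [← fixedDir_dot_fixedDir]
  simp only [dotProduct, fixedDir, fullDir, Fintype.sum_sum_type, Sum.elim_inl, Sum.elim_inr,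
    mul_zero, Finset.sum_const_zero, add_zero, Fintype.sum_prod_type]
  rw [add_assoc]
  congr 1
  rw [Finset.sum_eq_single (⟨s, hs⟩ : Fin T), Finset.sum_eq_single (⟨s, hs⟩ : Fin T)]
  · simp only [if_true]
    split_ifs with hst
    · subst hst
      have h : ∀ j, θ.σt s / √N * u j * (θ.σt s / √N * u' j)
          = θ.σt s ^ 2 / N * (u j * u' j) := fun j => by
        rw [← Real.sq_sqrt (Nat.cast_nonneg N), ← div_pow, Real.sqrt_sq (Real.sqrt_nonneg _)]
        ring
      simp only [h]
      rw [← Finset.mul_sum, avg]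
      simp only [Pi.mul_apply]
      ring
    · simp
  · intro q _ hq
    rw [if_neg fun h => hq (Fin.ext h), zero_mul]
  · simp
  · intro q _ hq
    refine Finset.sum_eq_zero fun j _ => ?_
    rw [if_neg fun h => hq (Fin.ext h), zero_mul]
  · simp

/-- The directions up to index `j` only depend on the images of the first `j` orthonormal
directions. -/
lemma dir_eq_of_mulv_onDir_eq (θ : Params T M) {N : ℕ} (d : DataSp T M N) {j : ℕ} (hj : j < 2 * T)
    (G G' : Fin N × Cols T N → ℝ)
    (h : ∀ q < j, mulv G (onDir θ d q G) = mulv G' (onDir θ d q G)) :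
    ∀ q ≤ j, dir θ d q G' = dir θ d q G := by
  -- An earlier direction lies in the span of the earlier orthonormal ones, on which $G$ and $G'$
  -- agree.
  have hdir (q : ℕ) (hq : q < j) : mulv G (dir θ d q G) = mulv G' (dir θ d q G) := by
    have he := eq_sum_orth (padDir_dot T N) (padDir_dot_dir θ d G) (hq.trans hj)
    have hlin (H : Fin N × Cols T N → ℝ) : mulv H (dir θ d q G) =
        ∑ r ∈ Finset.range (q + 1), (orth (padDir T N) (fun q => dir θ d q G) r ⬝ᵥ dir θ d q G) •
          mulv H (onDir θ d r G) := by
      conv_lhs => rw [he]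
      ext i
      simp only [mulv, Finset.sum_apply, Pi.smul_apply, smul_eq_mul, onDir, Finset.mul_sum]
      rw [Finset.sum_comm]
      refine Finset.sum_congr rfl fun r _ => Finset.sum_congr rfl fun l _ => by ring
    rw [hlin, hlin]
    refine Finset.sum_congr rfl fun r hr => ?_
    have hr' := Finset.mem_range.1 hr
    rw [h r (by omega)]
  -- The outcome at time $t+1$ needs the image of direction $2t+1$, which is among the first $j$
  -- ones when $2(t+1)\le j$.
  have hrun (t : ℕ) (ht : 2 * t ≤ j) : run θ d G' t = run θ d G t := by
    induction t with
    | zero => rfl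
    | succ t ih =>
      have h1 := ih (by omega)
      have h2 := hdir (2 * t + 1) (by omega)
      rw [dir_odd] at h2
      funext i
      simp only [run]
      rw [h1, ← h2]
  intro q hq
  unfold dir
  rw [hrun (q / 2) (by omega)]

lemma measurable_avg {X : Type*} [MeasurableSpace X] {N : ℕ} {f : X → Fin N → ℝ}
    (hf : Measurable f) : Measurable fun x => avg (f x) := by
  unfold avg
  fun_prop

section Measurability

variable {θ : Params T M} (hg : ∀ t < T, Measurable (θ.g t)) {N : ℕ}

lemma measurable_fullDir {X : Type*} [MeasurableSpace X] {t : ℕ} {u : X → Fin N → ℝ}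
    (hu : Measurable u) : Measurable fun x => fullDir θ t (u x) := by
  refine measurable_pi_lambda _ ?_
  rintro (((j | p) | s) | q) <;> simp only [fullDir, Sum.elim_inl, Sum.elim_inr]
  · fun_prop
  · split_ifs <;> fun_prop
  · fun_prop
  · fun_prop

include hg

lemma measurable_msg {X : Type*} [MeasurableSpace X] {t : ℕ} (ht : t < T)
    {d : X → DataSp T M N} {y : X → Fin N → ℝ} (hd : Measurable d) (hy : Measurable y) :
    Measurable fun x => msg θ (d x) t (y x) := by
  refine measurable_pi_lambda _ fun j => (hg t ht).comp ?_
  fun_prop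

lemma measurable_run {t : ℕ} (ht : t ≤ T) :
    Measurable fun p : DataSp T M N × (Fin N × Cols T N → ℝ) => run θ p.1 p.2 t := by
  induction t with
  | zero => exact measurable_fst.comp measurable_fst
  | succ t ih =>
    have h1 := measurable_msg hg (t := t) (by omega) measurable_fst (ih (by omega))
    have h2 := measurable_mulv (R := Fin N) measurable_snd (measurable_fullDir (θ := θ) (t := t) h1)
    have h3 := measurable_avg h1
    refine measurable_pi_lambda _ fun i => ?_
    simp only [run]
    fun_prop

lemma measurable_dir {j : ℕ} (hj : j < 2 * T) :
    Measurable fun p : DataSp T M N × (Fin N × Cols T N → ℝ) => dir θ p.1 j p.2 := by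
  have h1 := measurable_msg hg (t := j / 2) (N := N) (by omega) measurable_fst
    (measurable_run hg (t := j / 2) (by omega))
  unfold dir
  split_ifs
  · refine measurable_pi_lambda _ ?_
    rintro (((j | p) | s) | q) <;> simp only [fixedDir, Sum.elim_inl, Sum.elim_inr] <;> fun_prop
  · exact measurable_fullDir h1

lemma measurable_onDir {j : ℕ} (hj : j < 2 * T) :
    Measurable fun p : DataSp T M N × (Fin N × Cols T N → ℝ) => onDir θ p.1 j p.2 :=
  measurable_orth (v := fun q (p : DataSp T M N × (Fin N × Cols T N → ℝ)) => dir θ p.1 q p.2)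
    fun q hq => measurable_dir hg (by omega)

/-- The images of the orthonormal directions are standard Gaussian and independent of the data. -/
lemma measurePreserving_onDir (δ : Measure (DataSp T M N)) [IsProbabilityMeasure δ] :
    MeasurePreserving (fun p : DataSp T M N × (Fin N × Cols T N → ℝ) =>
      (p.1, fun n (q : Fin (2 * T)) => mulv p.2 (onDir θ p.1 q p.2) n))
      (δ.prod (stdPi (Fin N × Cols T N)))
      (δ.prod (Measure.pi fun _ : Fin N => stdPi (Fin (2 * T)))) := by
  refine (MeasurePreserving.id δ).skew_product (μc := stdPi (Fin N × Cols T N))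
    (μd := Measure.pi fun _ : Fin N => stdPi (Fin (2 * T)))
    (g := fun d G n (q : Fin (2 * T)) => mulv G (onDir θ d q G) n) ?_ (.of_forall fun d => ?_)
  · refine measurable_pi_lambda _ fun n => measurable_pi_lambda _ fun q => ?_
    exact (measurable_pi_apply n).comp
      (measurable_mulv measurable_snd (measurable_onDir hg q.2))
  · have h := measurePreserving_adaptive (R := Fin N) (2 * T) (fun j G => onDir θ d j G)
      (fun j hj => (measurable_onDir hg hj).comp measurable_prodMk_left)
      (fun G i hi j hj => orth_orthonormal (padDir_dot T N) (padDir_dot_dir θ d G) hi hj)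
      (fun j hj G G' h => orth_congr (dir_eq_of_mulv_onDir_eq θ d hj G G' h))
    -- Transposing groups the images by units: every unit carries an independent standard Gaussian
    -- vector in $\mathbb R^{2T}$.
    have h2 := (measurePreserving_transpose (ι := Fin (2 * T)) (κ := Fin N)
      (gaussianReal 0 1)).comp h
    exact h2.map_eq

end Measurability

end Run

/-! ### Exact Gaussian representation of the outcomes. -/

section Representation

variable {Ω : Type*} {T M : ℕ}

/-- Fresh Gaussian variables for every system size. -/
abbrev Aux (T : ℕ) := ∀ N : ℕ, (Fin N × NoiseCols T N → ℝ) × (Fin N × Fin (2 * T) → ℝ)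

/-- The law of the fresh variables. -/
noncomputable def auxLaw (T : ℕ) : Measure (Aux T) :=
  Measure.infinitePi fun N => (stdPi (Fin N × NoiseCols T N)).prod (stdPi (Fin N × Fin (2 * T)))

instance (T : ℕ) : IsProbabilityMeasure (auxLaw T) := by unfold auxLaw; infer_instance

/-- The standard Gaussian matrix of the system of size `N`. -/
noncomputable def gaussMatrix (θ : Params T M) (S : Systems Ω T M) (N : ℕ) (ω : Ω × Aux T) :
    Fin N × Cols T N → ℝ :=
  fillNoise (noiseMean θ N) (noiseSd θ N) (flatNoise T N (S.noise N ω.1), ω.2 N)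

lemma systemY_succ (θ : Params T M) (S : Systems Ω T M) (N : ℕ) (ω : Ω) (t : ℕ) :
    S.Y θ N ω (t + 1) = (S.A N ω + S.B N t ω).mulVec (S.U θ N ω t) + S.ε N t ω := rfl

lemma systemR_eq (θ : Params T M) (S : Systems Ω T M) (N : ℕ) (ω : Ω) (t : ℕ) :
    S.R θ N ω t = (S.A N ω).mulVec (S.U θ N ω t) := by
  rw [Systems.R, systemY_succ, Matrix.add_mulVec]
  abel

lemma fixed_mulVec_eq (θ : Params T M) (S : Systems Ω T M) (N : ℕ) (ω : Ω × Aux T)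
    (h : ∀ k : Fin N × NoiseCols T N, ∀ a : ℝ, flatNoise T N (S.noise N ω.1) k
      = noiseMean θ N k.2 + noiseSd θ N k.2 * normalizeEntry (noiseMean θ N k.2) (noiseSd θ N k.2)
        (flatNoise T N (S.noise N ω.1) k) a) (u : Fin N → ℝ) (i : Fin N) :
    (S.A N ω.1).mulVec u i = θ.μ * avg u + mulv (gaussMatrix θ S N ω) (fixedDir θ u) i := by
  have hA (j : Fin N) : S.A N ω.1 i j
      = θ.μ / N + θ.σ / √N * gaussMatrix θ S N ω (i, .inl (.inl (.inl j))) :=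
    h (i, .inl (.inl j)) ((ω.2 N).1 (i, .inl (.inl j)))
  simp only [Matrix.mulVec, dotProduct, hA, mulv, fixedDir, Fintype.sum_sum_type, Sum.elim_inl,
    Sum.elim_inr, mul_zero, Finset.sum_const_zero, add_zero, avg, add_mul]
  rw [Finset.sum_add_distrib, ← Finset.mul_sum]
  congr 1
  · ring
  · exact Finset.sum_congr rfl fun j _ => by ring

lemma full_mulVec_eq (θ : Params T M) (S : Systems Ω T M) (N : ℕ) (ω : Ω × Aux T)
    (h : ∀ k : Fin N × NoiseCols T N, ∀ a : ℝ, flatNoise T N (S.noise N ω.1) k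
      = noiseMean θ N k.2 + noiseSd θ N k.2 * normalizeEntry (noiseMean θ N k.2) (noiseSd θ N k.2)
        (flatNoise T N (S.noise N ω.1) k) a) {t : ℕ} (ht : t < T) (u : Fin N → ℝ) (i : Fin N) :
    ((S.A N ω.1 + S.B N t ω.1).mulVec u + S.ε N t ω.1) i
      = (θ.μ + θ.μt t) * avg u + mulv (gaussMatrix θ S N ω) (fullDir θ t u) i := by
  have hB (j : Fin N) : S.B N t ω.1 i j
      = θ.μt t / N + θ.σt t / √N * gaussMatrix θ S N ω (i, .inl (.inl (.inr (⟨t, ht⟩, j)))) :=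
    h (i, .inl (.inr (⟨t, ht⟩, j))) ((ω.2 N).1 (i, .inl (.inr (⟨t, ht⟩, j))))
  have hε : S.ε N t ω.1 i = 0 + θ.σe * gaussMatrix θ S N ω (i, .inl (.inr ⟨t, ht⟩)) :=
    h (i, .inr ⟨t, ht⟩) ((ω.2 N).1 (i, .inr ⟨t, ht⟩))
  have hdir : mulv (gaussMatrix θ S N ω) (fullDir θ t u) i
      = mulv (gaussMatrix θ S N ω) (fixedDir θ u) i
        + ∑ j, gaussMatrix θ S N ω (i, .inl (.inl (.inr (⟨t, ht⟩, j)))) * (θ.σt t / √N * u j)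
        + gaussMatrix θ S N ω (i, .inl (.inr ⟨t, ht⟩)) * θ.σe := by
    simp only [mulv, fixedDir, fullDir, Fintype.sum_sum_type, Sum.elim_inl,
      Sum.elim_inr, mul_zero, Finset.sum_const_zero, add_zero, Fintype.sum_prod_type]
    congr 1
    · congr 1
      rw [Finset.sum_eq_single (⟨t, ht⟩ : Fin T)]
      · simp
      · intro q _ hq
        refine Finset.sum_eq_zero fun j _ => ?_
        rw [if_neg fun h => hq (Fin.ext h), mul_zero]
      · simp
    · rw [Finset.sum_eq_single (⟨t, ht⟩ : Fin T)]
      · simp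
      · intro q _ hq
        rw [if_neg fun h => hq (Fin.ext h), mul_zero]
      · simp
  rw [Matrix.add_mulVec, Pi.add_apply, Pi.add_apply, fixed_mulVec_eq θ S N ω h, hε, hdir]
  simp only [Matrix.mulVec, dotProduct, hB, avg, add_mul]
  rw [Finset.sum_add_distrib, ← Finset.mul_sum]
  have : ∑ j, θ.σt t / √N * gaussMatrix θ S N ω (i, .inl (.inl (.inr (⟨t, ht⟩, j)))) * u j
      = ∑ j, gaussMatrix θ S N ω (i, .inl (.inl (.inr (⟨t, ht⟩, j)))) * (θ.σt t / √N * u j) :=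
    Finset.sum_congr rfl fun j _ => by ring
  rw [this]
  ring

variable [MeasurableSpace Ω] {P : Measure Ω} [IsProbabilityMeasure P]

/-- Noise, data and fresh variables are independent, and filling turns noise and fresh variables
into a standard Gaussian matrix. Inputs are only almost everywhere measurable, so the law is
computed on a measurable version. -/
lemma hasLaw_data_gaussMatrix {θ : Params T M} {S : Systems Ω T M}
    (hG : GaussianInterference P θ S) (N : ℕ) :
    HasLaw (fun ω => (S.data N ω.1, gaussMatrix θ S N ω))
      ((P.map (S.data N)).prod (stdPi (Fin N × Cols T N))) (P.prod (auxLaw T)) := by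
  have hnm := (hG.law N).aemeasurable
  have hdm := hG.aemeasurable_data N
  have := Measure.isProbabilityMeasure_map hdm
  have : IsProbabilityMeasure (noiseLaw θ N) := (hG.law N).isProbabilityMeasure_iff.1 inferInstance
  have hjoint : P.map (fun ω => (S.noise N ω, S.data N ω))
      = (noiseLaw θ N).prod (P.map (S.data N)) := by
    rw [(indepFun_iff_map_prod_eq_prod_map_map hnm hdm).1 (hG.indep N), (hG.law N).map_eq]
  have hpm := hnm.prodMk hdm
  have h1 : MeasurePreserving (hpm.mk _) P ((noiseLaw θ N).prod (P.map (S.data N))) :=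
    ⟨hpm.measurable_mk, by rw [← hjoint]; exact (Measure.map_congr hpm.ae_eq_mk).symm⟩
  have h0 : MeasurePreserving (Function.eval N) (auxLaw T)
      ((stdPi (Fin N × NoiseCols T N)).prod (stdPi (Fin N × Fin (2 * T)))) :=
    measurePreserving_eval_infinitePi (fun N : ℕ =>
      (stdPi (Fin N × NoiseCols T N)).prod (stdPi (Fin N × Fin (2 * T)))) N
  have h2 := h1.prod h0
  have h3 := (measurePreserving_prodAssoc (P.map (S.data N)) (noiseLaw θ N)
    ((stdPi (Fin N × NoiseCols T N)).prod (stdPi (Fin N × Fin (2 * T))))).comp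
    ((Measure.measurePreserving_swap (μ := noiseLaw θ N) (ν := P.map (S.data N))).prod
      (MeasurePreserving.id _))
  have h4 := (MeasurePreserving.id (P.map (S.data N))).prod
    ((measurePreserving_fillNoise (N := N) (Q := Fin (2 * T)) (noiseMean θ N) (noiseSd θ N)).comp
      ((measurePreserving_flatNoise θ N).prod (MeasurePreserving.id
        ((stdPi (Fin N × NoiseCols T N)).prod (stdPi (Fin N × Fin (2 * T)))))))
  have h5 := (h4.comp h3).comp h2
  have hae : (fun ω : Ω × Aux T => (S.data N ω.1, gaussMatrix θ S N ω)) =ᵐ[P.prod (auxLaw T)]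
      fun ω => (Prod.map id (fillNoise (noiseMean θ N) (noiseSd θ N) ∘
        Prod.map (flatNoise T N) id) ∘ MeasurableEquiv.prodAssoc ∘ Prod.map Prod.swap id)
        (Prod.map (hpm.mk _) (Function.eval N) ω) := by
    have := (Measure.quasiMeasurePreserving_fst (μ := P) (ν := auxLaw T)).ae hpm.ae_eq_mk
    filter_upwards [this] with ω hω
    simp only [Prod.map, Function.comp_apply, ← hω]
    rfl
  exact ⟨⟨_, h5.measurable, hae⟩, by rw [Measure.map_congr hae]; exact h5.map_eq⟩

/-- **Gaussian representation.** On an extension of the probability space, the outcomes are linear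
combinations of independent standard Gaussian vectors that are independent of the data; the Gram
matrices of the coefficients are those of the messages. -/
theorem exists_gaussian_representation {θ : Params T M} {S : Systems Ω T M}
    (hG : GaussianInterference P θ S) (hg : ∀ t < T, Measurable (θ.g t)) :
    ∃ (ζ : ∀ N, Ω × Aux T → Fin N → Fin (2 * T) → ℝ)
      (L L' : ∀ _ : ℕ, Ω × Aux T → ℕ → Fin (2 * T) → ℝ),
      (∀ N, HasLaw (fun ω => (S.data N ω.1, ζ N ω))
        ((P.map (S.data N)).prod (Measure.pi fun _ => stdPi (Fin (2 * T)))) (P.prod (auxLaw T))) ∧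
      ∀ᵐ ω ∂(P.prod (auxLaw T)), ∀ N,
        (∀ t < T, ∀ n, S.Y θ N ω.1 (t + 1) n
          = (θ.μ + θ.μt t) * avg (S.U θ N ω.1 t) + ∑ q, L N ω t q * ζ N ω n q) ∧
        (∀ t < T, ∀ n, S.R θ N ω.1 t n
          = θ.μ * avg (S.U θ N ω.1 t) + ∑ q, L' N ω t q * ζ N ω n q) ∧
        (∀ s < T, ∀ t < T, ∑ q, L N ω s q * L N ω t q
          = θ.σ ^ 2 * avg (S.U θ N ω.1 s * S.U θ N ω.1 t) + if s = t then
            θ.σt s ^ 2 * avg (S.U θ N ω.1 s * S.U θ N ω.1 t) + θ.σe ^ 2 else 0) ∧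
        (∀ s < T, ∀ t < T, ∑ q, L' N ω s q * L N ω t q
          = θ.σ ^ 2 * avg (S.U θ N ω.1 s * S.U θ N ω.1 t)) ∧
        (∀ s < T, ∀ t < T, ∑ q, L' N ω s q * L' N ω t q
          = θ.σ ^ 2 * avg (S.U θ N ω.1 s * S.U θ N ω.1 t)) := by
  let e (N : ℕ) (ω : Ω × Aux T) (j : ℕ) : Cols T N → ℝ :=
    onDir θ (S.data N ω.1) j (gaussMatrix θ S N ω)
  -- `L` and `L'` hold the coordinates of the odd and even directions in the orthonormal system; by
  -- Parseval their Gram matrices are those of the directions themselves.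
  refine ⟨fun N ω n q => mulv (gaussMatrix θ S N ω) (e N ω q) n,
    fun N ω t q => e N ω q ⬝ᵥ dir θ (S.data N ω.1) (2 * t + 1) (gaussMatrix θ S N ω),
    fun N ω t q => e N ω q ⬝ᵥ dir θ (S.data N ω.1) (2 * t) (gaussMatrix θ S N ω),
    fun N => ?_, ?_⟩
  · have := Measure.isProbabilityMeasure_map (hG.aemeasurable_data N)
    have h1 := hasLaw_data_gaussMatrix hG N
    have h2 := measurePreserving_onDir hg (P.map (S.data N))
    exact ⟨h2.measurable.comp_aemeasurable h1.aemeasurable, by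
      rw [← h2.map_eq, ← h1.map_eq, AEMeasurable.map_map_of_aemeasurable
        h2.measurable.aemeasurable h1.aemeasurable]
      rfl⟩
  · have hae : ∀ᵐ ω ∂(P.prod (auxLaw T)), ∀ N, ∀ k : Fin N × NoiseCols T N, ∀ a : ℝ,
        flatNoise T N (S.noise N ω.1) k = noiseMean θ N k.2 + noiseSd θ N k.2 *
          normalizeEntry (noiseMean θ N k.2) (noiseSd θ N k.2)
            (flatNoise T N (S.noise N ω.1) k) a := by
      rw [ae_all_iff]
      intro N
      have h1 := ae_flatNoise_eq θ N
      rw [← (hG.law N).map_eq] at h1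
      exact (Measure.quasiMeasurePreserving_fst (μ := P) (ν := auxLaw T)).ae
        (ae_of_ae_map (hG.law N).aemeasurable h1)
    filter_upwards [hae] with ω hω N
    have hpd := padDir_dot_dir θ (S.data N ω.1) (gaussMatrix θ S N ω)
    have hrun (t : ℕ) (ht : t ≤ T) :
        S.Y θ N ω.1 t = run θ (S.data N ω.1) (gaussMatrix θ S N ω) t := by
      induction t with
      | zero => rfl
      | succ t ih =>
        have hU : S.U θ N ω.1 t
            = msg θ (S.data N ω.1) t (run θ (S.data N ω.1) (gaussMatrix θ S N ω) t) := by
          rw [← ih (by omega)]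
          rfl
        funext i
        rw [systemY_succ, full_mulVec_eq θ S N ω (hω N) (by omega), run, ← hU]
    have hU (t : ℕ) (ht : t < T) : S.U θ N ω.1 t
        = msg θ (S.data N ω.1) t (run θ (S.data N ω.1) (gaussMatrix θ S N ω) t) := by
      rw [← hrun t ht.le]
      rfl
    have hodd (t : ℕ) (ht : t < T) : dir θ (S.data N ω.1) (2 * t + 1) (gaussMatrix θ S N ω)
        = fullDir θ t (S.U θ N ω.1 t) := by rw [dir_odd, hU t ht]
    have heven (t : ℕ) (ht : t < T) : dir θ (S.data N ω.1) (2 * t) (gaussMatrix θ S N ω)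
        = fixedDir θ (S.U θ N ω.1 t) := by rw [dir_even, hU t ht]
    have hexp (j : ℕ) (hj : j < 2 * T) (n : Fin N) :
        mulv (gaussMatrix θ S N ω) (dir θ (S.data N ω.1) j (gaussMatrix θ S N ω)) n
        = ∑ q : Fin (2 * T), (e N ω q ⬝ᵥ dir θ (S.data N ω.1) j (gaussMatrix θ S N ω))
          * mulv (gaussMatrix θ S N ω) (e N ω q) n := by
      have he := eq_sum_orth_fin (padDir_dot T N) hpd hj
      conv_lhs => rw [he]
      simp only [mulv, Finset.sum_apply, Pi.smul_apply, smul_eq_mul, Finset.mul_sum, e, onDir]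
      rw [Finset.sum_comm]
      refine Finset.sum_congr rfl fun r _ => Finset.sum_congr rfl fun l _ => by ring
    have hgram (i j : ℕ) (hj : j < 2 * T) :=
      dot_eq_sum_orth (i := i) (padDir_dot T N) hpd hj
    refine ⟨fun t ht n => ?_, fun t ht n => ?_, fun s hs t ht => ?_, fun s hs t ht => ?_,
      fun s hs t ht => ?_⟩
    · rw [systemY_succ, full_mulVec_eq θ S N ω (hω N) ht, ← hodd t ht, hexp _ (by omega)]
    · rw [systemR_eq, fixed_mulVec_eq θ S N ω (hω N), ← heven t ht, hexp _ (by omega)]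
    · refine (hgram _ _ (by omega)).symm.trans ?_
      rw [hodd s hs, hodd t ht, fullDir_dot_fullDir θ hs]
    · refine (hgram _ _ (by omega)).symm.trans ?_
      rw [hodd t ht, heven s hs, fixedDir_dot_fullDir]
    · refine (hgram _ _ (by omega)).symm.trans ?_
      rw [heven t ht, heven s hs, fixedDir_dot_fixedDir]

end Representation

/-! ### Laws of large numbers conditional on the data. -/

section Centering

variable {Ω : Type*} [MeasurableSpace Ω] {P : Measure Ω} [IsProbabilityMeasure P]
  {E : Type*} [MeasurableSpace E] (μ : Measure E) [IsProbabilityMeasure μ]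
  {D : ℕ → Type*} [∀ N, MeasurableSpace (D N)] {δ : ∀ N, Measure (D N)}
  [∀ N, IsProbabilityMeasure (δ N)] {ξ : ∀ N, Ω → Fin N → E} {d : ∀ N, Ω → D N}

/-- Averages of bounded functions of independent variables are close to the averages of their
conditional means given the independent data. -/
lemma ae_tendsto_avg_sub_integral
    (hlaw : ∀ N, HasLaw (fun ω => (d N ω, ξ N ω)) ((δ N).prod (Measure.pi fun _ => μ)) P)
    {F : ∀ N, D N → Fin N → E → ℝ}
    (hF : ∀ N n, Measurable fun p : D N × E => F N p.1 n p.2) {C : ℝ}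
    (hC : ∀ N e n x, |F N e n x| ≤ C)
    {a : ∀ N, D N → Fin N → ℝ} (ham : ∀ N n, Measurable fun e => a N e n)
    (ha : ∀ᵐ ω ∂P, ∃ A : ℝ, ∀ᶠ N in atTop, avg (fun n => a N (d N ω) n ^ 2) ≤ A) :
    ∀ᵐ ω ∂P, Tendsto (fun N => avg fun n => a N (d N ω) n *
      (F N (d N ω) n (ξ N ω n) - ∫ x, F N (d N ω) n x ∂μ)) atTop (𝓝 0) := by
  have hmF (N : ℕ) (e : D N) (n : Fin N) : Measurable (F N e n) :=
    (hF N n).comp measurable_prodMk_left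
  have hi (N : ℕ) (e : D N) (n : Fin N) : Integrable (F N e n) μ :=
    .of_bound (hmF N e n).aestronglyMeasurable C (.of_forall fun x => hC N e n x)
  have hint (N : ℕ) (e : D N) (n : Fin N) : |∫ x, F N e n x ∂μ| ≤ C := by
    simpa using norm_integral_le_of_norm_le_const (μ := μ) (f := F N e n) (C := C)
      (.of_forall fun x => hC N e n x)
  have hb (N : ℕ) (e : D N) (n : Fin N) (x : E) :
      |F N e n x - ∫ y, F N e n y ∂μ| ≤ 2 * C := by
    have h1 := abs_le.1 (hC N e n x)
    have h2 := abs_le.1 (hint N e n)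
    exact abs_le.2 ⟨by linarith [h1.1, h2.2], by linarith [h1.2, h2.1]⟩
  have hm (N : ℕ) (e : D N) (n : Fin N) (j : ℕ) : AEStronglyMeasurable
      (fun x => (F N e n x - ∫ y, F N e n y ∂μ) ^ j) μ :=
    (((hmF N e n).sub_const _).pow_const _).aestronglyMeasurable
  have hpow (N : ℕ) (e : D N) (n : Fin N) (x : E) (j : ℕ) :
      ‖(F N e n x - ∫ y, F N e n y ∂μ) ^ j‖ ≤ (2 * C) ^ j := by
    rw [norm_pow, Real.norm_eq_abs]
    exact pow_le_pow_left₀ (abs_nonneg _) (hb N e n x) j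
  have hpi (N : ℕ) (e : D N) (n : Fin N) (j : ℕ) :
      ∫ x, (F N e n x - ∫ y, F N e n y ∂μ) ^ j ∂μ ≤ (2 * C) ^ j := by
    refine (le_abs_self _).trans ?_
    simpa using norm_integral_le_of_norm_le_const (μ := μ) (.of_forall fun x => hpow N e n x j)
  -- The centred variables are bounded by $2C$; with $m=(2C)^2$ the second moment is at most $m$ and
  -- the fourth at most $m^2$.
  refine ae_tendsto_avg_zero μ hlaw (F := fun N e n x => F N e n x - ∫ y, F N e n y ∂μ)
    (m := (2 * C) ^ 2) (fun N n => ?_) (fun N e n => ?_) (fun N e n => ?_)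
    (fun N e n => hpi N e n 2)
    (fun N e n => (hpi N e n 4).trans ?_) ham ha
  · refine (hF N n).sub ?_
    exact ((hF N n).stronglyMeasurable.integral_prod_right' (ν := μ)).measurable.comp measurable_fst
  · exact .of_bound (hm N e n 4) _ (.of_forall fun x => hpow N e n x 4)
  · rw [integral_sub (hi N e n) (integrable_const _)]
    simp
  · nlinarith [sq_nonneg ((2 * C) ^ 2)]

/-- Averages of independent variables with a fourth moment converge to the mean almost surely,
whatever the coupling between different system sizes. -/
lemma ae_tendsto_avg_of_pow_four
    (hlaw : ∀ N, HasLaw (fun ω => (d N ω, ξ N ω)) ((δ N).prod (Measure.pi fun _ => μ)) P)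
    {f : E → ℝ} (hf : Measurable f) (h4 : MemLp f 4 μ) :
    ∀ᵐ ω ∂P, Tendsto (fun N => avg fun n => f (ξ N ω n)) atTop (𝓝 (∫ x, f x ∂μ)) := by
  set c := ∫ x, f x ∂μ with hc
  have hg : MemLp (fun x => f x - c) 4 μ := h4.sub (memLp_const c)
  have hg4 : Integrable (fun x => (f x - c) ^ 4) μ := by
    have := hg.integrable_norm_pow (p := 4) (by norm_num)
    simpa [Even.pow_abs (by decide : Even 4)] using this
  -- The summand $1$ makes $m\ge1$, so that $3m^2\ge m$ also dominates the fourth moment.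
  set m := 1 + ∫ x, (f x - c) ^ 2 ∂μ + ∫ x, (f x - c) ^ 4 ∂μ with hm
  have h2' : 0 ≤ ∫ x, (f x - c) ^ 2 ∂μ := integral_nonneg fun x => sq_nonneg _
  have h4' : 0 ≤ ∫ x, (f x - c) ^ 4 ∂μ := integral_nonneg fun x => Even.pow_nonneg (by decide) _
  have := ae_tendsto_avg_zero μ hlaw (F := fun _ _ _ x => f x - c) (m := m)
    (fun N n => by fun_prop) (fun _ _ _ => hg4) (fun _ _ _ => by
      rw [integral_sub (h4.integrable (by norm_num)) (integrable_const _)]; simp [hc])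
    (fun _ _ _ => by linarith) (fun _ _ _ => by nlinarith) (a := fun _ _ _ => 1)
    (fun N n => measurable_const) (.of_forall fun ω => ⟨1, .of_forall fun N => by
      simpa using avg_const_le zero_le_one⟩)
  filter_upwards [this] with ω hω
  have h1 := hω.add_const c
  rw [zero_add] at h1
  refine h1.congr' ?_
  filter_upwards [eventually_gt_atTop 0] with N hN
  simp only [one_mul]
  rw [avg_sub, avg_const_of_pos hN]
  ring

end Centering

lemma isGaussian_stdPi (κ : Type*) [Fintype κ] : IsGaussian (stdPi κ) := by
  have h : iIndepFun (fun (i : κ) (x : κ → ℝ) => x i) (stdPi κ) :=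
    iIndepFun_pi (X := fun _ : κ => (id : ℝ → ℝ)) fun _ => aemeasurable_id
  have h' := h.hasGaussianLaw fun i => ⟨by
    rw [(measurePreserving_eval (fun _ : κ => gaussianReal 0 1) i).map_eq]
    infer_instance⟩
  simpa using h'.isGaussian_map

/-- Integrating out the first variable of a bounded continuous function. -/
noncomputable def marginalBCF {A B : Type*} [TopologicalSpace A] [MeasurableSpace A]
    [OpensMeasurableSpace A] [TopologicalSpace B] [FirstCountableTopology B]
    (μ : Measure A) [IsProbabilityMeasure μ] (f : A × B →ᵇ ℝ) : B →ᵇ ℝ :=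
  BoundedContinuousFunction.ofNormedAddCommGroup (fun b => ∫ a, f (a, b) ∂μ)
    (continuous_of_dominated (bound := fun _ => ‖f‖)
      (fun b => (f.continuous.comp
        (by fun_prop : Continuous fun a => (a, b))).measurable.aestronglyMeasurable)
      (fun b => .of_forall fun a => f.norm_coe_le_norm _) (integrable_const _)
      (.of_forall fun a => by fun_prop)) ‖f‖ fun b => by
        simpa using norm_integral_le_of_norm_le_const (μ := μ) (f := fun a => f (a, b)) (C := ‖f‖)
          (.of_forall fun a => f.norm_coe_le_norm _)

/-! ### Uniform integrability of Gaussian variables, treatments and covariates. -/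

section Tails

lemma exists_integral_tail_lt {E : Type*} [MeasurableSpace E] {μ : Measure E} [IsFiniteMeasure μ]
    {h : E → ℝ} (hi : Integrable h μ) {ε : ℝ} (hε : 0 < ε) :
    ∃ R : ℕ, ∫ x, max (h x - R) 0 ∂μ < ε := by
  have ht : Tendsto (fun R : ℕ => ∫ x, max (h x - R) 0 ∂μ) atTop (𝓝 (∫ _, 0 ∂μ)) := by
    refine tendsto_integral_of_dominated_convergence (fun x => |h x|)
      (fun R => ((hi.sub (integrable_const _)).sup (integrable_const 0)).aestronglyMeasurable)
      hi.abs (fun R => .of_forall fun x => ?_) (.of_forall fun x => ?_)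
    · rw [Real.norm_of_nonneg (le_max_right _ _)]
      have : (0 : ℝ) ≤ R := R.cast_nonneg
      exact max_le (by linarith [le_abs_self (h x)]) (abs_nonneg _)
    · refine tendsto_const_nhds.congr' ?_
      obtain ⟨R, hR⟩ := exists_nat_ge (h x)
      filter_upwards [eventually_ge_atTop R] with R' hR'
      have : (R : ℝ) ≤ R' := by exact_mod_cast hR'
      rw [max_eq_right (by linarith)]
  rw [integral_zero] at ht
  exact (ht.eventually_lt_const hε).exists

/-- The tail $(h-R)^+$ is $h$ minus its truncation. Averages of both converge, hence so do those of
the tail, and the limiting tail is small for large $R$. -/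
lemma WeakConv.unifInt {E : Type*} [NormedAddCommGroup E] [MeasurableSpace E] [BorelSpace E]
    {z : ∀ N, Fin N → E} {μ : Measure E} [IsProbabilityMeasure μ] (hz : WeakConv z μ) {h : E → ℝ}
    (hc : Continuous h) (h0 : ∀ x, 0 ≤ h x) (hi : Integrable h μ)
    (hm : Tendsto (fun N => avg fun n => h (z N n)) atTop (𝓝 (∫ x, h x ∂μ))) :
    UnifInt fun N n => h (z N n) := by
  intro ε hε
  obtain ⟨R, hR⟩ := exists_integral_tail_lt hi hε
  refine ⟨R, ?_⟩
  have hcl (x : E) : max (h x - R) 0 = h x - clip R (h x) := by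
    have h1 := h0 x
    have h2 : (0 : ℝ) ≤ R := R.cast_nonneg
    unfold clip
    rw [max_eq_right ((neg_nonpos.2 h2).trans (le_min h1 h2)), min_def, max_def]
    split_ifs <;> linarith
  have hb := hz (clipBCF R (by positivity) h hc)
  have hlim := hm.sub hb
  have e1 : ∫ x, h x ∂μ - ∫ x, clipBCF R (by positivity) h hc x ∂μ
      = ∫ x, max (h x - R) 0 ∂μ := by
    rw [← integral_sub hi (bcf_integrable μ _)]
    exact integral_congr_ae (.of_forall fun x => (hcl x).symm)
  rw [e1] at hlim
  filter_upwards [hlim.eventually_lt_const hR] with N hN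
  refine le_trans (le_of_eq ?_) hN.le
  rw [← avg_sub]
  simp only [hcl]
  rfl

/-- Averages of i.i.d. integrable variables are almost surely uniformly integrable. -/
lemma ae_unifInt_of_iid {Ω E : Type*} [MeasurableSpace Ω] {P : Measure Ω} [IsProbabilityMeasure P]
    [MeasurableSpace E] {μ : Measure E} [IsProbabilityMeasure μ] {W : ℕ → Ω → E}
    (hlaw : ∀ n, HasLaw (W n) μ P) (hind : iIndepFun W P) {h : E → ℝ} (hm : Measurable h)
    (hi : Integrable h μ) : ∀ᵐ ω ∂P, UnifInt fun N (n : Fin N) => h (W n ω) := by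
  have key (R : ℕ) : ∀ᵐ ω ∂P, Tendsto (fun N => avg fun n : Fin N => max (h (W n ω) - R) 0) atTop
      (𝓝 (∫ x, max (h x - R) 0 ∂μ)) := by
    have hm' : Measurable fun x => max (h x - R) 0 := by fun_prop
    have hi' : Integrable (fun x => max (h x - R) 0) μ :=
      (hi.sub (integrable_const _)).sup (integrable_const 0)
    -- The treatments form a single sequence, independent of $N$, so the strong law applies to each
    -- tail and integrability of $h$ suffices.
    have h1 := strong_law_ae_real (μ := P) (fun n ω => max (h (W n ω) - R) 0)
      ((hlaw 0).map_eq ▸ hi' |>.comp_aemeasurable (hlaw 0).aemeasurable)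
      (fun i j hij => (hind.indepFun hij).comp hm' hm')
      (fun i => by
        have : IdentDistrib (W i) (W 0) P P :=
          ⟨(hlaw i).aemeasurable, (hlaw 0).aemeasurable, by
            rw [(hlaw i).map_eq, (hlaw 0).map_eq]⟩
        exact this.comp hm')
    have h2 : ∫ ω, max (h (W 0 ω) - R) 0 ∂P = ∫ x, max (h x - R) 0 ∂μ :=
      (hlaw 0).integral_comp hm'.aestronglyMeasurable
    rw [h2] at h1
    filter_upwards [h1] with ω hω
    refine hω.congr fun N => ?_
    rw [avg, Fin.sum_univ_eq_sum_range (fun n => max (h (W n ω) - R) 0)]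
  rw [← ae_all_iff] at key
  filter_upwards [key] with ω hω ε hε
  obtain ⟨R, hR⟩ := exists_integral_tail_lt hi hε
  exact ⟨R, ((hω R).eventually_lt_const hR).mono fun N hN => hN.le⟩

/-- The Gaussian arrays for different $N$ may be coupled in any way, so the strong law is replaced
by the fourth-moment law for $\|\xi\|^{2k}$, which bounds the mean squares of $\|\xi\|^k$. -/
lemma ae_unifInt_stdPi {Ω : Type*} [MeasurableSpace Ω] {P : Measure Ω} [IsProbabilityMeasure P]
    {κ : Type*} [Fintype κ] {D : ℕ → Type*} [∀ N, MeasurableSpace (D N)] {δ : ∀ N, Measure (D N)}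
    [∀ N, IsProbabilityMeasure (δ N)] {ξ : ∀ N, Ω → Fin N → κ → ℝ} {d : ∀ N, Ω → D N}
    (hlaw : ∀ N, HasLaw (fun ω => (d N ω, ξ N ω)) ((δ N).prod (Measure.pi fun _ => stdPi κ)) P)
    {k : ℝ} (hk : 0 < k) : ∀ᵐ ω ∂P, UnifInt fun N n => ‖ξ N ω n‖ ^ k := by
  have := isGaussian_stdPi κ
  have hmem : MemLp (fun x : κ → ℝ => ‖x‖ ^ (2 * k)) 4 (stdPi κ) := by
    have h1 := (IsGaussian.memLp_id (stdPi κ) (ENNReal.ofReal (8 * k))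
      ENNReal.ofReal_ne_top).norm_rpow_div (ENNReal.ofReal (2 * k))
    rw [ENNReal.toReal_ofReal (by positivity), ← ENNReal.ofReal_div_of_pos (by positivity),
      show 8 * k / (2 * k) = 4 by field_simp; norm_num] at h1
    simpa using h1
  have hmeas : Measurable fun x : κ → ℝ => ‖x‖ ^ (2 * k) := by fun_prop
  filter_upwards [ae_tendsto_avg_of_pow_four _ hlaw hmeas hmem] with ω hω
  refine unifInt_of_sq_bounded (C := ∫ x, ‖x‖ ^ (2 * k) ∂stdPi κ + 1) ?_
  filter_upwards [hω.eventually_le_const (lt_add_one _)] with N hN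
  refine le_trans (le_of_eq ?_) hN
  congr 1
  ext n
  rw [mul_comm, Real.rpow_mul (norm_nonneg _)]
  norm_cast

end Tails

/-! ### Polynomial growth. -/

section Growth

variable {E F : Type*} [NormedAddCommGroup E] [NormedAddCommGroup F] {k : ℝ}

lemma PolyGrowth.exists_nonneg {f : E → ℝ} (hf : PolyGrowth k f) :
    ∃ c : ℝ, 0 ≤ c ∧ ∀ x, |f x| ≤ c * (1 + ‖x‖ ^ k) := by
  obtain ⟨c, hc⟩ := hf.2
  refine ⟨|c|, abs_nonneg c, fun x => (hc x).trans ?_⟩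
  gcongr
  exact le_abs_self c

lemma polyGrowth_const (c : ℝ) : PolyGrowth k fun _ : E => c := by
  refine ⟨continuous_const, |c|, fun x => ?_⟩
  have : 0 ≤ ‖x‖ ^ k := by positivity
  nlinarith [abs_nonneg c]

lemma PolyGrowth.comp {f : F → ℝ} (hf : PolyGrowth k f) (hk : 0 ≤ k) {π : E → F}
    (hπ : Continuous π) (h : ∀ x, ‖π x‖ ≤ ‖x‖) : PolyGrowth k fun x => f (π x) := by
  obtain ⟨c, hc0, hc⟩ := hf.exists_nonneg
  refine ⟨hf.1.comp hπ, c, fun x => (hc _).trans ?_⟩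
  have := Real.rpow_le_rpow (norm_nonneg _) (h x) hk
  gcongr

lemma PolyGrowth.comp_coord {ι : Type*} [Fintype ι] {f : ℝ × F → ℝ} (hf : PolyGrowth k f)
    (hk : 0 ≤ k) (i : ι) : PolyGrowth k fun y : (ι → ℝ) × F => f (y.1 i, y.2) := by
  refine hf.comp hk (by fun_prop) fun y => ?_
  simp only [Prod.norm_def]
  exact max_le_max (norm_le_pi_norm y.1 i) le_rfl

lemma one_add_rpow_half_sq_le {r : ℝ} (hr : 0 ≤ r) : (1 + r ^ (k / 2)) ^ 2 ≤ 2 * (1 + r ^ k) := by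
  have : r ^ k = (r ^ (k / 2)) ^ 2 := by
    rw [← Real.rpow_natCast, ← Real.rpow_mul hr]
    congr 1
    push_cast
    ring
  nlinarith [sq_nonneg (r ^ (k / 2) - 1)]

/-- This is what growth of order $k/2$ of the messages provides: their products are test functions
of order $k$. -/
lemma PolyGrowth.mul {f g : E → ℝ} (hf : PolyGrowth (k / 2) f) (hg : PolyGrowth (k / 2) g) :
    PolyGrowth k fun x => f x * g x := by
  obtain ⟨c, hc0, hc⟩ := hf.exists_nonneg
  obtain ⟨d, hd0, hd⟩ := hg.exists_nonneg
  refine ⟨hf.1.mul hg.1, 2 * (c * d), fun x => ?_⟩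
  rw [abs_mul]
  calc |f x| * |g x| ≤ (c * (1 + ‖x‖ ^ (k / 2))) * (d * (1 + ‖x‖ ^ (k / 2))) :=
        mul_le_mul (hc x) (hd x) (abs_nonneg _) (by positivity)
    _ = c * d * (1 + ‖x‖ ^ (k / 2)) ^ 2 := by ring
    _ ≤ c * d * (2 * (1 + ‖x‖ ^ k)) := by
      gcongr
      exact one_add_rpow_half_sq_le (norm_nonneg _)
    _ = 2 * (c * d) * (1 + ‖x‖ ^ k) := by ring

lemma PolyGrowth.of_half {f : E → ℝ} (hf : PolyGrowth (k / 2) f) : PolyGrowth k f := by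
  simpa using hf.mul (polyGrowth_const 1)

end Growth

/-! ### Typical samples of Gaussian variables, treatments and covariates. -/

section Joint

variable {T M : ℕ}

/-- The size of a sample point, measured by the `k`-th powers of its components. -/
noncomputable def growthFn {A B C : Type*} [Norm A] [Norm B] [Norm C] (k : ℝ) (x : A × B × C) : ℝ :=
  1 + ‖x.1‖ ^ k + ‖x.2.1‖ ^ k + ‖x.2.2‖ ^ k

lemma continuous_growthFn {A B C : Type*} [NormedAddCommGroup A] [NormedAddCommGroup B]
    [NormedAddCommGroup C] {k : ℝ} (hk : 0 ≤ k) :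
    Continuous (growthFn (A := A) (B := B) (C := C) k) := by
  unfold growthFn
  have h (f : A × B × C → ℝ) (hf : Continuous f) : Continuous fun x => f x ^ k :=
    hf.rpow_const fun x => .inr hk
  have h1 := h (fun x => ‖x.1‖) (by fun_prop)
  have h2 := h (fun x => ‖x.2.1‖) (by fun_prop)
  have h3 := h (fun x => ‖x.2.2‖) (by fun_prop)
  fun_prop

/-- With $r=\max(1,\|x\|)$ one has $1+\|x\|\le2r$, and $r^k$ is one of the four terms of `growthFn`.
-/
lemma growthFn_of_norm_le {A B C G : Type*} [NormedAddCommGroup A] [NormedAddCommGroup B]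
    [NormedAddCommGroup C] [NormedAddCommGroup G] {k : ℝ} (hk : 0 ≤ k) {D : ℝ} (hD : 0 ≤ D)
    {x : A × B × C} {y : G} (h : ‖y‖ ≤ D * (1 + ‖x‖)) :
    1 + ‖y‖ ^ k ≤ (1 + (2 * D) ^ k) * growthFn k x := by
  obtain ⟨a, b, c⟩ := x
  have ha := Real.rpow_nonneg (norm_nonneg a) k
  have hb := Real.rpow_nonneg (norm_nonneg b) k
  have hc := Real.rpow_nonneg (norm_nonneg c) k
  set r := max 1 ‖(a, b, c)‖ with hr
  have hr1 : 1 ≤ r := le_max_left _ _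
  have hrk : r ^ k ≤ growthFn k (a, b, c) := by
    unfold growthFn
    simp only [hr, Prod.norm_mk]
    rcases max_choice 1 (max ‖a‖ (max ‖b‖ ‖c‖)) with h | h <;> rw [h]
    · rw [Real.one_rpow]; linarith
    rcases max_choice ‖a‖ (max ‖b‖ ‖c‖) with h | h <;> rw [h]
    · linarith
    rcases max_choice ‖b‖ ‖c‖ with h | h <;> rw [h] <;> linarith
  have h1 : 1 ≤ growthFn k (a, b, c) := by unfold growthFn; linarith
  have h2 : ‖y‖ ≤ 2 * D * r := by
    have : ‖(a, b, c)‖ ≤ r := le_max_right _ _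
    nlinarith
  have h3 : ‖y‖ ^ k ≤ (2 * D) ^ k * growthFn k (a, b, c) := by
    refine (Real.rpow_le_rpow (norm_nonneg _) h2 hk).trans ?_
    rw [Real.mul_rpow (by positivity) (by positivity)]
    gcongr
  linarith

lemma norm_le_growthFn {A B C : Type*} [NormedAddCommGroup A] [NormedAddCommGroup B]
    [NormedAddCommGroup C] {k : ℝ} (hk : 1 ≤ k) (x : A × B × C) : ‖x‖ ≤ growthFn k x := by
  have h (r : ℝ) (hr : 0 ≤ r) : r ≤ 1 + r ^ k := by
    rcases le_total r 1 with h | h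
    · linarith [Real.rpow_nonneg hr k]
    · linarith [Real.self_le_rpow_of_one_le h hk]
  obtain ⟨a, b, c⟩ := x
  have ha := Real.rpow_nonneg (norm_nonneg a) k
  have hb := Real.rpow_nonneg (norm_nonneg b) k
  have hc := Real.rpow_nonneg (norm_nonneg c) k
  have ha' := h _ (norm_nonneg a)
  have hb' := h _ (norm_nonneg b)
  have hc' := h _ (norm_nonneg c)
  unfold growthFn
  simp only [Prod.norm_mk]
  refine max_le ?_ (max_le ?_ ?_) <;> linarith

section

variable {Ω : Type*} [MeasurableSpace Ω] {P : Measure Ω} [IsProbabilityMeasure P]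
  {Pi : Measure (Vec T)} {pX : Measure (Vec M)} {S : Systems Ω T M}

lemma hasLaw_covariates_treatments (hW : RandomizedDesign P Pi S)
    (hX : ∀ N, AEMeasurable (S.X N) P) (N : ℕ) :
    HasLaw (fun ω => (S.X N ω, fun n : Fin N => S.W n ω))
      ((P.map (S.X N)).prod (Measure.pi fun _ => Pi)) P := by
  have hw : AEMeasurable (fun ω (n : Fin N) => S.W n ω) P :=
    aemeasurable_pi_lambda _ fun n => (hW.law n).aemeasurable
  have hind : IndepFun (S.X N) (fun ω (n : Fin N) => S.W n ω) P :=
    (hW.indep_covariates.comp (φ := fun (w : ℕ → Vec T) (n : Fin N) => w n)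
      (ψ := fun x : ∀ N, Fin N → Vec M => x N) (by fun_prop) (by fun_prop)).symm
  refine ⟨(hX N).prodMk hw, ?_⟩
  have hind' : iIndepFun (fun (n : Fin N) => S.W n) P := hW.iIndep.precomp Fin.val_injective
  have hmap := iIndepFun.map_fun_eq_pi_map (f := fun (n : Fin N) => S.W n)
    (fun n => (hW.law n).aemeasurable) hind'
  simp only [(hW.law _).map_eq] at hmap
  rw [(indepFun_iff_map_prod_eq_prod_map_map (hX N) hw).1 hind, hmap]

/-- If both variances vanished, the sequence in `initial_var` would be identically zero, against its
positive limit. -/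
lemma Regularity.sq_pos {k : ℝ} {θ : Params T M} {ν₁ v₁ : ℝ} {gbar : Vec T × Vec M → ℝ}
    (hR : Regularity k P θ S Pi pX ν₁ v₁ gbar) : 0 < θ.σ ^ 2 + θ.σt 0 ^ 2 := by
  refine lt_of_le_of_ne (by positivity) fun h0 => ?_
  obtain ⟨ω, hω⟩ := hR.initial_var.exists
  simp only [← h0, zero_mul] at hω
  exact hR.initial_var_pos.ne (tendsto_nhds_unique tendsto_const_nhds hω)

/-- The limit of the second moment of the initial messages. -/
noncomputable def initSq (θ : Params T M) (v₁ : ℝ) : ℝ := (v₁ - θ.σe ^ 2) / (θ.σ ^ 2 + θ.σt 0 ^ 2)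

lemma Regularity.tendsto_sq {k : ℝ} {θ : Params T M} {ν₁ v₁ : ℝ} {gbar : Vec T × Vec M → ℝ}
    (hR : Regularity k P θ S Pi pX ν₁ v₁ gbar) : ∀ᵐ ω ∂P,
    Tendsto (fun N => avg fun n => S.U θ N ω 0 n ^ 2) atTop (𝓝 (initSq θ v₁)) := by
  filter_upwards [hR.initial_var] with ω hω
  have h := hω.div_const (θ.σ ^ 2 + θ.σt 0 ^ 2)
  refine h.congr fun N => ?_
  rw [mul_div_cancel_left₀ _ hR.sq_pos.ne']

end

variable {Ω : Type*} [MeasurableSpace Ω] {P : Measure Ω} [IsProbabilityMeasure P]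
  {Pi : Measure (Vec T)} [IsProbabilityMeasure Pi] {pX : Measure (Vec M)} [IsProbabilityMeasure pX]
  {S : Systems Ω T M}

/-- The empirical distribution of treatments and covariates. -/
lemma ae_tendsto_treatment_covariate (hW : RandomizedDesign P Pi S)
    (hX : ∀ N, AEMeasurable (S.X N) P)
    (hpX : ∀ᵐ ω ∂P, ∀ f : Vec M →ᵇ ℝ,
      Tendsto (fun N => avg fun n => f (S.X N ω n)) atTop (𝓝 (∫ x, f x ∂pX)))
    (f : Vec T × Vec M →ᵇ ℝ) :
    ∀ᵐ ω ∂P, Tendsto (fun N => avg fun n : Fin N => f (S.W n ω, S.X N ω n)) atTop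
      (𝓝 (∫ q, f q ∂(Pi.prod pX))) := by
  have := fun N => Measure.isProbabilityMeasure_map (μ := P) (hX N)
  -- Given the covariates the treatments are i.i.d.; integrating them out leaves a bounded
  -- continuous function of the covariates, to which their weak convergence applies.
  have h := ae_tendsto_avg_sub_integral Pi (hasLaw_covariates_treatments hW hX)
    (F := fun N x n w => f (w, x n)) (fun N n => f.continuous.measurable.comp (by fun_prop))
    (C := ‖f‖) (fun N x n w => f.norm_coe_le_norm _) (a := fun _ _ _ => 1)
    (fun N n => measurable_const) (.of_forall fun ω => ⟨1, .of_forall fun N => by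
      simpa using avg_const_le zero_le_one⟩)
  filter_upwards [h, hpX] with ω h1 h2
  have h3 := h1.add (h2 (marginalBCF Pi f))
  have e : ∫ q, f q ∂(Pi.prod pX) = ∫ x, marginalBCF Pi f x ∂pX :=
    integral_prod_symm _ (bcf_integrable _ f)
  rw [e]
  rw [zero_add] at h3
  refine h3.congr fun N => ?_
  rw [← avg_add]
  congr 1
  ext n
  simp only [one_mul]
  exact sub_add_cancel _ _

/-- Weighted averages of functions of Gaussian variables, treatments and covariates, when the
Gaussian variables are independent of everything else. -/
lemma ae_tendsto_avg_gaussian {κ Q : Type*} [Fintype κ] [NormedAddCommGroup Q] [MeasurableSpace Q]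
    [BorelSpace Q] [SecondCountableTopology Q]
    {ν : Measure Q} [IsProbabilityMeasure ν] {D : ℕ → Type*} [∀ N, MeasurableSpace (D N)]
    {δ : ∀ N, Measure (D N)} [∀ N, IsProbabilityMeasure (δ N)] {ξ : ∀ N, Ω → Fin N → κ → ℝ}
    {d : ∀ N, Ω → D N}
    (hlaw : ∀ N, HasLaw (fun ω => (d N ω, ξ N ω)) ((δ N).prod (Measure.pi fun _ => stdPi κ)) P)
    {a : ∀ N, D N → Fin N → ℝ} (ham : ∀ N n, Measurable fun e => a N e n)
    (ha : ∀ᵐ ω ∂P, ∃ A : ℝ, ∀ᶠ N in atTop, avg (fun n => a N (d N ω) n ^ 2) ≤ A)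
    {q : ∀ N, D N → Fin N → Q} (hq : ∀ N n, Measurable fun e => q N e n) {b : Q → ℝ}
    (hb : Integrable b ν)
    (hab : ∀ f : Q →ᵇ ℝ, ∀ᵐ ω ∂P, Tendsto
      (fun N => avg fun n => a N (d N ω) n * f (q N (d N ω) n)) atTop (𝓝 (∫ x, b x * f x ∂ν)))
    (f : (κ → ℝ) × Q →ᵇ ℝ) :
    ∀ᵐ ω ∂P, Tendsto (fun N => avg fun n => a N (d N ω) n * f (ξ N ω n, q N (d N ω) n)) atTop
      (𝓝 (∫ x, b x.2 * f x ∂((stdPi κ).prod ν))) := by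
  have h := ae_tendsto_avg_sub_integral (stdPi κ) hlaw
    (F := fun N e n x => f (x, q N e n)) (fun N n => f.continuous.measurable.comp
      (measurable_snd.prodMk ((hq N n).comp measurable_fst)))
    (C := ‖f‖) (fun N x n w => f.norm_coe_le_norm _) ham ha
  filter_upwards [h, hab (marginalBCF (stdPi κ) f)] with ω h1 h2
  have h3 := h1.add h2
  have hi : Integrable (fun x : (κ → ℝ) × Q => b x.2 * f x) ((stdPi κ).prod ν) :=
    (hb.comp_snd _).mul_bdd f.continuous.measurable.aestronglyMeasurable
      (.of_forall fun x => f.norm_coe_le_norm x)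
  have e : ∫ x, b x.2 * f x ∂((stdPi κ).prod ν) = ∫ x, b x * marginalBCF (stdPi κ) f x ∂ν := by
    rw [integral_prod_symm _ hi]
    simp only [integral_const_mul]
    rfl
  rw [e]
  rw [zero_add] at h3
  refine h3.congr fun N => ?_
  rw [← avg_add]
  congr 1
  ext n
  change a N (d N ω) n * (_ - marginalBCF (stdPi κ) f (q N (d N ω) n)) + _ = _
  ring

lemma integrable_of_polyGrowth {k : ℝ}
    (hPi : Integrable (fun w : Vec T => ‖w‖ ^ k) Pi)
    (hpX : Integrable (fun x : Vec M => ‖x‖ ^ k) pX) {f : Vec T × Vec M → ℝ}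
    (hf : PolyGrowth k f) : Integrable f (Pi.prod pX) := by
  obtain ⟨c, hc0, hc⟩ := hf.exists_nonneg
  have hi : Integrable (fun q : Vec T × Vec M => c * (1 + ‖q.1‖ ^ k + ‖q.2‖ ^ k)) (Pi.prod pX) :=
    (((integrable_const 1).add (hPi.comp_fst pX)).add (hpX.comp_snd Pi)).const_mul c
  refine hi.mono' hf.1.measurable.aestronglyMeasurable (.of_forall fun q => (hc q).trans ?_)
  have h1 := Real.rpow_nonneg (norm_nonneg q.1) k
  have h2 := Real.rpow_nonneg (norm_nonneg q.2) k
  refine mul_le_mul_of_nonneg_left ?_ hc0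
  rw [Prod.norm_def]
  rcases max_choice ‖q.1‖ ‖q.2‖ with h | h <;> rw [h] <;> linarith

/-- A countable family of bounded continuous functions which is dense for the uniform convergence
on bounded sets. -/
noncomputable def denseBCF (E : Type*) [NormedAddCommGroup E] [ProperSpace E] :
    ℕ → ℕ → (E →ᵇ ℝ) := exists_dense_boundedContinuous.choose

/-- The limits satisfied by a typical sample of Gaussian variables, treatments and covariates, with
weights `a`. -/
structure SampleLimit {κ : Type*} [Fintype κ] (k : ℝ) (ν : Measure (Vec T × Vec M))
    (b : Vec T × Vec M → ℝ) (q₀ : ℝ) (z : ∀ N, Fin N → (κ → ℝ) × Vec T × Vec M)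
    (a : ∀ N, Fin N → ℝ) : Prop where
  weak : WeakConv z ((stdPi κ).prod ν)
  unifInt : UnifInt fun N n => growthFn k (z N n)
  sq : Tendsto (fun N => avg fun n => a N n ^ 2) atTop (𝓝 q₀)
  weighted : ∀ R i, Tendsto (fun N => avg fun n =>
    a N n * denseBCF ((κ → ℝ) × Vec T × Vec M) R i (z N n)) atTop
    (𝓝 (∫ x, b x.2 * denseBCF ((κ → ℝ) × Vec T × Vec M) R i x ∂((stdPi κ).prod ν)))

/-- Almost every sample is typical. -/
theorem ae_sampleLimit {k : ℝ} (hk : 2 ≤ k) (hT : 0 < T) {θ : Params T M} {ν₁ v₁ : ℝ}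
    {gbar : Vec T × Vec M → ℝ} (hG : GaussianInterference P θ S) (hW : RandomizedDesign P Pi S)
    (hR : Regularity k P θ S Pi pX ν₁ v₁ gbar) {κ Ω' : Type*} [Fintype κ] [MeasurableSpace Ω']
    {P' : Measure Ω'} [IsProbabilityMeasure P'] {ζ : ∀ N, Ω × Ω' → Fin N → κ → ℝ}
    (hζ : ∀ N, HasLaw (fun ω => (S.data N ω.1, ζ N ω))
      ((P.map (S.data N)).prod (Measure.pi fun _ => stdPi κ)) (P.prod P')) :
    ∀ᵐ ω ∂(P.prod P'), SampleLimit k (Pi.prod pX) gbar (initSq θ v₁)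
      (fun N n => (ζ N ω n, S.W n ω.1, S.X N ω.1 n)) (fun N n => S.U θ N ω.1 0 n) := by
  have := fun N => Measure.isProbabilityMeasure_map (μ := P) (hG.aemeasurable_data N)
  have hk0 : 0 < k := by linarith
  have hlift {p : Ω → Prop} (h : ∀ᵐ ω ∂P, p ω) : ∀ᵐ ω ∂(P.prod P'), p ω.1 :=
    Measure.quasiMeasurePreserving_fst.ae h
  have hX (N : ℕ) : AEMeasurable (S.X N) P := (hG.aemeasurable_data N).snd.snd
  have hq (N : ℕ) (n : Fin N) : Measurable fun e : DataSp T M N => (e.2.1 n, e.2.2 n) := by fun_prop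
  have hb : Integrable gbar (Pi.prod pX) := integrable_of_polyGrowth hR.treatment_moment
    hR.covariates_moment hR.gbar_growth.of_half
  have hone := ae_tendsto_treatment_covariate hW hX hR.covariates_weak
  have hg0 := (hR.growth 0 hT).1.measurable
  have hφ := fun f : (κ → ℝ) × Vec T × Vec M →ᵇ ℝ => ae_tendsto_avg_gaussian
    (Q := Vec T × Vec M) (ν := Pi.prod pX) hζ (a := fun _ _ _ => 1) (fun N n => measurable_const)
    (.of_forall fun ω => ⟨1, .of_forall fun N => by simpa using avg_const_le zero_le_one⟩)
    (q := fun N e n => (e.2.1 n, e.2.2 n)) hq (b := fun _ => 1) (integrable_const _)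
    (fun f => by
      simp only [one_mul]
      exact hlift (hone f)) f
  -- The weight is $U_0$, a function of the data alone, hence independent of the Gaussian variables;
  -- its averages against functions of $(W,X)$ are given by $\bar g_0$.
  have hψ := fun f : (κ → ℝ) × Vec T × Vec M →ᵇ ℝ => ae_tendsto_avg_gaussian
    (Q := Vec T × Vec M) (ν := Pi.prod pX) hζ (a := fun N e n => θ.g 0 (e.1 n, e.2.1 n, e.2.2 n))
    (fun N n => hg0.comp (by fun_prop))
    (by
      filter_upwards [hlift hR.tendsto_sq] with ω hω
      exact ⟨initSq θ v₁ + 1, hω.eventually_le_const (lt_add_one _)⟩)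
    (q := fun N e n => (e.2.1 n, e.2.2 n)) hq hb
    (fun f => hlift (hR.gbar_tendsto f ⟨f.continuous, ‖f‖, fun x => by
      have h1 := Real.rpow_nonneg (norm_nonneg x) (k / 2)
      have h2 := f.norm_coe_le_norm x
      rw [Real.norm_eq_abs] at h2
      nlinarith [norm_nonneg f]⟩)) f
  -- Only a countable family is tested, so that one null set serves all test functions.
  have hφ' := ae_all_iff.2 fun R => ae_all_iff.2 fun i => hφ (denseBCF _ R i)
  have hψ' := ae_all_iff.2 fun R => ae_all_iff.2 fun i => hψ (denseBCF _ R i)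
  filter_upwards [hφ', hψ', hlift hR.tendsto_sq, ae_unifInt_stdPi hζ hk0,
    hlift (ae_unifInt_of_iid hW.law hW.iIndep (h := fun w => ‖w‖ ^ k) (by fun_prop)
      hR.treatment_moment), hlift hR.covariates_weak, hlift hR.covariates_tendsto_moment]
    with ω h1 h2 h3 h4 h5 h6 h7
  have h8 : UnifInt fun N n => ‖S.X N ω.1 n‖ ^ k := WeakConv.unifInt (h := fun x => ‖x‖ ^ k) h6
    (continuous_norm.rpow_const fun x => .inr hk0.le) (fun x => by positivity)
    hR.covariates_moment h7
  have hu := (((unifInt_const 1).add h4).add h5).add h8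
  refine ⟨weakConv_of_dense exists_dense_boundedContinuous.choose_spec.1
    exists_dense_boundedContinuous.choose_spec.2 (fun R i => ?_)
    (hu.mono fun N n => norm_le_growthFn (by linarith) _), hu, h3, h2⟩
  have h9 := h1 R i
  simp only [one_mul] at h9
  exact h9

end Joint

/-! ### Affine substitutions of Gaussian variables. -/

section Affine

variable {ι κ κ' Q : Type*} [Fintype κ] [Fintype κ']

/-- An affine substitution in the first variable. -/
noncomputable def affine (c : ι → ℝ) (L : ι → κ → ℝ) (x : (κ → ℝ) × Q) : (ι → ℝ) × Q :=
  (c + linMap L x.1, x.2)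

lemma affine_fst_apply (c : ι → ℝ) (L : ι → κ → ℝ) (x : (κ → ℝ) × Q) (i : ι) :
    (affine c L x).1 i = c i + ∑ q, L i q * x.1 q := by
  simp [affine, linMap_apply]

lemma continuous_affine [TopologicalSpace Q] :
    Continuous fun p : ((ι → ℝ) × (ι → κ → ℝ)) × (κ → ℝ) × Q => affine p.1.1 p.1.2 p.2 := by
  unfold affine
  refine .prodMk (continuous_pi fun i => ?_) (by fun_prop)
  simp only [Pi.add_apply, linMap_apply]
  fun_prop

lemma norm_affine_le [Fintype ι] [NormedAddCommGroup Q] {c : ι → ℝ} {L : ι → κ → ℝ} {B : ℝ}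
    (hc : ‖c‖ ≤ B) (hL : ‖L‖ ≤ B) (x : (κ → ℝ) × Q) :
    ‖affine c L x‖ ≤ (1 + B + Fintype.card κ * B) * (1 + ‖x‖) := by
  have hB : 0 ≤ B := (norm_nonneg _).trans hc
  have hx1 : ‖x.1‖ ≤ ‖x‖ := norm_fst_le x
  have hx2 : ‖x.2‖ ≤ ‖x‖ := norm_snd_le x
  have hx := norm_nonneg x
  have hcard : (0 : ℝ) ≤ Fintype.card κ * B := by positivity
  rw [Prod.norm_def]
  refine max_le ?_ ?_
  · rw [pi_norm_le_iff_of_nonneg (by positivity)]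
    intro i
    rw [affine_fst_apply]
    calc ‖c i + ∑ q, L i q * x.1 q‖ ≤ ‖c i‖ + ∑ q, ‖L i q * x.1 q‖ :=
          (norm_add_le _ _).trans (by gcongr; exact norm_sum_le _ _)
      _ ≤ B + ∑ _q : κ, B * ‖x‖ := by
          gcongr with q
          · exact (norm_le_pi_norm c i).trans hc
          · rw [norm_mul]
            gcongr
            · exact ((norm_le_pi_norm (L i) q).trans (norm_le_pi_norm L i)).trans hL
            · exact (norm_le_pi_norm x.1 q).trans hx1
      _ = B + Fintype.card κ * B * ‖x‖ := by simp; ring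
      _ ≤ _ := by nlinarith
  · change ‖x.2‖ ≤ _
    nlinarith

variable [Fintype ι]

lemma measurable_affine [MeasurableSpace Q] (c : ι → ℝ) (L : ι → κ → ℝ) :
    Measurable (affine c L : (κ → ℝ) × Q → (ι → ℝ) × Q) :=
  (((linMap L).continuous.measurable.comp measurable_fst).const_add c).prodMk measurable_snd

lemma map_affine [MeasurableSpace Q] (ν : Measure Q) [SFinite ν] (c : ι → ℝ) (L : ι → κ → ℝ) :
    ((stdPi κ).prod ν).map (affine c L)
      = (((stdPi κ).map (linMap L)).prod ν).map (Prod.map (c + ·) id) := by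
  rw [← Measure.map_id (μ := ν), Measure.map_prod_map _ _ (linMap L).measurable measurable_id,
    Measure.map_id, Measure.map_map (by fun_prop) ((linMap L).measurable.prodMap measurable_id)]
  rfl

lemma map_affine_eq [MeasurableSpace Q] (ν : Measure Q) [SFinite ν] (c : ι → ℝ) (L : ι → κ → ℝ)
    (L' : ι → κ' → ℝ) (h : ∀ i j, ∑ q, L i q * L j q = ∑ q, L' i q * L' j q) :
    ((stdPi κ).prod ν).map (affine c L) = ((stdPi κ').prod ν).map (affine c L') := by
  rw [map_affine, map_affine, map_linMap_eq L L' h]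

lemma integrable_affine_iff [MeasurableSpace Q] {ν : Measure Q} [SFinite ν] {c : ι → ℝ}
    {L : ι → κ → ℝ} {L' : ι → κ' → ℝ} (h : ∀ i j, ∑ q, L i q * L j q = ∑ q, L' i q * L' j q)
    {ψ : (ι → ℝ) × Q → ℝ} (hψ : Measurable ψ) :
    Integrable (fun x => ψ (affine c L x)) ((stdPi κ).prod ν)
      ↔ Integrable (fun x => ψ (affine c L' x)) ((stdPi κ').prod ν) := by
  have hm := measurable_affine (Q := Q) c L
  have hm' := measurable_affine (Q := Q) c L'
  rw [← Function.comp_def, ← Function.comp_def,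
    ← integrable_map_measure hψ.aestronglyMeasurable hm.aemeasurable,
    ← integrable_map_measure hψ.aestronglyMeasurable hm'.aemeasurable, map_affine_eq ν c L L' h]

lemma integral_affine_eq [MeasurableSpace Q] {ν : Measure Q} [SFinite ν] {c : ι → ℝ}
    {L : ι → κ → ℝ} {L' : ι → κ' → ℝ} (h : ∀ i j, ∑ q, L i q * L j q = ∑ q, L' i q * L' j q)
    {ψ : (ι → ℝ) × Q → ℝ} (hψ : Measurable ψ) :
    ∫ x, ψ (affine c L x) ∂((stdPi κ).prod ν) = ∫ x, ψ (affine c L' x) ∂((stdPi κ').prod ν) := by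
  have hm := measurable_affine (Q := Q) c L
  have hm' := measurable_affine (Q := Q) c L'
  rw [← integral_map hm.aemeasurable hψ.aestronglyMeasurable,
    ← integral_map hm'.aemeasurable hψ.aestronglyMeasurable, map_affine_eq ν c L L' h]

end Affine

section Family

variable {ι κ : Type*} [Fintype κ] {T M : ℕ}

/-- A continuous function after an affine substitution. -/
noncomputable def affineComp (ψ : C((ι → ℝ) × Vec T × Vec M, ℝ)) (p : (ι → ℝ) × (ι → κ → ℝ)) :
    C((κ → ℝ) × Vec T × Vec M, ℝ) :=
  ⟨fun x => ψ (affine p.1 p.2 x), ψ.continuous.comp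
    (continuous_affine.comp (by fun_prop : Continuous fun x : (κ → ℝ) × Vec T × Vec M => (p, x)))⟩

/-- Continuity into the compact-open topology: when the random coefficients converge, the composed
test functions converge locally uniformly. -/
lemma continuous_affineComp (ψ : C((ι → ℝ) × Vec T × Vec M, ℝ)) :
    Continuous (affineComp (κ := κ) ψ) :=
  ContinuousMap.continuous_of_continuous_uncurry _ (ψ.continuous.comp continuous_affine)

end Family

/-! ### Limits of averages when only Gram matrices converge. -/

section Limits

variable {ι κ κ' : Type*} [Fintype ι] [Fintype κ] [Fintype κ']

/-- Convergence of the Gram matrices of a sequence of families of vectors. -/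
def GramTendsto (L : ℕ → ι → κ → ℝ) (Γ : ι → ι → ℝ) : Prop :=
  ∀ i j, Tendsto (fun N => ∑ q, L N i q * L N j q) atTop (𝓝 (Γ i j))

lemma GramTendsto.bounded {L : ℕ → ι → κ → ℝ} {Γ : ι → ι → ℝ} (h : GramTendsto L Γ) :
    ∃ B, ∀ N, ‖L N‖ ≤ B := by
  have h1 : Tendsto (fun N i => ∑ q, L N i q * L N i q) atTop (𝓝 fun i => Γ i i) :=
    tendsto_pi_nhds.2 fun i => h i i
  obtain ⟨b, hb⟩ := (Metric.isBounded_range_of_tendsto _ h1).exists_norm_le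
  have hb' (N : ℕ) := hb _ (Set.mem_range_self N)
  have hb0 : 0 ≤ b := (norm_nonneg _).trans (hb' 0)
  refine ⟨1 + b, fun N => (pi_norm_le_iff_of_nonneg (by positivity)).2 fun i =>
    (pi_norm_le_iff_of_nonneg (by positivity)).2 fun q => ?_⟩
  have h2 : L N i q * L N i q ≤ b := by
    refine (Finset.single_le_sum (f := fun q => L N i q * L N i q)
      (fun q _ => mul_self_nonneg _) (Finset.mem_univ q)).trans ?_
    exact (le_abs_self _).trans ((norm_le_pi_norm _ i).trans (hb' N))
  rw [Real.norm_eq_abs]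
  nlinarith [abs_mul_abs_self (L N i q), sq_nonneg (|L N i q| - 1)]

/-- Convergence of the Gram matrices leaves an orthogonal transformation of `L N` free, so the
sequence itself need not converge; boundedness gives limits along ultrafilters, each with Gram
matrix `Γ`. -/
lemma GramTendsto.exists_tendsto_ultrafilter {L : ℕ → ι → κ → ℝ} {Γ : ι → ι → ℝ}
    (h : GramTendsto L Γ) (l : Ultrafilter ℕ) (hl : ↑l ≤ (atTop : Filter ℕ)) :
    ∃ L₀, Tendsto L l (𝓝 L₀) ∧ ∀ i j, ∑ q, L₀ i q * L₀ j q = Γ i j := by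
  obtain ⟨B, hB⟩ := h.bounded
  obtain ⟨L₀, -, hL₀⟩ := (isCompact_closedBall (0 : ι → κ → ℝ) B).ultrafilter_le_nhds (l.map L) (by
    rw [Filter.le_principal_iff]
    exact Filter.Eventually.of_forall (f := (l : Filter ℕ))
      (p := fun N => L N ∈ Metric.closedBall 0 B) fun N => by simpa using hB N)
  refine ⟨L₀, hL₀, fun i j => tendsto_nhds_unique (f := fun N => ∑ q, L N i q * L N j q) (l := l)
    ?_ ((h i j).mono_left hl)⟩
  have hc : Continuous fun L : ι → κ → ℝ => ∑ q, L i q * L j q := by fun_prop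
  exact (hc.tendsto L₀).comp hL₀

lemma GramTendsto.exists_eq {L : ℕ → ι → κ → ℝ} {Γ : ι → ι → ℝ} (h : GramTendsto L Γ) :
    ∃ L₀ : ι → κ → ℝ, ∀ i j, ∑ q, L₀ i q * L₀ j q = Γ i j := by
  obtain ⟨L₀, -, h₀⟩ := h.exists_tendsto_ultrafilter (Ultrafilter.of atTop) (Ultrafilter.of_le _)
  exact ⟨L₀, h₀⟩

variable {T M : ℕ} {k : ℝ} {ν : Measure (Vec T × Vec M)} [IsProbabilityMeasure ν]
  {b : Vec T × Vec M → ℝ} {q₀ : ℝ} {z : ∀ N, Fin N → (κ → ℝ) × Vec T × Vec M} {a : ∀ N, Fin N → ℝ}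

/-- A bound uniform over all coefficients of norm at most `B`. The exponent `j` is 1 for test
functions of order $k$ and 2 for those of order $k/2$, which are needed in mean square. -/
lemma exists_growth_bound (hk : 0 ≤ k) {B : ℝ} (hB : 0 ≤ B) {ψ : (ι → ℝ) × Vec T × Vec M → ℝ}
    {j : ℕ} {d : ℝ} (hd0 : 0 ≤ d) (hd : ∀ y, |ψ y| ^ j ≤ d * (1 + ‖y‖ ^ k)) :
    ∃ C, 1 ≤ C ∧ ∀ (c : ι → ℝ) (L : ι → κ → ℝ), ‖c‖ ≤ B → ‖L‖ ≤ B →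
      ∀ x, |ψ (affine c L x)| ^ j ≤ C * growthFn k x := by
  set D : ℝ := 1 + B + Fintype.card κ * B
  have hD : 0 ≤ D := by positivity
  refine ⟨1 + d * (1 + (2 * D) ^ k), ?_, fun c L hc hL x => ?_⟩
  · exact le_add_of_nonneg_right (by positivity)
  · have h0 : 0 ≤ growthFn k x := by unfold growthFn; positivity
    have h1 := growthFn_of_norm_le hk hD (norm_affine_le hc hL x)
    have h2 := mul_le_mul_of_nonneg_left h1 hd0
    have h3 := hd (affine c L x)
    nlinarith

/-- Limits of averages along a typical sample: the coefficients of the Gaussian variables only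
enter through the limit of their Gram matrix. -/
theorem SampleLimit.tendsto_avg (hs : SampleLimit k ν b q₀ z a) (hk : 2 ≤ k) {c : ℕ → ι → ℝ}
    {c₀ : ι → ℝ} (hc : Tendsto c atTop (𝓝 c₀)) {L : ℕ → ι → κ → ℝ} {Γ : ι → ι → ℝ}
    (hL : GramTendsto L Γ) {L₀ : ι → κ' → ℝ} (hL₀ : ∀ i j, ∑ q, L₀ i q * L₀ j q = Γ i j)
    {ψ : (ι → ℝ) × Vec T × Vec M → ℝ} (hψ : PolyGrowth k ψ) :
    Integrable (fun x => ψ (affine c₀ L₀ x)) ((stdPi κ').prod ν) ∧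
    Tendsto (fun N => avg fun n => ψ (affine (c N) (L N) (z N n))) atTop
      (𝓝 (∫ x, ψ (affine c₀ L₀ x) ∂((stdPi κ').prod ν))) := by
  have hk0 : 0 ≤ k := by linarith
  have hψm : Measurable ψ := hψ.1.measurable
  obtain ⟨B₁, hB₁⟩ := (Metric.isBounded_range_of_tendsto _ hc).exists_norm_le
  obtain ⟨B₂, hB₂⟩ := hL.bounded
  obtain ⟨L₁, hL₁⟩ := hL.exists_eq
  -- Including the limiting coefficients lets the same growth bound give integrability of the limit.
  set B := max (max B₁ B₂) ‖(c₀, L₁)‖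
  have hcB (N : ℕ) : ‖c N‖ ≤ B :=
    (hB₁ _ (Set.mem_range_self N)).trans ((le_max_left _ _).trans (le_max_left _ _))
  have hLB (N : ℕ) : ‖L N‖ ≤ B := (hB₂ N).trans ((le_max_right _ _).trans (le_max_left _ _))
  have hB : 0 ≤ B := (norm_nonneg _).trans (hcB 0)
  obtain ⟨d, hd0, hd⟩ := hψ.exists_nonneg
  obtain ⟨C, hC1, hC⟩ := exists_growth_bound (κ := κ) hk0 hB (j := 1) hd0 (by simpa using hd)
  simp only [pow_one] at hC
  have hcont : Continuous fun x : (κ → ℝ) × Vec T × Vec M => C * growthFn k x :=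
    (continuous_growthFn hk0).const_mul C
  have hui : UnifInt fun N n => C * growthFn k (z N n) := hs.unifInt.const_mul (by linarith)
  have hn (x : (κ → ℝ) × Vec T × Vec M) : ‖x‖ ≤ C * growthFn k x := by
    have h1 := norm_le_growthFn (by linarith : 1 ≤ k) x
    nlinarith [norm_nonneg x]
  refine ⟨?_, ?_⟩
  · rw [← integrable_affine_iff (L := L₁) (fun i j => (hL₁ i j).trans (hL₀ i j).symm) hψm]
    exact (hs.weak.tendsto_avg hcont hui (affineComp ⟨ψ, hψ.1⟩ (c₀, L₁)).continuous
      (hC c₀ L₁ ((norm_fst_le (c₀, L₁)).trans (le_max_right _ _))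
        ((norm_snd_le (c₀, L₁)).trans (le_max_right _ _)))).1
  · rw [tendsto_iff_ultrafilter]
    intro l hl
    obtain ⟨L₂, hL₂, hL₂'⟩ := hL.exists_tendsto_ultrafilter l hl
    rw [← integral_affine_eq (L := L₂) (fun i j => (hL₂' i j).trans (hL₀ i j).symm) hψm]
    exact hs.weak.tendsto_avg_continuousMap hcont hn hui hl
      (F := fun N => affineComp ⟨ψ, hψ.1⟩ (c N, L N)) (F₀ := affineComp ⟨ψ, hψ.1⟩ (c₀, L₂))
      (((continuous_affineComp ⟨ψ, hψ.1⟩).tendsto (c₀, L₂)).comp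
        ((hc.mono_left hl).prodMk_nhds hL₂)) (fun N x => hC _ _ (hcB N) (hLB N) x)

/-- Weighted version of `SampleLimit.tendsto_avg`. -/
theorem SampleLimit.tendsto_avg_mul (hs : SampleLimit k ν b q₀ z a) (hk : 2 ≤ k) (hb : Continuous b)
    (hb2 : Integrable (fun q => b q ^ 2) ν) {c : ℕ → ι → ℝ}
    {c₀ : ι → ℝ} (hc : Tendsto c atTop (𝓝 c₀)) {L : ℕ → ι → κ → ℝ} {Γ : ι → ι → ℝ}
    (hL : GramTendsto L Γ) {L₀ : ι → κ' → ℝ} (hL₀ : ∀ i j, ∑ q, L₀ i q * L₀ j q = Γ i j)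
    {ψ : (ι → ℝ) × Vec T × Vec M → ℝ} (hψ : PolyGrowth (k / 2) ψ) :
    Tendsto (fun N => avg fun n => a N n * ψ (affine (c N) (L N) (z N n))) atTop
      (𝓝 (∫ x, b x.2 * ψ (affine c₀ L₀ x) ∂((stdPi κ').prod ν))) := by
  have hk0 : 0 ≤ k := by linarith
  obtain ⟨B₁, hB₁⟩ := (Metric.isBounded_range_of_tendsto _ hc).exists_norm_le
  obtain ⟨B₂, hB₂⟩ := hL.bounded
  set B := max B₁ B₂
  have hcB (N : ℕ) : ‖c N‖ ≤ B := (hB₁ _ (Set.mem_range_self N)).trans (le_max_left _ _)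
  have hLB (N : ℕ) : ‖L N‖ ≤ B := (hB₂ N).trans (le_max_right _ _)
  have hB : 0 ≤ B := (norm_nonneg _).trans (hcB 0)
  obtain ⟨d, hd0, hd⟩ := (hψ.mul hψ).exists_nonneg
  obtain ⟨C, hC1, hC⟩ := exists_growth_bound (κ := κ) hk0 hB (j := 2) (ψ := ψ) hd0 (fun y => by
    simpa [abs_mul, pow_two] using hd y)
  simp only [sq_abs] at hC
  have hcont : Continuous fun x : (κ → ℝ) × Vec T × Vec M => C * growthFn k x :=
    (continuous_growthFn hk0).const_mul C
  have hui : UnifInt fun N n => C * growthFn k (z N n) := hs.unifInt.const_mul (by linarith)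
  have hn (x : (κ → ℝ) × Vec T × Vec M) : ‖x‖ ≤ C * growthFn k x := by
    have h1 := norm_le_growthFn (by linarith : 1 ≤ k) x
    nlinarith [norm_nonneg x]
  rw [tendsto_iff_ultrafilter]
  intro l hl
  obtain ⟨L₂, hL₂, hL₂'⟩ := hL.exists_tendsto_ultrafilter l hl
  have hm : Measurable fun y : (ι → ℝ) × Vec T × Vec M => b y.2 * ψ y :=
    ((hb.comp continuous_snd).mul hψ.1).measurable
  have e := integral_affine_eq (ν := ν) (c := c₀) (L := L₂) (L' := L₀)
    (fun i j => (hL₂' i j).trans (hL₀ i j).symm) hm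
  change Tendsto _ _ (𝓝 (∫ x, (fun y : (ι → ℝ) × Vec T × Vec M => b y.2 * ψ y) (affine c₀ L₀ x)
    ∂((stdPi κ').prod ν)))
  rw [← e]
  exact hs.weak.tendsto_avg_mul_continuousMap exists_dense_boundedContinuous.choose_spec.1
    exists_dense_boundedContinuous.choose_spec.2 hcont hn hui
    (hs.sq.eventually_le_const (lt_add_one q₀)) (b := fun x => b x.2) (hb.comp continuous_snd)
    (hb2.comp_snd _) hs.weighted hl
    (F := fun N => affineComp ⟨ψ, hψ.1⟩ (c N, L N)) (F₀ := affineComp ⟨ψ, hψ.1⟩ (c₀, L₂))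
    (((continuous_affineComp ⟨ψ, hψ.1⟩).tendsto (c₀, L₂)).comp
      ((hc.mono_left hl).prodMk_nhds hL₂)) (fun N x => hC _ _ (hcB N) (hLB N) x)

end Limits

/-! ### First and second moments of linear forms. -/

section GaussianMoments

variable {κ : Type*} [Fintype κ]

lemma memLp_coord (q : κ) : MemLp (fun x : κ → ℝ => x q) 2 (stdPi κ) :=
  (IsGaussian.memLp_two_id (μ := gaussianReal 0 1)).comp_measurePreserving
    (measurePreserving_eval (fun _ : κ => gaussianReal 0 1) q)

lemma integral_coord (q : κ) : ∫ x, x q ∂stdPi κ = 0 := by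
  have hm := measurePreserving_eval (fun _ : κ => gaussianReal 0 1) q
  have e : ∫ x, x q ∂stdPi κ = ∫ y, y ∂(gaussianReal 0 1) := by
    rw [← hm.map_eq, integral_map hm.measurable.aemeasurable (by fun_prop)]
  rw [e, integral_id_gaussianReal]

lemma integral_coord_mul [DecidableEq κ] (p q : κ) :
    ∫ x, x p * x q ∂stdPi κ = if p = q then 1 else 0 := by
  have hm (q : κ) := measurePreserving_eval (fun _ : κ => gaussianReal 0 1) q
  split_ifs with h
  · subst h
    have e : ∫ x, x p * x p ∂stdPi κ = ∫ y, y * y ∂(gaussianReal 0 1) := by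
      rw [← (hm p).map_eq, integral_map (hm p).measurable.aemeasurable (by fun_prop)]
    rw [e]
    have := variance_id_gaussianReal (μ := 0) (v := 1)
    rw [variance_eq_sub IsGaussian.memLp_two_id] at this
    simpa [pow_two] using this
  · have hi : IndepFun (fun x : κ → ℝ => x p) (fun x => x q) (stdPi κ) :=
      (iIndepFun_pi (X := fun _ : κ => (id : ℝ → ℝ)) fun _ => aemeasurable_id).indepFun h
    rw [hi.integral_fun_mul_eq_mul_integral (memLp_coord p).aestronglyMeasurable
      (memLp_coord q).aestronglyMeasurable, integral_coord, zero_mul]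

lemma memLp_linear (u : κ → ℝ) : MemLp (fun x : κ → ℝ => ∑ q, u q * x q) 2 (stdPi κ) :=
  memLp_finsetSum _ fun q _ => (memLp_coord q).const_mul (u q)

lemma integral_linear (u : κ → ℝ) : ∫ x, ∑ q, u q * x q ∂stdPi κ = 0 := by
  rw [integral_finsetSum _ fun q _ => ((memLp_coord q).const_mul (u q)).integrable (by norm_num)]
  simp [integral_const_mul, integral_coord]

lemma integral_linear_mul (u v : κ → ℝ) :
    ∫ x, (∑ q, u q * x q) * (∑ q, v q * x q) ∂stdPi κ = ∑ q, u q * v q := by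
  classical
  have hi (p q : κ) : Integrable (fun x : κ → ℝ => u p * x p * (v q * x q)) (stdPi κ) :=
    ((memLp_coord p).const_mul (u p)).integrable_mul ((memLp_coord q).const_mul (v q))
  simp only [Finset.sum_mul_sum]
  rw [integral_finsetSum _ fun p _ => integrable_finsetSum _ fun q _ => hi p q]
  simp only [integral_finsetSum _ fun q _ => hi _ q]
  have (p q : κ) : ∫ x, u p * x p * (v q * x q) ∂stdPi κ = if p = q then u p * v q else 0 := by
    have e : (fun x : κ → ℝ => u p * x p * (v q * x q)) = fun x => u p * v q * (x p * x q) := by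
      ext; ring
    rw [e, integral_const_mul, integral_coord_mul]
    simp
  simp [this]

lemma integral_affine_fst {ι Q : Type*} [MeasurableSpace Q] (ν : Measure Q) [IsProbabilityMeasure ν]
    (c : ι → ℝ) (L : ι → κ → ℝ) (i : ι) :
    ∫ x, (affine c L x).1 i ∂((stdPi κ).prod ν) = c i := by
  simp only [affine_fst_apply]
  rw [integral_fun_fst (fun x : κ → ℝ => c i + ∑ q, L i q * x q),
    integral_add (integrable_const _) ((memLp_linear _).integrable (by norm_num)), integral_linear]
  simp

lemma integral_affine_fst_mul {ι Q : Type*} [MeasurableSpace Q] (ν : Measure Q)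
    [IsProbabilityMeasure ν] (c : ι → ℝ) (L : ι → κ → ℝ) (i j : ι) :
    ∫ x, (affine c L x).1 i * (affine c L x).1 j ∂((stdPi κ).prod ν)
      = c i * c j + ∑ q, L i q * L j q := by
  simp only [affine_fst_apply]
  rw [integral_fun_fst (fun x : κ → ℝ => (c i + ∑ q, L i q * x q) * (c j + ∑ q, L j q * x q))]
  have h1 (i : ι) := (memLp_linear (L i)).integrable (μ := stdPi κ) (by norm_num)
  have h2 := (memLp_linear (L i)).integrable_mul (memLp_linear (L j))
  have e : (fun x : κ → ℝ => (c i + ∑ q, L i q * x q) * (c j + ∑ q, L j q * x q))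
      = fun x => c i * c j + (c i * ∑ q, L j q * x q) + (c j * ∑ q, L i q * x q)
        + (∑ q, L i q * x q) * ∑ q, L j q * x q := by
    ext; ring
  rw [e, integral_add, integral_add, integral_add]
  · simp only [integral_const_mul, integral_linear, integral_linear_mul]
    simp
  · exact integrable_const _
  · exact (h1 j).const_mul _
  · exact (integrable_const _).add ((h1 j).const_mul _)
  · exact (h1 i).const_mul _
  · exact ((integrable_const _).add ((h1 j).const_mul _)).add ((h1 i).const_mul _)
  · exact h2

end GaussianMoments


lemma polyGrowth_coord {ι Q : Type*} [Fintype ι] [NormedAddCommGroup Q] {k : ℝ} (hk : 1 ≤ k)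
    (i : ι) : PolyGrowth k fun y : (ι → ℝ) × Q => y.1 i := by
  refine ⟨by fun_prop, 1, fun y => ?_⟩
  have h1 : |y.1 i| ≤ ‖y‖ := (norm_le_pi_norm y.1 i).trans (norm_fst_le y)
  rw [one_mul]
  rcases le_total ‖y‖ 1 with h | h
  · linarith [Real.rpow_nonneg (norm_nonneg y) k]
  · linarith [Real.self_le_rpow_of_one_le h hk]

section Linear

variable {ι κ : Type*} [Fintype ι] [Fintype κ] {T M : ℕ} {k : ℝ} {ν : Measure (Vec T × Vec M)}
  [IsProbabilityMeasure ν] {b : Vec T × Vec M → ℝ} {q₀ : ℝ}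
  {z : ∀ N, Fin N → (κ → ℝ) × Vec T × Vec M} {a : ∀ N, Fin N → ℝ}

/-- First and second moments of linear combinations of the Gaussian variables. -/
lemma SampleLimit.tendsto_avg_linear (hs : SampleLimit k ν b q₀ z a) (hk : 2 ≤ k)
    {c : ℕ → ι → ℝ} {c₀ : ι → ℝ} (hc : Tendsto c atTop (𝓝 c₀)) {L : ℕ → ι → κ → ℝ}
    {Γ : ι → ι → ℝ} (hL : GramTendsto L Γ) :
    (∀ i, Tendsto (fun N => avg fun n => (affine (c N) (L N) (z N n)).1 i) atTop (𝓝 (c₀ i))) ∧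
    ∀ i j, Tendsto (fun N => avg fun n =>
      (affine (c N) (L N) (z N n)).1 i * (affine (c N) (L N) (z N n)).1 j) atTop
      (𝓝 (c₀ i * c₀ j + Γ i j)) := by
  obtain ⟨L₀, hL₀⟩ := hL.exists_eq
  have hp (i : ι) := polyGrowth_coord (Q := Vec T × Vec M) (by linarith : 1 ≤ k / 2) i
  refine ⟨fun i => ?_, fun i j => ?_⟩
  · have h := (hs.tendsto_avg hk hc hL hL₀ (hp i).of_half).2
    rwa [integral_affine_fst] at h
  · have h := (hs.tendsto_avg hk hc hL hL₀ ((hp i).mul (hp j))).2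
    rwa [integral_affine_fst_mul, hL₀] at h

end Linear

/-! ### One step of the evolution along a typical sample. -/

section Evolution

variable {T M : ℕ}

/-- The mean of the outcomes, given the means of the messages. -/
def outMean (θ : Params T M) (m : ℕ → ℝ) (t : ℕ) : ℝ := (θ.μ + θ.μt t) * m t

/-- The covariances of the outcomes, given the Gram matrix of the messages. -/
def outCov (θ : Params T M) (Q : ℕ → ℕ → ℝ) (s t : ℕ) : ℝ :=
  θ.σ ^ 2 * Q s t + if s = t then θ.σt s ^ 2 * Q s t + θ.σe ^ 2 else 0

/-- The evolution of the outcomes along one sample, in terms of the Gaussian variables. -/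
structure SampleRun {κ : Type*} [Fintype κ] (θ : Params T M)
    (z : ∀ N, Fin N → (κ → ℝ) × Vec T × Vec M) (U Y R : ∀ N, ℕ → Fin N → ℝ)
    (L L' : ℕ → ℕ → κ → ℝ) : Prop where
  msg : ∀ N t n, U N t n = θ.g t (Y N t n, (z N n).2)
  outcome : ∀ N, ∀ t < T, ∀ n,
    Y N (t + 1) n = outMean θ (fun t => avg (U N t)) t + ∑ q, L N t q * (z N n).1 q
  fixedPart : ∀ N, ∀ t < T, ∀ n,
    R N t n = θ.μ * avg (U N t) + ∑ q, L' N t q * (z N n).1 q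
  gram : ∀ N, ∀ s < T, ∀ t < T,
    ∑ q, L N s q * L N t q = outCov θ (fun s t => avg (U N s * U N t)) s t
  gram_fixed : ∀ N, ∀ s < T, ∀ t < T,
    ∑ q, L' N s q * L N t q = θ.σ ^ 2 * avg (U N s * U N t)
  gram_fixed_fixed : ∀ N, ∀ s < T, ∀ t < T,
    ∑ q, L' N s q * L' N t q = θ.σ ^ 2 * avg (U N s * U N t)

/-- The limiting message, given the means and the Gaussian coefficients of the limiting outcomes. -/
noncomputable def limMsg {κ : Type*} [Fintype κ] (θ : Params T M) (gbar : Vec T × Vec M → ℝ)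
    (c : ℕ → ℝ) (L : ℕ → κ → ℝ) (s : ℕ) (x : (κ → ℝ) × Vec T × Vec M) : ℝ :=
  if s = 0 then gbar x.2 else θ.g s (c (s - 1) + ∑ q, L (s - 1) q * x.1 q, x.2)

/-- The assumptions on the functions and on the law of treatments and covariates. -/
structure GrowthAssumptions (k : ℝ) (θ : Params T M) (ν : Measure (Vec T × Vec M))
    (gbar : Vec T × Vec M → ℝ) : Prop where
  two_le : 2 ≤ k
  msg : ∀ t < T, PolyGrowth (k / 2) (θ.g t)
  gbar : PolyGrowth (k / 2) gbar
  integrable : ∀ f : Vec T × Vec M → ℝ, PolyGrowth k f → Integrable f ν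

variable {κ κ' : Type*} [Fintype κ] [Fintype κ'] {k q₀ : ℝ} {θ : Params T M}
  {ν : Measure (Vec T × Vec M)} [IsProbabilityMeasure ν] {gbar : Vec T × Vec M → ℝ}
  {z : ∀ N, Fin N → (κ → ℝ) × Vec T × Vec M} {U Y R : ∀ N, ℕ → Fin N → ℝ}
  {L L' : ℕ → ℕ → κ → ℝ} {t : ℕ} {m : ℕ → ℝ} {Q : ℕ → ℕ → ℝ}

/-- The limits of the first and second moments of the messages up to time `t`. -/
def MomentLimits (U : ∀ N, ℕ → Fin N → ℝ) (t : ℕ) (m : ℕ → ℝ) (Q : ℕ → ℕ → ℝ) : Prop :=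
  (∀ s < t, Tendsto (fun N => avg (U N s)) atTop (𝓝 (m s))) ∧
  ∀ s < t, ∀ r < t, Tendsto (fun N => avg (U N s * U N r)) atTop (𝓝 (Q s r))

lemma MomentLimits.tendsto_outMean (h : MomentLimits U t m Q) :
    Tendsto (fun N (i : Fin t) => outMean θ (fun t => avg (U N t)) i) atTop
      (𝓝 fun i => outMean θ m i) :=
  tendsto_pi_nhds.2 fun i => (h.1 i i.2).const_mul _

lemma MomentLimits.gramTendsto (h : MomentLimits U t m Q) (hr : SampleRun θ z U Y R L L')
    (ht : t ≤ T) :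
    GramTendsto (fun N (i : Fin t) => L N i) fun i j => outCov θ Q i j := by
  intro i j
  simp only [hr.gram _ i (i.2.trans_le ht) j (j.2.trans_le ht)]
  have h1 := h.2 i i.2 j j.2
  refine (h1.const_mul _).add ?_
  split_ifs with hij
  · exact (h1.const_mul _).add_const _
  · exact tendsto_const_nhds

variable (hs : SampleLimit k ν gbar q₀ z (fun N => U N 0)) (hr : SampleRun θ z U Y R L L')
  (hA : GrowthAssumptions k θ ν gbar) (ht : t ≤ T) (hm : MomentLimits U t m Q)
  {L₀ : ℕ → κ' → ℝ} (hL₀ : ∀ i < t, ∀ j < t, ∑ q, L₀ i q * L₀ j q = outCov θ Q i j)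

include hr ht in
lemma SampleRun.affine_eq (N : ℕ) (n : Fin N) :
    affine (fun i : Fin t => outMean θ (fun t => avg (U N t)) i) (fun i : Fin t => L N i) (z N n)
      = (fun i : Fin t => Y N (i + 1) n, (z N n).2) := by
  refine Prod.ext (funext fun i => ?_) rfl
  rw [affine_fst_apply]
  exact (hr.outcome N i (i.2.trans_le ht) n).symm

include hs hr hA ht hm hL₀

/-- Averages of functions of the outcomes. -/
theorem tendsto_avg_outcomes {ψ : (Fin t → ℝ) × Vec T × Vec M → ℝ} (hψ : PolyGrowth k ψ) :
    Integrable (fun x => ψ (affine (fun i : Fin t => outMean θ m i) (fun i : Fin t => L₀ i) x))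
      ((stdPi κ').prod ν) ∧
    Tendsto (fun N => avg fun n => ψ (fun i : Fin t => Y N (i + 1) n, (z N n).2)) atTop
      (𝓝 (∫ x, ψ (affine (fun i : Fin t => outMean θ m i) (fun i : Fin t => L₀ i) x)
        ∂((stdPi κ').prod ν))) := by
  have h := hs.tendsto_avg hA.two_le (hm.tendsto_outMean (θ := θ)) (hm.gramTendsto hr ht)
    (L₀ := fun i : Fin t => L₀ i) (fun i j => hL₀ i i.2 j j.2) hψ
  simpa only [hr.affine_eq ht] using h

/-- Averages of functions of the outcomes, weighted by a message. -/
theorem tendsto_avg_msg_mul {s : ℕ} (hst : s ≤ t) (hsT : s < T)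
    {φ : (Fin t → ℝ) × Vec T × Vec M → ℝ} (hφ : PolyGrowth (k / 2) φ) :
    Tendsto (fun N => avg fun n => U N s n * φ (fun i : Fin t => Y N (i + 1) n, (z N n).2)) atTop
      (𝓝 (∫ x, limMsg θ gbar (outMean θ m) L₀ s x *
        φ (affine (fun i : Fin t => outMean θ m i) (fun i : Fin t => L₀ i) x)
        ∂((stdPi κ').prod ν))) := by
  have hk := hA.two_le
  -- The message $U_0$ is known only through its averages, hence the weighted limit. For $s>0$,
  -- $U_s$ is a function of $Y^s$, which is coordinate $s-1$ of the outcome vector.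
  rcases Nat.eq_zero_or_pos s with rfl | hs0
  · have h := hs.tendsto_avg_mul hk hA.gbar.1
      (hA.integrable _ (by simpa only [pow_two] using hA.gbar.mul hA.gbar))
      (hm.tendsto_outMean (θ := θ)) (hm.gramTendsto hr ht)
      (L₀ := fun i : Fin t => L₀ i) (fun i j => hL₀ i i.2 j j.2) hφ
    simpa only [hr.affine_eq ht, limMsg, if_true] using h
  · have hπ := (hA.msg s hsT).comp_coord (by linarith) (⟨s - 1, by omega⟩ : Fin t)
    have h := (tendsto_avg_outcomes hs hr hA ht hm hL₀ (hπ.mul hφ)).2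
    have e : s - 1 + 1 = s := by omega
    simp only [e, affine_fst_apply] at h
    simp only [hr.msg, limMsg, if_neg hs0.ne']
    exact h

/-- The limits of the moments of the messages at the next time. -/
theorem MomentLimits.next :
    (∀ s ≤ t, s < T → Tendsto (fun N => avg (U N s)) atTop
      (𝓝 (∫ x, limMsg θ gbar (outMean θ m) L₀ s x ∂((stdPi κ').prod ν)))) ∧
    ∀ s ≤ t, s < T → ∀ r ≤ t, r < T → Tendsto (fun N => avg (U N s * U N r)) atTop
      (𝓝 (if s = 0 ∧ r = 0 then q₀ else ∫ x, limMsg θ gbar (outMean θ m) L₀ s x *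
        limMsg θ gbar (outMean θ m) L₀ r x ∂((stdPi κ').prod ν))) := by
  have hk := hA.two_le
  refine ⟨fun s hst hsT => ?_, ?_⟩
  · simpa using tendsto_avg_msg_mul hs hr hA ht hm hL₀ hst hsT (polyGrowth_const 1)
  -- A message of positive time serves as the test function and the other one as the weight.
  -- Symmetry covers all pairs but $(0,0)$, where the limit is $q_0$ and may differ from $E[\bar
  -- g_0^2]$.
  have key (s : ℕ) (hst : s ≤ t) (hsT : s < T) (r : ℕ) (hr0 : 0 < r) (hrt : r ≤ t) (hrT : r < T) :
      Tendsto (fun N => avg (U N s * U N r)) atTop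
      (𝓝 (∫ x, limMsg θ gbar (outMean θ m) L₀ s x *
        limMsg θ gbar (outMean θ m) L₀ r x ∂((stdPi κ').prod ν))) := by
    have hπ := (hA.msg r hrT).comp_coord (by linarith) (⟨r - 1, by omega⟩ : Fin t)
    have h := tendsto_avg_msg_mul hs hr hA ht hm hL₀ hst hsT hπ
    have e : r - 1 + 1 = r := by omega
    simp only [e, affine_fst_apply, ← hr.msg] at h
    have e2 : ∀ x, limMsg θ gbar (outMean θ m) L₀ r x
        = θ.g r (outMean θ m (r - 1) + ∑ q, L₀ (r - 1) q * x.1 q, x.2) := fun x => by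
      rw [limMsg, if_neg hr0.ne']
    simp only [e2]
    exact h
  intro s hst hsT r hrt hrT
  rcases Nat.eq_zero_or_pos r with rfl | hr0
  · rcases Nat.eq_zero_or_pos s with rfl | hs0
    · have h := hs.sq
      simp only [pow_two] at h
      rw [if_pos ⟨rfl, rfl⟩]
      exact h
    · have h := key 0 (by omega) hrT s hs0 hst hsT
      rw [if_neg (by omega)]
      simp only [mul_comm (U _ s)]
      simpa only [mul_comm (limMsg θ gbar (outMean θ m) L₀ s _)] using h
  · rw [if_neg (by omega)]
    exact key s hst hsT r hr0 hrt hrT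

end Evolution

/-! ### Induction on time. -/

section Existence

variable {Ω : Type*} [MeasurableSpace Ω] {P : Measure Ω} [IsProbabilityMeasure P] {T M : ℕ} {k : ℝ}
  {θ : Params T M} {S : Systems Ω T M} {Pi : Measure (Vec T)} [IsProbabilityMeasure Pi]
  {pX : Measure (Vec M)} [IsProbabilityMeasure pX] {ν₁ v₁ : ℝ} {gbar : Vec T × Vec M → ℝ}

omit [IsProbabilityMeasure P] in
lemma Regularity.growthAssumptions (hk : 2 ≤ k) (hR : Regularity k P θ S Pi pX ν₁ v₁ gbar) :
    GrowthAssumptions k θ (Pi.prod pX) gbar where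
  two_le := hk
  msg := hR.growth
  gbar := hR.gbar_growth
  integrable _ hf := integrable_of_polyGrowth hR.treatment_moment hR.covariates_moment hf

/-- The sample `ω` is typical: the outcomes are driven by Gaussian variables which, together with
the treatments and covariates, satisfy the expected limits. -/
def TypicalSample (k : ℝ) (θ : Params T M) (S : Systems Ω T M) (ν : Measure (Vec T × Vec M))
    (gbar : Vec T × Vec M → ℝ) (v₁ : ℝ) (ω : Ω) : Prop :=
  ∃ (z : ∀ N, Fin N → (Fin (2 * T) → ℝ) × Vec T × Vec M) (L L' : ℕ → ℕ → Fin (2 * T) → ℝ),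
    (∀ N n, (z N n).2 = (S.W n ω, S.X N ω n)) ∧
    SampleLimit k ν gbar (initSq θ v₁) z (fun N => S.U θ N ω 0) ∧
    SampleRun θ z (fun N => S.U θ N ω) (fun N => S.Y θ N ω) (fun N => S.R θ N ω) L L'

lemma ae_typicalSample (hk : 2 ≤ k) (hT : 0 < T) (hG : GaussianInterference P θ S)
    (hW : RandomizedDesign P Pi S) (hR : Regularity k P θ S Pi pX ν₁ v₁ gbar) :
    ∀ᵐ ω ∂P, TypicalSample k θ S (Pi.prod pX) gbar v₁ ω := by
  obtain ⟨ζ, L, L', hζ, hrep⟩ := exists_gaussian_representation hG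
    fun t ht => (hR.growth t ht).1.measurable
  have hlim := ae_sampleLimit hk hT hG hW hR hζ
  have hprod : ∀ᵐ ω ∂(P.prod (auxLaw T)), TypicalSample k θ S (Pi.prod pX) gbar v₁ ω.1 := by
    filter_upwards [hrep, hlim] with ω h1 h2
    refine ⟨fun N n => (ζ N ω n, S.W n ω.1, S.X N ω.1 n), fun N => L N ω, fun N => L' N ω,
      fun N n => rfl, h2, ⟨fun N t n => rfl, fun N => (h1 N).1, fun N => (h1 N).2.1,
        fun N => (h1 N).2.2.1, fun N => (h1 N).2.2.2.1, fun N => (h1 N).2.2.2.2⟩⟩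
  -- Typicality involves only the original sample point, so by Fubini the fresh variables can be
  -- dropped.
  filter_upwards [Measure.ae_ae_of_ae_prod hprod] with ω hω
  exact hω.exists.choose_spec

/-- Once the moments before time $t$ have deterministic limits, the coefficients of the outcomes
have a deterministic limiting Gram matrix, and that determines the limits of the moments including
time $t$. -/
lemma exists_momentLimits_of_le (hk : 2 ≤ k) (hT : 0 < T) (hG : GaussianInterference P θ S)
    (hW : RandomizedDesign P Pi S) (hR : Regularity k P θ S Pi pX ν₁ v₁ gbar) (t : ℕ) (ht : t ≤ T) :
    ∃ m Q, ∀ᵐ ω ∂P, MomentLimits (fun N => S.U θ N ω) t m Q := by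
  induction t with
  | zero => exact ⟨0, 0, .of_forall fun ω => ⟨fun s hs => by omega, fun s hs => by omega⟩⟩
  | succ t ih =>
    obtain ⟨m, Q, hmQ⟩ := ih (by omega)
    have hty := ae_typicalSample hk hT hG hW hR
    -- A single typical sample realizes the limiting covariances as a Gram matrix. The new limits
    -- are defined from it, hence deterministic, and all typical samples share them.
    obtain ⟨ω, hω, z, L, L', -, hs, hr⟩ := (hmQ.and hty).exists
    obtain ⟨L₁, hL₁⟩ := (hω.gramTendsto hr (by omega)).exists_eq
    let L₀ (s : ℕ) : Fin (2 * T) → ℝ := if h : s < t then L₁ ⟨s, h⟩ else 0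
    have hL₀ : ∀ i < t, ∀ j < t, ∑ q, L₀ i q * L₀ j q = outCov θ Q i j := fun i hi j hj => by
      simp only [L₀, dif_pos hi, dif_pos hj]
      exact hL₁ ⟨i, hi⟩ ⟨j, hj⟩
    refine ⟨fun s => ∫ x, limMsg θ gbar (outMean θ m) L₀ s x
        ∂((stdPi (Fin (2 * T))).prod (Pi.prod pX)),
      fun s r => if s = 0 ∧ r = 0 then initSq θ v₁ else ∫ x, limMsg θ gbar (outMean θ m) L₀ s x *
        limMsg θ gbar (outMean θ m) L₀ r x ∂((stdPi (Fin (2 * T))).prod (Pi.prod pX)), ?_⟩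
    filter_upwards [hmQ, hty] with ω hω hty
    obtain ⟨z, L, L', -, hs, hr⟩ := hty
    have h := hω.next hs hr (hR.growthAssumptions hk) (by omega) hL₀
    exact ⟨fun s hst => h.1 s (by omega) (by omega), fun s hst r hrt =>
      h.2 s (by omega) (by omega) r (by omega) (by omega)⟩

/-- The limits of the moments of the messages, together with vectors which have the limiting
covariances of the outcomes as Gram matrix. -/
structure LimitData (P : Measure Ω) (k : ℝ) (θ : Params T M) (S : Systems Ω T M)
    (ν : Measure (Vec T × Vec M)) (gbar : Vec T × Vec M → ℝ) (v₁ : ℝ) (m : ℕ → ℝ)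
    (Q : ℕ → ℕ → ℝ) : Prop where
  typical : ∀ᵐ ω ∂P, TypicalSample k θ S ν gbar v₁ ω
  moments : ∀ᵐ ω ∂P, MomentLimits (fun N => S.U θ N ω) T m Q
  growth : GrowthAssumptions k θ ν gbar

lemma exists_limitData (hk : 2 ≤ k) (hT : 0 < T) (hG : GaussianInterference P θ S)
    (hW : RandomizedDesign P Pi S) (hR : Regularity k P θ S Pi pX ν₁ v₁ gbar) :
    ∃ m Q, LimitData P k θ S (Pi.prod pX) gbar v₁ m Q := by
  obtain ⟨m, Q, h⟩ := exists_momentLimits_of_le hk hT hG hW hR T le_rfl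
  exact ⟨m, Q, ae_typicalSample hk hT hG hW hR, h, hR.growthAssumptions hk⟩

end Existence

/-! ### Consequences of the existence of the limits. -/

section LimitData

variable {Ω : Type*} [MeasurableSpace Ω] {P : Measure Ω} [IsProbabilityMeasure P] {T M : ℕ} {k : ℝ}
  {θ : Params T M} {S : Systems Ω T M} {ν : Measure (Vec T × Vec M)}
  {v₁ : ℝ} {gbar : Vec T × Vec M → ℝ} {m : ℕ → ℝ} {Q : ℕ → ℕ → ℝ}

lemma LimitData.exists_gram (h : LimitData P k θ S ν gbar v₁ m Q) :
    ∃ L₁ : Fin T → Fin (2 * T) → ℝ, ∀ s r : Fin T, ∑ q, L₁ s q * L₁ r q = outCov θ Q s r := by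
  obtain ⟨ω, hω, z, L, L', -, hs, hr⟩ := (h.moments.and h.typical).exists
  exact (hω.gramTendsto hr le_rfl).exists_eq

lemma LimitData.symm (h : LimitData P k θ S ν gbar v₁ m Q) {s r : ℕ} (hs : s < T) (hr : r < T) :
    Q s r = Q r s := by
  obtain ⟨ω, hω⟩ := h.moments.exists
  have h1 := hω.2 s hs r hr
  simp only [mul_comm (S.U θ _ ω s)] at h1
  exact tendsto_nhds_unique h1 (hω.2 r hr s hs)

variable [IsProbabilityMeasure ν] {κ' : Type*} [Fintype κ'] {L₀ : ℕ → κ' → ℝ}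

/-- A consistency relation from uniqueness of limits, valid for every choice of coefficients with
the right Gram matrix. This freedom later allows normalized coefficients. -/
lemma LimitData.mean_eq (h : LimitData P k θ S ν gbar v₁ m Q)
    (hL₀ : ∀ i < T, ∀ j < T, ∑ q, L₀ i q * L₀ j q = outCov θ Q i j) {s : ℕ} (hs : s < T) :
    m s = ∫ x, limMsg θ gbar (outMean θ m) L₀ s x ∂((stdPi κ').prod ν) := by
  obtain ⟨ω, hω, z, L, L', -, hl, hr⟩ := (h.moments.and h.typical).exists
  exact tendsto_nhds_unique (hω.1 s hs) ((hω.next hl hr h.growth le_rfl hL₀).1 s hs.le hs)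

lemma LimitData.gram_eq (h : LimitData P k θ S ν gbar v₁ m Q)
    (hL₀ : ∀ i < T, ∀ j < T, ∑ q, L₀ i q * L₀ j q = outCov θ Q i j) {s r : ℕ} (hs : s < T)
    (hr : r < T) : Q s r = if s = 0 ∧ r = 0 then initSq θ v₁ else
      ∫ x, limMsg θ gbar (outMean θ m) L₀ s x * limMsg θ gbar (outMean θ m) L₀ r x
        ∂((stdPi κ').prod ν) := by
  obtain ⟨ω, hω, z, L, L', -, hl, hrun⟩ := (h.moments.and h.typical).exists
  exact tendsto_nhds_unique (hω.2 s hs r hr)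
    ((hω.next hl hrun h.growth le_rfl hL₀).2 s hs.le hs r hr.le hr)

/-- Averages of functions of the outcomes up to time `t`, the treatments and the covariates. -/
lemma LimitData.tendsto_avg (h : LimitData P k θ S ν gbar v₁ m Q)
    (hL₀ : ∀ i < T, ∀ j < T, ∑ q, L₀ i q * L₀ j q = outCov θ Q i j) {t : ℕ} (ht : t ≤ T)
    {ψ : (Fin t → ℝ) × Vec T × Vec M → ℝ} (hψ : PolyGrowth k ψ) :
    Integrable (fun x => ψ (affine (fun i : Fin t => outMean θ m i) (fun i : Fin t => L₀ i) x))
      ((stdPi κ').prod ν) ∧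
    ∀ᵐ ω ∂P, Tendsto (fun N => avg fun n : Fin N =>
        ψ (fun i : Fin t => S.Y θ N ω (i + 1) n, S.W n ω, S.X N ω n)) atTop
      (𝓝 (∫ x, ψ (affine (fun i : Fin t => outMean θ m i) (fun i : Fin t => L₀ i) x)
        ∂((stdPi κ').prod ν))) := by
  have key : ∀ᵐ ω ∂P, Integrable (fun x => ψ (affine (fun i : Fin t => outMean θ m i)
      (fun i : Fin t => L₀ i) x)) ((stdPi κ').prod ν) ∧ Tendsto (fun N => avg fun n : Fin N =>
        ψ (fun i : Fin t => S.Y θ N ω (i + 1) n, S.W n ω, S.X N ω n)) atTop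
      (𝓝 (∫ x, ψ (affine (fun i : Fin t => outMean θ m i) (fun i : Fin t => L₀ i) x)
        ∂((stdPi κ').prod ν))) := by
    filter_upwards [h.moments, h.typical] with ω hω hty
    obtain ⟨z, L, L', hz, hl, hr⟩ := hty
    have h1 := tendsto_avg_outcomes hl hr h.growth ht
      ⟨fun s hs => hω.1 s (by omega), fun s hs r hr => hω.2 s (by omega) r (by omega)⟩
      (fun i hi j hj => hL₀ i (by omega) j (by omega)) hψ
    simpa only [hz] using h1
  obtain ⟨ω, hω⟩ := key.exists
  exact ⟨hω.1, key.mono fun ω hω => hω.2⟩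

omit [IsProbabilityMeasure P] in
/-- The first and second moments of the outcomes and of their parts due to the fixed matrix. -/
lemma LimitData.tendsto_moments (h : LimitData P k θ S ν gbar v₁ m Q) :
    ∀ᵐ ω ∂P, (∀ s < T, Tendsto (fun N => avg (S.Y θ N ω (s + 1))) atTop (𝓝 (outMean θ m s))) ∧
      (∀ s < T, Tendsto (fun N => avg (S.R θ N ω s)) atTop (𝓝 (θ.μ * m s))) ∧
      ∀ s < T, ∀ r < T,
        Tendsto (fun N => avg (S.Y θ N ω (s + 1) * S.Y θ N ω (r + 1))) atTop
          (𝓝 (outMean θ m s * outMean θ m r + outCov θ Q s r)) ∧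
        Tendsto (fun N => avg (S.R θ N ω s * S.Y θ N ω (r + 1))) atTop
          (𝓝 (θ.μ * m s * outMean θ m r + θ.σ ^ 2 * Q s r)) ∧
        Tendsto (fun N => avg (S.R θ N ω s * S.R θ N ω r)) atTop
          (𝓝 (θ.μ * m s * (θ.μ * m r) + θ.σ ^ 2 * Q s r)) := by
  filter_upwards [h.moments, h.typical] with ω hω hty
  obtain ⟨z, L, L', -, hl, hr⟩ := hty
  -- Outcomes and fixed parts are treated as one family, so that all mixed moments come from a
  -- single application.
  let c (N : ℕ) : Fin T ⊕ Fin T → ℝ := Sum.elim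
    (fun i => outMean θ (fun t => avg (S.U θ N ω t)) i) (fun i => θ.μ * avg (S.U θ N ω i))
  let Λ (N : ℕ) : Fin T ⊕ Fin T → Fin (2 * T) → ℝ := Sum.elim (fun i => L N i) (fun i => L' N i)
  have hc : Tendsto c atTop
      (𝓝 (Sum.elim (fun i : Fin T => outMean θ m i) fun i : Fin T => θ.μ * m i)) := by
    refine tendsto_pi_nhds.2 ?_
    rintro (i | i)
    · exact (hω.1 i i.2).const_mul _
    · exact (hω.1 i i.2).const_mul _
  have hΛ : GramTendsto Λ (Sum.elim
      (fun i => Sum.elim (fun j : Fin T => outCov θ Q i j) fun j : Fin T => θ.σ ^ 2 * Q j i)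
      fun i : Fin T => Sum.elim (fun j : Fin T => θ.σ ^ 2 * Q i j)
        fun j : Fin T => θ.σ ^ 2 * Q i j) := by
    rintro (i | i) (j | j)
    · exact hω.gramTendsto hr le_rfl i j
    · have h1 := (hω.2 j j.2 i i.2).const_mul (θ.σ ^ 2)
      refine h1.congr fun N => (hr.gram_fixed N j j.2 i i.2).symm.trans ?_
      exact Finset.sum_congr rfl fun q _ => mul_comm _ _
    · exact ((hω.2 i i.2 j j.2).const_mul (θ.σ ^ 2)).congr fun N =>
        (hr.gram_fixed N i i.2 j j.2).symm
    · exact ((hω.2 i i.2 j j.2).const_mul (θ.σ ^ 2)).congr fun N =>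
        (hr.gram_fixed_fixed N i i.2 j j.2).symm
  have hY (N : ℕ) (n : Fin N) (i : Fin T) :
      (affine (c N) (Λ N) (z N n)).1 (.inl i) = S.Y θ N ω (i + 1) n := by
    rw [affine_fst_apply]
    exact (hr.outcome N i i.2 n).symm
  have hR (N : ℕ) (n : Fin N) (i : Fin T) :
      (affine (c N) (Λ N) (z N n)).1 (.inr i) = S.R θ N ω i n := by
    rw [affine_fst_apply]
    exact (hr.fixedPart N i i.2 n).symm
  obtain ⟨h1, h2⟩ := hl.tendsto_avg_linear h.growth.two_le hc hΛ
  refine ⟨fun s hs => ?_, fun s hs => ?_, fun s hs r hrT => ⟨?_, ?_, ?_⟩⟩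
  · have h3 := h1 (.inl ⟨s, hs⟩)
    simp only [hY] at h3
    exact h3
  · have h3 := h1 (.inr ⟨s, hs⟩)
    simp only [hR] at h3
    exact h3
  · have h3 := h2 (.inl ⟨s, hs⟩) (.inl ⟨r, hrT⟩)
    simp only [hY] at h3
    exact h3
  · have h3 := h2 (.inr ⟨s, hs⟩) (.inl ⟨r, hrT⟩)
    simp only [hY, hR] at h3
    exact h3
  · have h3 := h2 (.inr ⟨s, hs⟩) (.inr ⟨r, hrT⟩)
    simp only [hR] at h3
    exact h3

end LimitData

/-! ### Normalized rows and one-dimensional marginals. -/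

section Normalization

variable {ι κ : Type*} [Fintype ι] [DecidableEq ι] [Fintype κ]

/-- Vectors can be normalized, replacing the zero vectors by fresh unit vectors. -/
noncomputable def normalizeRow (u : ι → κ → ℝ) (i : ι) : κ ⊕ ι → ℝ :=
  if ∑ q, u i q * u i q = 0 then Sum.elim 0 (Pi.single i 1)
  else Sum.elim (fun q => u i q / √(∑ q, u i q * u i q)) 0

lemma normalizeRow_self (u : ι → κ → ℝ) (i : ι) :
    ∑ q, normalizeRow u i q * normalizeRow u i q = 1 := by
  unfold normalizeRow
  split_ifs with h
  · simp [Fintype.sum_sum_type, Pi.single_apply]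
  · have h0 : 0 ≤ ∑ q, u i q * u i q := Finset.sum_nonneg fun q _ => mul_self_nonneg _
    simp only [Fintype.sum_sum_type, Sum.elim_inl, Sum.elim_inr, Pi.zero_apply, mul_zero,
      Finset.sum_const_zero, add_zero, div_mul_div_comm, Real.mul_self_sqrt h0]
    rw [← Finset.sum_div, div_self h]

omit [Fintype ι] in
-- Multiplying back by the norm recovers the row; for a zero row the norm also removes the fresh
-- unit vector.
lemma sqrt_mul_normalizeRow (u : ι → κ → ℝ) (i : ι) (q : κ ⊕ ι) :
    √(∑ q, u i q * u i q) * normalizeRow u i q = Sum.elim (u i) 0 q := by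
  unfold normalizeRow
  have h0 : 0 ≤ ∑ q, u i q * u i q := Finset.sum_nonneg fun q _ => mul_self_nonneg _
  split_ifs with h
  · rw [h, Real.sqrt_zero, zero_mul]
    rcases q with q | q
    · have := (Finset.sum_eq_zero_iff_of_nonneg fun q _ => mul_self_nonneg (u i q)).1 h q
        (Finset.mem_univ q)
      simpa using (mul_self_eq_zero.1 this).symm
    · rfl
  · rcases q with q | q
    · simp only [Sum.elim_inl]
      rw [mul_div_cancel₀]
      exact (Real.sqrt_pos.2 (lt_of_le_of_ne h0 (Ne.symm h))).ne'
    · simp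

end Normalization

/-- One-dimensional marginals of linear images of Gaussian vectors. -/
lemma integral_linear_eq_gaussianReal {κ Q : Type*} [Fintype κ] [MeasurableSpace Q] (ν : Measure Q)
    [SFinite ν] (c v : ℝ) (u : κ → ℝ) (hv : ∑ q, u q * u q = v) {f : ℝ × Q → ℝ}
    (hf : Measurable f) :
    ∫ x, f (c + ∑ q, u q * x.1 q, x.2) ∂((stdPi κ).prod ν)
      = ∫ x, f (c + √v * x.1, x.2) ∂((gaussianReal 0 1).prod ν) := by
  have hv0 : 0 ≤ v := hv ▸ Finset.sum_nonneg fun q _ => mul_self_nonneg _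
  have hm : Measurable fun y : (Unit → ℝ) × Q => f (y.1 (), y.2) := hf.comp (by fun_prop)
  have h1 := integral_affine_eq (ν := ν) (c := fun _ : Unit => c) (L := fun _ : Unit => u)
    (L' := fun (_ _ : Unit) => √v) (fun _ _ => by simp [hv, Real.mul_self_sqrt hv0]) hm
  simp only [affine_fst_apply, Finset.univ_unique, Finset.sum_singleton] at h1
  have h2 : MeasurePreserving (Prod.map (Function.eval (() : Unit)) (id : Q → Q))
      ((stdPi Unit).prod ν) ((gaussianReal 0 1).prod ν) :=
    (measurePreserving_eval (fun _ : Unit => gaussianReal 0 1) ()).prod (.id ν)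
  refine h1.trans ?_
  have hm2 : Measurable fun x : ℝ × Q => f (c + √v * x.1, x.2) := hf.comp (by fun_prop)
  rw [← h2.map_eq, integral_map h2.measurable.aemeasurable hm2.aestronglyMeasurable]
  rfl

/-! ### Identification with state evolution. -/

section StateEvolution

variable {Ω : Type*} [MeasurableSpace Ω] {P : Measure Ω} [IsProbabilityMeasure P] {T M : ℕ} {k : ℝ}
  {θ : Params T M} {S : Systems Ω T M} {Pi : Measure (Vec T)} [IsProbabilityMeasure Pi]
  {pX : Measure (Vec M)} [IsProbabilityMeasure pX] {ν₁ v₁ : ℝ} {gbar : Vec T × Vec M → ℝ}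
  {m : ℕ → ℝ} {Q : ℕ → ℕ → ℝ}

/-- The state evolution gives the means and the variances of the outcomes. -/
lemma LimitData.stateEvolution_eq (h : LimitData P k θ S (Pi.prod pX) gbar v₁ m Q)
    (hR : Regularity k P θ S Pi pX ν₁ v₁ gbar) {s : ℕ} (hs : s < T) :
    nu θ Pi pX ν₁ v₁ (s + 1) = outMean θ m s ∧ rhoSq θ Pi pX ν₁ v₁ (s + 1) = outCov θ Q s s := by
  obtain ⟨L₁, hL₁⟩ := h.exists_gram
  let L₀ (s : ℕ) : Fin (2 * T) → ℝ := if h : s < T then L₁ ⟨s, h⟩ else 0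
  have hL₀ : ∀ i < T, ∀ j < T, ∑ q, L₀ i q * L₀ j q = outCov θ Q i j := fun i hi j hj => by
    simp only [L₀, dif_pos hi, dif_pos hj]
    exact hL₁ ⟨i, hi⟩ ⟨j, hj⟩
  induction s with
  | zero =>
    constructor
    · obtain ⟨ω, h1, h2⟩ := (h.moments.and hR.initial_mean).exists
      exact tendsto_nhds_unique h2 ((h1.1 0 hs).const_mul _)
    · have hQ := h.gram_eq hL₀ hs hs
      rw [if_pos ⟨rfl, rfl⟩] at hQ
      have := hR.sq_pos.ne'
      change v₁ = _
      simp only [outCov, if_true, hQ, initSq]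
      field_simp
      ring
  | succ s ih =>
    obtain ⟨h1, h2⟩ := ih (by omega)
    have hgm := (h.growth.msg (s + 1) hs).1.measurable
    have hmean := h.mean_eq hL₀ hs
    have hgram := h.gram_eq hL₀ hs hs
    rw [if_neg (by omega)] at hgram
    simp only [limMsg, Nat.succ_ne_zero, if_false, Nat.add_sub_cancel, ← pow_two] at hmean hgram
    -- The message at time $s+1$ depends on a single linear form, of variance `outCov θ Q s s`,
    -- which by induction is $\rho_{s+1}^2$; the integral collapses to one Gaussian variable.
    rw [integral_linear_eq_gaussianReal (Pi.prod pX) _ _ _ (hL₀ s (by omega) s (by omega)) hgm]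
      at hmean
    rw [integral_linear_eq_gaussianReal (Pi.prod pX) _ _ _ (hL₀ s (by omega) s (by omega))
      (hgm.pow_const 2)] at hgram
    rw [← h1, ← h2] at hmean hgram
    constructor
    · rw [outMean, hmean]
      rfl
    · simp only [outCov, if_true, hgram]
      change (θ.σ ^ 2 + θ.σt (s + 1) ^ 2) * _ + θ.σe ^ 2 = _
      simp only [nu, rhoSq]
      ring

end StateEvolution

section LimitNoise

variable {κ : Type*} [Fintype κ] {ι : Type*} [Fintype ι]

lemma map_linMap_eval (w : ι → κ → ℝ) (i : ι) (hw : ∑ q, w i q * w i q = 1) :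
    ((stdPi κ).map (linMap w)).map (fun z => z i) = gaussianReal 0 1 := by
  have := isGaussian_stdPi κ
  have hg : HasGaussianLaw (fun z : ι → ℝ => z i) ((stdPi κ).map (linMap w)) :=
    ⟨inferInstanceAs (IsGaussian (Measure.map
      (ContinuousLinearMap.proj (R := ℝ) (φ := fun _ : ι => ℝ) i) ((stdPi κ).map (linMap w))))⟩
  have hm : AEMeasurable (linMap w) (stdPi κ) := (linMap w).continuous.measurable.aemeasurable
  have h0 : ∫ z, z i ∂((stdPi κ).map (linMap w)) = 0 := by
    rw [integral_map hm (measurable_pi_apply i).aestronglyMeasurable]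
    simp only [linMap_apply]
    exact integral_linear _
  have h1 : ∫ z, z i * z i ∂((stdPi κ).map (linMap w)) = 1 := by
    rw [integral_map hm (by fun_prop)]
    simp only [linMap_apply]
    rw [integral_linear_mul, hw]
  rw [hg.map_eq_gaussianReal, variance_eq_sub hg.memLp_two, h0]
  simp only [Pi.pow_apply, pow_two, h1]
  simp

lemma integral_map_linMap_mul (w : ι → κ → ℝ) (i j : ι) :
    ∫ z, z i * z j ∂((stdPi κ).map (linMap w)) = ∑ q, w i q * w j q := by
  rw [integral_map (linMap w).continuous.measurable.aemeasurable (by fun_prop)]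
  simp only [linMap_apply]
  exact integral_linear_mul _ _

lemma measurePreserving_linMap_prod {Q : Type*} [MeasurableSpace Q] (ν : Measure Q) [SFinite ν]
    (w : ι → κ → ℝ) : MeasurePreserving (fun x : (κ → ℝ) × Q => (linMap w x.1, x.2))
      ((stdPi κ).prod ν) (((stdPi κ).map (linMap w)).prod ν) :=
  ((linMap w).continuous.measurable.measurePreserving (stdPi κ)).prod (.id ν)

end LimitNoise

/-! ### The limiting Gaussian vector. -/

section Identification

variable {Ω : Type*} [MeasurableSpace Ω] {P : Measure Ω} [IsProbabilityMeasure P] {T M : ℕ} {k : ℝ}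
  {θ : Params T M} {S : Systems Ω T M} {Pi : Measure (Vec T)} [IsProbabilityMeasure Pi]
  {pX : Measure (Vec M)} [IsProbabilityMeasure pX] {ν₁ v₁ : ℝ} {gbar : Vec T × Vec M → ℝ}
  {m : ℕ → ℝ} {Q : ℕ → ℕ → ℝ} {κ : Type*} [Fintype κ]

/-- Unit vectors `w s` such that `ρ_{s+1} w s` have the limiting covariances of the outcomes. -/
def IsNoiseRows (θ : Params T M) (Pi : Measure (Vec T)) (pX : Measure (Vec M)) (ν₁ v₁ : ℝ)
    (Q : ℕ → ℕ → ℝ) (w : Fin T → κ → ℝ) : Prop :=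
  (∀ s, ∑ q, w s q * w s q = 1) ∧ ∀ s r : Fin T, rho θ Pi pX ν₁ v₁ (s + 1) *
    rho θ Pi pX ν₁ v₁ (r + 1) * ∑ q, w s q * w r q = outCov θ Q s r

/-- By state evolution $\rho_{s+1}$ is the norm of row $s$ of a limiting coefficient matrix, so
normalized rows work. A fresh unit vector keeps $Z_{s+1}$ standard normal when $\rho_{s+1}=0$. -/
lemma LimitData.exists_noiseRows (h : LimitData P k θ S (Pi.prod pX) gbar v₁ m Q)
    (hR : Regularity k P θ S Pi pX ν₁ v₁ gbar) :
    ∃ w : Fin T → (Fin (2 * T) ⊕ Fin T) → ℝ, IsNoiseRows θ Pi pX ν₁ v₁ Q w := by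
  obtain ⟨L₁, hL₁⟩ := h.exists_gram
  refine ⟨normalizeRow L₁, normalizeRow_self L₁, fun s r => ?_⟩
  have hrho (s : Fin T) : rho θ Pi pX ν₁ v₁ (s + 1) = √(∑ q, L₁ s q * L₁ s q) := by
    rw [rho, (h.stateEvolution_eq hR s.2).2, hL₁]
  rw [hrho, hrho, ← hL₁, Finset.mul_sum]
  have e (q : Fin (2 * T) ⊕ Fin T) : √(∑ q, L₁ s q * L₁ s q) * √(∑ q, L₁ r q * L₁ r q) *
      (normalizeRow L₁ s q * normalizeRow L₁ r q) = Sum.elim (L₁ s) 0 q * Sum.elim (L₁ r) 0 q := by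
    rw [← sqrt_mul_normalizeRow, ← sqrt_mul_normalizeRow]
    ring
  simp [e]

/-- The coefficients of the limiting outcomes. -/
noncomputable def outRows (θ : Params T M) (Pi : Measure (Vec T)) (pX : Measure (Vec M))
    (ν₁ v₁ : ℝ) (w : Fin T → κ → ℝ) (s : ℕ) (q : κ) : ℝ :=
  if h : s < T then rho θ Pi pX ν₁ v₁ (s + 1) * w ⟨s, h⟩ q else 0

variable {w : Fin T → κ → ℝ}

omit [IsProbabilityMeasure Pi] [IsProbabilityMeasure pX] in
lemma IsNoiseRows.gram (hw : IsNoiseRows θ Pi pX ν₁ v₁ Q w) :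
    ∀ i < T, ∀ j < T, ∑ q, outRows θ Pi pX ν₁ v₁ w i q * outRows θ Pi pX ν₁ v₁ w j q
      = outCov θ Q i j := by
  intro i hi j hj
  rw [← hw.2 ⟨i, hi⟩ ⟨j, hj⟩, Finset.mul_sum]
  simp only [outRows, dif_pos hi, dif_pos hj]
  exact Finset.sum_congr rfl fun q _ => by ring

variable (h : LimitData P k θ S (Pi.prod pX) gbar v₁ m Q)
  (hR : Regularity k P θ S Pi pX ν₁ v₁ gbar) (hw : IsNoiseRows θ Pi pX ν₁ v₁ Q w)

include h hR

lemma LimitData.limY_eq (x : κ → ℝ) (s : Fin T) : limY θ Pi pX ν₁ v₁ (linMap w x) s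
    = outMean θ m s + ∑ q, outRows θ Pi pX ν₁ v₁ w s q * x q := by
  rw [limY, (h.stateEvolution_eq hR s.2).1, linMap_apply, Finset.mul_sum]
  simp only [outRows, dif_pos s.2, mul_assoc, Fin.eta]

lemma LimitData.limU_eq (x : κ → ℝ) (q : Vec T × Vec M) (s : Fin T) :
    limU θ Pi pX ν₁ v₁ gbar s (linMap w x) q
      = limMsg θ gbar (outMean θ m) (outRows θ Pi pX ν₁ v₁ w) s (x, q) := by
  rw [limU, limMsg]
  split_ifs with hs
  · rfl
  · rw [h.limY_eq hR]

omit [IsProbabilityMeasure P] [IsProbabilityMeasure Pi] [IsProbabilityMeasure pX] in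
lemma LimitData.measurable_limU (s : Fin T) :
    Measurable fun p : (Fin T → ℝ) × Vec T × Vec M => limU θ Pi pX ν₁ v₁ gbar s p.1 p.2 := by
  unfold limU
  split_ifs with hs
  · exact hR.gbar_growth.1.measurable.comp measurable_snd
  · refine (h.growth.msg s s.2).1.measurable.comp ?_
    unfold limY
    fun_prop

include hw

lemma LimitData.limMean_eq (s : Fin T) :
    limMean θ Pi pX ν₁ v₁ gbar ((stdPi κ).map (linMap w)) s = m s := by
  have hmp := measurePreserving_linMap_prod (Pi.prod pX) w
  rw [limMean, ← hmp.map_eq, integral_map hmp.measurable.aemeasurable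
    (h.measurable_limU hR s).aestronglyMeasurable, h.mean_eq hw.gram s.2]
  simp only [h.limU_eq hR]

lemma LimitData.limGram_eq (s r : Fin T) :
    limGram θ Pi pX ν₁ v₁ gbar ((stdPi κ).map (linMap w)) s r = Q s r := by
  have hmp := measurePreserving_linMap_prod (Pi.prod pX) w
  have hm : Measurable fun p : (Fin T → ℝ) × Vec T × Vec M =>
      limU θ Pi pX ν₁ v₁ gbar s p.1 p.2 * limU θ Pi pX ν₁ v₁ gbar r p.1 p.2 :=
    (h.measurable_limU hR s).mul (h.measurable_limU hR r)
  rw [limGram, ← hmp.map_eq, integral_map hmp.measurable.aemeasurable hm.aestronglyMeasurable,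
    h.gram_eq hw.gram s.2 r.2]
  simp only [h.limU_eq hR, initSq]

lemma LimitData.isLimitNoise :
    IsLimitNoise θ Pi pX ν₁ v₁ gbar ((stdPi κ).map (linMap w)) where
  gaussian := by
    have := isGaussian_stdPi κ
    infer_instance
  marginal s := map_linMap_eval w s (hw.1 s)
  cov s r hsr := by
    rw [integral_map_linMap_mul, hw.2, h.limGram_eq hR hw, outCov,
      if_neg fun e => hsr (Fin.ext e), add_zero]

lemma LimitData.tendsto_avg_limY {t : ℕ} (ht : t + 1 ≤ T)
    {ψ : (Fin (t + 1) → ℝ) × Vec T × Vec M → ℝ} (hψ : PolyGrowth k ψ) :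
    Integrable (fun p => ψ (fun i => limY θ Pi pX ν₁ v₁ p.1 (Fin.castLE ht i), p.2))
      (((stdPi κ).map (linMap w)).prod (Pi.prod pX)) ∧
    ∀ᵐ ω ∂P, Tendsto (fun N => avg fun n : Fin N =>
        ψ (fun i => S.Y θ N ω (i + 1) n, S.W n ω, S.X N ω n)) atTop
      (𝓝 (∫ p, ψ (fun i => limY θ Pi pX ν₁ v₁ p.1 (Fin.castLE ht i), p.2)
        ∂(((stdPi κ).map (linMap w)).prod (Pi.prod pX)))) := by
  have hmp := measurePreserving_linMap_prod (Pi.prod pX) w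
  have hm : AEStronglyMeasurable (fun p : (Fin T → ℝ) × Vec T × Vec M =>
      ψ (fun i => limY θ Pi pX ν₁ v₁ p.1 (Fin.castLE ht i), p.2))
      (((stdPi κ).map (linMap w)).prod (Pi.prod pX)) := by
    refine (hψ.1.measurable.comp ?_).aestronglyMeasurable
    unfold limY
    fun_prop
  have e (x : (κ → ℝ) × Vec T × Vec M) :
      ψ (fun i => limY θ Pi pX ν₁ v₁ (linMap w x.1) (Fin.castLE ht i), x.2)
      = ψ (affine (fun i : Fin (t + 1) => outMean θ m i)
        (fun i : Fin (t + 1) => outRows θ Pi pX ν₁ v₁ w i) x) := by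
    congr 1
    refine Prod.ext (funext fun i => ?_) rfl
    rw [affine_fst_apply]
    exact h.limY_eq hR x.1 _
  have hlim := h.tendsto_avg hw.gram ht hψ
  simp only [← e] at hlim
  rw [← hmp.integrable_comp hm]
  refine ⟨hlim.1, ?_⟩
  rw [← hmp.map_eq] at hm ⊢
  rw [integral_map hmp.measurable.aemeasurable hm]
  exact hlim.2

end Identification

/-! ### Quadratic forms of the limiting matrices. -/

section QuadForm

/-- The quadratic form of a matrix indexed by `{0, …, t - 1}`. -/
def quadForm (Q : ℕ → ℕ → ℝ) (t : ℕ) (x : ℕ → ℝ) : ℝ :=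
  ∑ i ∈ Finset.range t, ∑ j ∈ Finset.range t, x i * x j * Q i j

/-- The quadratic form is positive away from zero. -/
def PosDefUpTo (Q : ℕ → ℕ → ℝ) (t : ℕ) : Prop :=
  ∀ x : ℕ → ℝ, quadForm Q t x ≤ 0 → ∀ i < t, x i = 0

variable {Q : ℕ → ℕ → ℝ} {t : ℕ}

lemma PosDefUpTo.posDef (h : PosDefUpTo Q t) (hsymm : ∀ i < t, ∀ j < t, Q i j = Q j i) :
    (Matrix.of fun i j : Fin t => Q i j).PosDef := by
  refine Matrix.PosDef.of_dotProduct_mulVec_pos ?_ fun x hx => ?_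
  · ext i j
    simpa using hsymm j j.2 i i.2
  · let y (i : ℕ) : ℝ := if hi : i < t then x ⟨i, hi⟩ else 0
    have hy (i : Fin t) : y i = x i := by simp [y]
    have e : star x ⬝ᵥ (Matrix.of fun i j : Fin t => Q i j).mulVec x = quadForm Q t y := by
      rw [quadForm, ← Fin.sum_univ_eq_sum_range (fun i => ∑ j ∈ Finset.range t, y i * y j * Q i j)]
      simp only [dotProduct, Matrix.mulVec, star_trivial, Matrix.of_apply, Finset.mul_sum]
      refine Finset.sum_congr rfl fun i _ => ?_
      rw [← Fin.sum_univ_eq_sum_range (fun j => y i * y j * Q i j)]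
      refine Finset.sum_congr rfl fun j _ => ?_
      rw [hy, hy]
      ring
    rw [e]
    by_contra hneg
    refine hx (funext fun i => ?_)
    rw [← hy i]
    exact h y (not_lt.1 hneg) i i.2

/-- If the Gram matrix of a family of vectors is positive definite, there is a dual family. -/
lemma PosDefUpTo.exists_dual (h : PosDefUpTo Q t) {κ : Type*} [Fintype κ] {L : ℕ → κ → ℝ}
    (hL : ∀ i < t, ∀ j < t, ∑ q, L i q * L j q = Q i j) {r : ℕ} (hr : r < t) :
    ∃ v : κ → ℝ, ∀ j < t, ∑ q, L j q * v q = if j = r then 1 else 0 := by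
  have hpd := h.posDef fun i hi j hj => by
    rw [← hL i hi j hj, ← hL j hj i hi]
    exact Finset.sum_congr rfl fun q _ => mul_comm _ _
  -- The dual vector is sought in the span of the family: its coefficients solve the linear system
  -- given by the invertible Gram matrix.
  obtain ⟨α, hα⟩ := Matrix.mulVec_surjective_iff_isUnit.2 hpd.isUnit (Pi.single ⟨r, hr⟩ 1)
  refine ⟨fun q => ∑ i : Fin t, α i * L i q, fun j hj => ?_⟩
  have h1 := congrFun hα ⟨j, hj⟩
  simp only [Matrix.mulVec, dotProduct, Matrix.of_apply, Pi.single_apply, Fin.mk.injEq] at h1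
  rw [← h1]
  simp only [Finset.mul_sum]
  rw [Finset.sum_comm]
  refine Finset.sum_congr rfl fun i _ => ?_
  rw [← hL j hj i i.2, Finset.sum_mul]
  exact Finset.sum_congr rfl fun q _ => by ring

variable {T M : ℕ} {θ : Params T M}

lemma quadForm_outCov (x : ℕ → ℝ) : quadForm (outCov θ Q) t x = θ.σ ^ 2 * quadForm Q t x
    + ∑ i ∈ Finset.range t, x i ^ 2 * (θ.σt i ^ 2 * Q i i + θ.σe ^ 2) := by
  simp only [quadForm, outCov, mul_add, Finset.sum_add_distrib, Finset.mul_sum]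
  congr 1
  · exact Finset.sum_congr rfl fun i _ => Finset.sum_congr rfl fun j _ => by ring
  · rw [← Finset.sum_add_distrib]
    refine Finset.sum_congr rfl fun i hi => ?_
    simp only [mul_ite, mul_zero, Finset.sum_ite_eq, if_pos hi]
    ring

/-- The form is $\sigma^2$ times that of `Q` plus a nonnegative diagonal form; noise makes the
diagonal part strictly positive, otherwise `Q` itself does it. -/
lemma posDefUpTo_outCov (h0 : ∀ x, 0 ≤ quadForm Q t x) (hd : ∀ i < t, 0 ≤ Q i i)
    (h : θ.σe ≠ 0 ∨ (θ.σ ≠ 0 ∧ PosDefUpTo Q t)) : PosDefUpTo (outCov θ Q) t := by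
  intro x hx
  rw [quadForm_outCov] at hx
  have hterm : ∀ i ∈ Finset.range t, 0 ≤ x i ^ 2 * (θ.σt i ^ 2 * Q i i + θ.σe ^ 2) := fun i hi => by
    have := hd i (Finset.mem_range.1 hi)
    positivity
  have hσ : 0 ≤ θ.σ ^ 2 * quadForm Q t x := mul_nonneg (sq_nonneg _) (h0 x)
  have hsum := Finset.sum_nonneg hterm
  rcases h with he | ⟨hs, hQ⟩
  · intro i hi
    have hz := (Finset.sum_eq_zero_iff_of_nonneg hterm).1 (by linarith) i (Finset.mem_range.2 hi)
    have hpos : 0 < θ.σt i ^ 2 * Q i i + θ.σe ^ 2 := by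
      have := hd i hi
      positivity
    simpa [hpos.ne'] using hz
  · have hs2 : 0 < θ.σ ^ 2 := by positivity
    exact hQ x (by nlinarith)

end QuadForm

section FullSupport

instance : (gaussianReal 0 1).IsOpenPosMeasure :=
  (gaussianReal_absolutelyContinuous' 0 one_ne_zero).isOpenPosMeasure

/-- A function which is continuous in the Gaussian variable and vanishes almost everywhere
vanishes for every value of the Gaussian variable. -/
lemma ae_forall_eq_zero {κ Q : Type*} [Fintype κ] [MeasurableSpace Q] {ν : Measure Q} [SFinite ν]
    {F : (κ → ℝ) × Q → ℝ} (hc : ∀ d, Continuous fun x => F (x, d))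
    (h : ∀ᵐ y ∂((stdPi κ).prod ν), F y = 0) : ∀ᵐ d ∂ν, ∀ x, F (x, d) = 0 := by
  have h1 : ∀ᵐ y ∂(ν.prod (stdPi κ)), F y.swap = 0 :=
    Measure.measurePreserving_swap.quasiMeasurePreserving.ae h
  filter_upwards [Measure.ae_ae_of_ae_prod h1] with d hd
  exact congrFun ((hc d).ae_eq_iff_eq (stdPi κ) continuous_const |>.1 hd)

end FullSupport

/-! ### Positive definiteness of the limits. -/

section PositiveDefinite

variable {Ω : Type*} [MeasurableSpace Ω] {P : Measure Ω} [IsProbabilityMeasure P] {T M : ℕ} {k : ℝ}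
  {θ : Params T M} {S : Systems Ω T M} {Pi : Measure (Vec T)} [IsProbabilityMeasure Pi]
  {pX : Measure (Vec M)} [IsProbabilityMeasure pX] {ν₁ v₁ : ℝ} {gbar : Vec T × Vec M → ℝ}
  {m : ℕ → ℝ} {Q : ℕ → ℕ → ℝ} {κ : Type*} [Fintype κ] {L₀ : ℕ → κ → ℝ}

lemma continuous_limMsg {c : ℕ → ℝ} (hg : ∀ t < T, Continuous (θ.g t)) (hgbar : Continuous gbar)
    {s : ℕ} (hs : s < T) : Continuous (limMsg θ gbar c L₀ s) := by
  unfold limMsg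
  split_ifs
  · fun_prop
  · exact (hg s hs).comp (by fun_prop)

variable (h : LimitData P k θ S (Pi.prod pX) gbar v₁ m Q)
  (hR : Regularity k P θ S Pi pX ν₁ v₁ gbar)
  (hL₀ : ∀ i < T, ∀ j < T, ∑ q, L₀ i q * L₀ j q = outCov θ Q i j)

include h hL₀

lemma LimitData.memLp_limMsg {s : ℕ} (hs : s < T) :
    MemLp (limMsg θ gbar (outMean θ m) L₀ s) 2 ((stdPi κ).prod (Pi.prod pX)) := by
  have hc := continuous_limMsg (L₀ := L₀) (c := outMean θ m) (fun t ht => (h.growth.msg t ht).1)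
    h.growth.gbar.1 hs
  rw [memLp_two_iff_integrable_sq hc.measurable.aestronglyMeasurable]
  rcases Nat.eq_zero_or_pos s with rfl | hs0
  · have h1 := h.growth.integrable _ (h.growth.gbar.mul h.growth.gbar)
    simp only [limMsg, if_true, pow_two]
    exact h1.comp_snd (stdPi κ)
  · have hp := h.growth.msg s hs
    have hπ := hp.comp_coord (by linarith [h.growth.two_le]) (⟨s - 1, by omega⟩ : Fin s)
    have h1 := (h.tendsto_avg hL₀ hs.le (hπ.mul hπ)).1
    simp only [affine_fst_apply] at h1
    simp only [limMsg, if_neg hs0.ne', pow_two]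
    exact h1

lemma LimitData.diag_nonneg {s : ℕ} (hR : Regularity k P θ S Pi pX ν₁ v₁ gbar) (hs : s < T) :
    0 ≤ Q s s := by
  rw [h.gram_eq hL₀ hs hs]
  split_ifs
  · exact (div_pos hR.initial_var_pos hR.sq_pos).le
  · exact integral_nonneg fun y => mul_self_nonneg _

include hR

/-- `Q` is the Gram matrix of the limiting messages except at $(0,0)$, where it exceeds it by
$D=q_{00}-E[\bar g_0^2]\ge0$; the forms differ by $Dx_0^2$, or not at all for $t=0$. -/
lemma LimitData.integral_sq_le_quadForm {t : ℕ} (ht : t ≤ T) (x : ℕ → ℝ) :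
    ∫ y, (∑ i ∈ Finset.range t, x i * limMsg θ gbar (outMean θ m) L₀ i y) ^ 2
      ∂((stdPi κ).prod (Pi.prod pX)) ≤ quadForm Q t x := by
  set G := limMsg θ gbar (outMean θ m) L₀ with hG
  set μ := (stdPi κ).prod (Pi.prod pX) with hμ
  set D := initSq θ v₁ - ∫ q, gbar q ^ 2 ∂(Pi.prod pX) with hD
  have hD0 : 0 ≤ D := sub_nonneg.2 hR.gbar_sq
  let δ (i : ℕ) : ℝ := if i = 0 then 1 else 0
  have hQ (i j : ℕ) (hi : i < T) (hj : j < T) : Q i j = ∫ y, G i y * G j y ∂μ + δ i * δ j * D := by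
    rw [h.gram_eq hL₀ hi hj]
    by_cases h0 : i = 0 ∧ j = 0
    · obtain ⟨rfl, rfl⟩ := h0
      have e : ∫ y, G 0 y * G 0 y ∂μ = ∫ q, gbar q ^ 2 ∂(Pi.prod pX) := by
        simp only [hG, limMsg, if_true, ← pow_two]
        rw [hμ, integral_fun_snd (fun q => gbar q ^ 2)]
        simp
      rw [if_pos ⟨rfl, rfl⟩, e, hD]
      simp [δ]
    · rw [if_neg h0]
      have : δ i * δ j = 0 := by
        simp only [δ]
        split_ifs <;> simp_all
      rw [this, zero_mul, add_zero]
  have hi (i j : ℕ) (hi : i < T) (hj : j < T) :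
      Integrable (fun y => x i * G i y * (x j * G j y)) μ :=
    ((h.memLp_limMsg hL₀ hi).const_mul (x i)).integrable_mul
      ((h.memLp_limMsg hL₀ hj).const_mul (x j))
  have hlt {i : ℕ} (hi : i ∈ Finset.range t) : i < T := (Finset.mem_range.1 hi).trans_le ht
  have e1 : ∫ y, (∑ i ∈ Finset.range t, x i * G i y) ^ 2 ∂μ
      = ∑ i ∈ Finset.range t, ∑ j ∈ Finset.range t, x i * x j * ∫ y, G i y * G j y ∂μ := by
    simp only [pow_two, Finset.sum_mul_sum]
    rw [integral_finsetSum _ fun i hi' => integrable_finsetSum _ fun j hj' =>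
      hi i j (hlt hi') (hlt hj')]
    refine Finset.sum_congr rfl fun i hi' => ?_
    rw [integral_finsetSum _ fun j hj' => hi i j (hlt hi') (hlt hj')]
    refine Finset.sum_congr rfl fun j hj' => ?_
    rw [← integral_const_mul]
    congr 1
    ext y
    ring
  have e2 : quadForm Q t x = ∑ i ∈ Finset.range t, ∑ j ∈ Finset.range t,
        x i * x j * ∫ y, G i y * G j y ∂μ + (∑ i ∈ Finset.range t, x i * δ i) ^ 2 * D := by
    rw [pow_two, Finset.sum_mul_sum, Finset.sum_mul, ← Finset.sum_add_distrib]
    refine Finset.sum_congr rfl fun i hi' => ?_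
    rw [Finset.sum_mul, ← Finset.sum_add_distrib]
    refine Finset.sum_congr rfl fun j hj' => ?_
    rw [hQ i j (hlt hi') (hlt hj')]
    ring
  rw [e1, e2]
  exact le_add_of_nonneg_right (by positivity)

lemma LimitData.quadForm_nonneg {t : ℕ} (ht : t ≤ T) (x : ℕ → ℝ) : 0 ≤ quadForm Q t x :=
  (integral_nonneg fun _ => sq_nonneg _).trans (h.integral_sq_le_quadForm hR hL₀ ht x)

/-- If a linear combination of the messages vanishes, the last coefficient vanishes, unless the last
message does not depend on the last outcome. -/
lemma LimitData.coeff_eq_zero {t : ℕ} (ht0 : 0 < t) (ht : t < T) (hV : PosDefUpTo (outCov θ Q) t)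
    (hN : ¬ ∀ᵐ q ∂(Pi.prod pX), ∀ y y' : ℝ, θ.g t (y, q) = θ.g t (y', q)) {x : ℕ → ℝ}
    (hx : quadForm Q (t + 1) x ≤ 0) : x t = 0 := by
  by_contra hxt
  refine hN ?_
  have hG {s : ℕ} (hs : s < T) := continuous_limMsg (L₀ := L₀) (c := outMean θ m)
    (fun t ht => (h.growth.msg t ht).1) h.growth.gbar.1 hs
  have hL2 : MemLp (fun y => ∑ i ∈ Finset.range (t + 1), x i * limMsg θ gbar (outMean θ m) L₀ i y) 2
      ((stdPi κ).prod (Pi.prod pX)) :=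
    memLp_finsetSum _ fun i hi => (h.memLp_limMsg hL₀ (by
      have := Finset.mem_range.1 hi
      omega)).const_mul (x i)
  have hint := (h.integral_sq_le_quadForm hR hL₀ (t := t + 1) (by omega) x).trans hx
  have hz := (integral_eq_zero_iff_of_nonneg (fun y => sq_nonneg _) hL2.integrable_sq).1
    (le_antisymm hint (integral_nonneg fun y => sq_nonneg _))
  have hz' : ∀ᵐ y ∂((stdPi κ).prod (Pi.prod pX)),
      ∑ i ∈ Finset.range (t + 1), x i * limMsg θ gbar (outMean θ m) L₀ i y = 0 :=
    hz.mono fun y hy => pow_eq_zero_iff two_ne_zero |>.1 hy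
  -- The Gaussian law has full support and the combination is continuous, so it vanishes for every
  -- value of the Gaussian vector.
  have hall := ae_forall_eq_zero (fun d => by
    refine continuous_finsetSum _ fun i hi => continuous_const.mul ((hG ?_).comp (by fun_prop))
    have := Finset.mem_range.1 hi
    omega) hz'
  -- Shifting the Gaussian vector along `v` moves only the last outcome $Y^t$, whose coefficients
  -- have index $t-1$. The messages of times before $t$ do not see it.
  obtain ⟨v, hv⟩ := hV.exists_dual (L := L₀) (fun i hi j hj => hL₀ i (by omega) j (by omega))
    (show t - 1 < t by omega)
  filter_upwards [hall] with d hd y y'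
  have key (τ : ℝ) : x t * θ.g t (outMean θ m (t - 1) + τ, d)
      = -∑ i ∈ Finset.range t, x i * limMsg θ gbar (outMean θ m) L₀ i (0, d) := by
    have h1 := hd (fun q => τ * v q)
    have hlin (j : ℕ) (hj : j < t) : ∑ q, L₀ j q * (τ * v q) = if j = t - 1 then τ else 0 := by
      have h2 := hv j hj
      have e : ∑ q, L₀ j q * (τ * v q) = τ * ∑ q, L₀ j q * v q := by
        rw [Finset.mul_sum]
        exact Finset.sum_congr rfl fun q _ => by ring
      rw [e, h2]
      split_ifs <;> simp
    rw [Finset.sum_range_succ] at h1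
    have e1 : ∑ i ∈ Finset.range t, x i * limMsg θ gbar (outMean θ m) L₀ i (fun q => τ * v q, d)
        = ∑ i ∈ Finset.range t, x i * limMsg θ gbar (outMean θ m) L₀ i (0, d) := by
      refine Finset.sum_congr rfl fun i hi => ?_
      have hi' := Finset.mem_range.1 hi
      unfold limMsg
      split_ifs with h0
      · rfl
      · rw [hlin (i - 1) (by omega), if_neg (by omega)]
        simp
    have e2 : limMsg θ gbar (outMean θ m) L₀ t (fun q => τ * v q, d)
        = θ.g t (outMean θ m (t - 1) + τ, d) := by
      rw [limMsg, if_neg ht0.ne', hlin (t - 1) (by omega), if_pos rfl]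
    rw [e1, e2] at h1
    linarith
  have h1 := key (y - outMean θ m (t - 1))
  have h2 := key (y' - outMean θ m (t - 1))
  rw [add_sub_cancel] at h1 h2
  exact mul_left_cancel₀ hxt (h1.trans h2.symm)

/-- The limiting Gram matrix of the messages is positive definite. -/
theorem LimitData.posDefUpTo_gram (hσ : θ.σe ≠ 0 ∨ θ.σ ≠ 0) {t : ℕ} (ht : t ≤ T)
    (hN : NonConstant θ Pi pX t) : PosDefUpTo Q t := by
  induction t with
  | zero => exact fun x _ i hi => by omega
  | succ t ih =>
    have hQ := ih (by omega) fun s hs hst => hN s hs (by omega)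
    intro x hx
    have hxt : x t = 0 := by
      -- At time 0 positivity comes from $q_{00}>0$. Later, positive definiteness of `Q` up to $t$,
      -- or noise, gives that of the outcome covariance up to $t$, which isolates the new
      -- coefficient.
      rcases Nat.eq_zero_or_pos t with rfl | ht0
      · have h0 := h.gram_eq hL₀ (s := 0) (r := 0) (by omega) (by omega)
        rw [if_pos ⟨rfl, rfl⟩] at h0
        have hpos : 0 < Q 0 0 := h0 ▸ div_pos hR.initial_var_pos hR.sq_pos
        simp only [quadForm, zero_add, Finset.sum_range_one] at hx
        by_contra hne
        have : 0 < x 0 * x 0 := mul_self_pos.2 hne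
        nlinarith
      · have hV : PosDefUpTo (outCov θ Q) t := posDefUpTo_outCov
          (h.quadForm_nonneg hR hL₀ (by omega)) (fun i hi => h.diag_nonneg hL₀ hR (by omega))
          (hσ.imp_right fun h' => ⟨h', hQ⟩)
        exact h.coeff_eq_zero hR hL₀ ht0 (by omega) hV (hN t ht0 (by omega)) hx
    have hsucc : quadForm Q (t + 1) x = quadForm Q t x := by
      simp [quadForm, Finset.sum_range_succ, hxt]
    rw [hsucc] at hx
    intro i hi
    rcases Nat.lt_succ_iff_lt_or_eq.1 hi with h' | rfl
    · exact hQ x hx i h'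
    · exact hxt

/-- The limiting covariance matrix of the outcomes is positive definite. -/
theorem LimitData.posDefUpTo_outCov {t : ℕ} (ht : t ≤ T)
    (hσ : θ.σe ≠ 0 ∨ (θ.σ ≠ 0 ∧ NonConstant θ Pi pX t)) : PosDefUpTo (outCov θ Q) t :=
  CausalMP.posDefUpTo_outCov (h.quadForm_nonneg hR hL₀ ht)
    (fun i hi => h.diag_nonneg hL₀ hR (by omega))
    (hσ.imp_right fun h' => ⟨h'.1, h.posDefUpTo_gram hR hL₀ (.inr h'.1) ht h'.2⟩)

end PositiveDefinite

end CausalMP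

/-! ### The main theorem. -/

open CausalMP

theorem theorem1 {Ω : Type*} [MeasurableSpace Ω] (P : Measure Ω) [IsProbabilityMeasure P]
    {T M : ℕ} (k : ℝ) (hk : 2 ≤ k)
    (θ : CausalMP.Params T M) (S : CausalMP.Systems Ω T M)
    (Pi : Measure (CausalMP.Vec T)) [IsProbabilityMeasure Pi]
    (pX : Measure (CausalMP.Vec M)) [IsProbabilityMeasure pX]
    (ν₁ v₁ : ℝ) (gbar : CausalMP.Vec T × CausalMP.Vec M → ℝ)
    (hG : CausalMP.GaussianInterference P θ S)
    (hW : CausalMP.RandomizedDesign P Pi S)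
    (hR : CausalMP.Regularity k P θ S Pi pX ν₁ v₁ gbar) :
    let ν := CausalMP.nu θ Pi pX ν₁ v₁
    let ρ2 := CausalMP.rhoSq θ Pi pX ν₁ v₁
    ∃ γ : Measure (Fin T → ℝ), CausalMP.IsLimitNoise θ Pi pX ν₁ v₁ gbar γ ∧
      let m := CausalMP.limMean θ Pi pX ν₁ v₁ gbar γ
      let G := CausalMP.limGram θ Pi pX ν₁ v₁ gbar γ
      -- empirical averages of test functions of (Y^1, …, Y^{t+1}, W, X)
      (∀ t : ℕ, ∀ ht : t + 1 ≤ T,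
        ∀ ψ : (Fin (t + 1) → ℝ) × CausalMP.Vec T × CausalMP.Vec M → ℝ, CausalMP.PolyGrowth k ψ →
          Integrable (fun p => ψ (fun i => CausalMP.limY θ Pi pX ν₁ v₁ p.1 (Fin.castLE ht i), p.2))
            (γ.prod (Pi.prod pX)) ∧
          ∀ᵐ ω ∂P, Tendsto
            (fun N => CausalMP.avg fun n : Fin N =>
              ψ (fun i => S.Y θ N ω (i + 1) n, S.W n ω, S.X N ω n)) atTop
            (𝓝 (∫ p, ψ (fun i => CausalMP.limY θ Pi pX ν₁ v₁ p.1 (Fin.castLE ht i), p.2)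
              ∂(γ.prod (Pi.prod pX))))) ∧
      -- first moments of outcomes, messages, and of the part due to the fixed matrix
      (∀ s : Fin T,
        (∀ᵐ ω ∂P, Tendsto (fun N => CausalMP.avg (S.Y θ N ω (s + 1))) atTop (𝓝 (ν (s + 1)))) ∧
        (∀ᵐ ω ∂P, Tendsto (fun N => CausalMP.avg (S.U θ N ω s)) atTop (𝓝 (m s))) ∧
        (θ.μ + θ.μt s) * m s = ν (s + 1) ∧
        (∀ᵐ ω ∂P, Tendsto (fun N => CausalMP.avg (S.R θ N ω s)) atTop (𝓝 (θ.μ * m s)))) ∧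
      -- second moments
      (∀ s : Fin T,
        (∀ᵐ ω ∂P, Tendsto (fun N => CausalMP.avg (S.Y θ N ω (s + 1) ^ 2)) atTop
          (𝓝 (ν (s + 1) ^ 2 + ρ2 (s + 1)))) ∧
        (θ.σ ^ 2 + θ.σt s ^ 2) * G s s + θ.σe ^ 2 = ρ2 (s + 1)) ∧
      (∀ s r : Fin T, s ≠ r →
        ∀ᵐ ω ∂P, Tendsto
          (fun N => CausalMP.avg (S.Y θ N ω (s + 1) * S.Y θ N ω (r + 1))) atTop
          (𝓝 (ν (s + 1) * ν (r + 1) + θ.σ ^ 2 * G s r))) ∧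
      (∀ s r : Fin T,
        (∀ᵐ ω ∂P, Tendsto (fun N => CausalMP.avg (S.U θ N ω s * S.U θ N ω r)) atTop
          (𝓝 (G s r))) ∧
        (∀ᵐ ω ∂P, Tendsto (fun N => CausalMP.avg (S.R θ N ω s * S.Y θ N ω (r + 1))) atTop
          (𝓝 (θ.μ * (θ.μ + θ.μt r) * (m s * m r) + θ.σ ^ 2 * G s r))) ∧
        (∀ᵐ ω ∂P, Tendsto (fun N => CausalMP.avg (S.R θ N ω s * S.R θ N ω r)) atTop
          (𝓝 (θ.μ ^ 2 * (m s * m r) + θ.σ ^ 2 * G s r)))) ∧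
      -- the limiting Gram matrix of the messages U_0, …, U_{t-1} is positive definite
      (∀ t ≤ T, (θ.σe ≠ 0 ∨ θ.σ ≠ 0) → CausalMP.NonConstant θ Pi pX t →
        ∃ Q : Matrix (Fin t) (Fin t) ℝ, Q.PosDef ∧
          ∀ᵐ ω ∂P, Tendsto
            (fun N => Matrix.of fun i j : Fin t => CausalMP.avg (S.U θ N ω i * S.U θ N ω j)) atTop
            (𝓝 Q)) ∧
      -- the limiting covariance matrix of the outcomes Y^1, …, Y^t is positive definite
      (∀ t ≤ T, (θ.σe ≠ 0 ∨ (θ.σ ≠ 0 ∧ CausalMP.NonConstant θ Pi pX t)) →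
        ∃ (V : Matrix (Fin t) (Fin t) ℝ) (v : Fin t → ℝ),
          (∀ᵐ ω ∂P, Tendsto
            (fun N => Matrix.of fun i j : Fin t =>
              CausalMP.avg (S.Y θ N ω (i + 1) * S.Y θ N ω (j + 1))) atTop (𝓝 V)) ∧
          (∀ᵐ ω ∂P, Tendsto
            (fun N => fun i : Fin t => CausalMP.avg (S.Y θ N ω (i + 1))) atTop (𝓝 v)) ∧
          (V - Matrix.vecMulVec v v).PosDef) := by
  intro ν ρ2
  -- The assumptions on $g_t$ concern $t<T$ and say nothing about $g_0$ when $T=0$; this case is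
  -- separate, with only empty matrices left.
  rcases Nat.eq_zero_or_pos T with rfl | hT
  · refine ⟨stdPi (Fin 0), ⟨isGaussian_stdPi _, fun s => s.elim0, fun s => s.elim0⟩,
      fun t ht => absurd ht (by omega), fun s => s.elim0, fun s => s.elim0, fun s => s.elim0,
      fun s => s.elim0, fun t ht _ _ => ?_, fun t ht _ => ?_⟩
    · obtain rfl : t = 0 := by omega
      exact ⟨1, .one, .of_forall fun ω => tendsto_pi_nhds.2 fun i => i.elim0⟩
    · obtain rfl : t = 0 := by omega
      refine ⟨1, 0, .of_forall fun ω => tendsto_pi_nhds.2 fun i => i.elim0,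
        .of_forall fun ω => tendsto_pi_nhds.2 fun i => i.elim0, ?_⟩
      rw [Subsingleton.elim (1 - Matrix.vecMulVec 0 0 : Matrix (Fin 0) (Fin 0) ℝ) 1]
      exact .one
  obtain ⟨m, Q, h⟩ := exists_limitData hk hT hG hW hR
  obtain ⟨w, hw⟩ := h.exists_noiseRows hR
  have hν (s : Fin T) : ν (s + 1) = outMean θ m s := (h.stateEvolution_eq hR s.2).1
  have hρ (s : Fin T) : ρ2 (s + 1) = outCov θ Q s s := (h.stateEvolution_eq hR s.2).2
  have hmom := h.tendsto_moments
  refine ⟨(stdPi _).map (linMap w), h.isLimitNoise hR hw, fun t ht ψ hψ =>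
    h.tendsto_avg_limY hR hw ht hψ, ?_⟩
  simp only [h.limMean_eq hR hw, h.limGram_eq hR hw, hν, hρ]
  refine ⟨fun s => ⟨?_, ?_, rfl, ?_⟩, fun s => ⟨?_, ?_⟩, fun s r hsr => ?_,
    fun s r => ⟨?_, ?_, ?_⟩, fun t ht hσ hN => ?_, fun t ht hσ => ?_⟩
  · exact hmom.mono fun ω hω => hω.1 s s.2
  · exact h.moments.mono fun ω hω => hω.1 s s.2
  · exact hmom.mono fun ω hω => hω.2.1 s s.2
  · filter_upwards [hmom] with ω hω
    simpa only [pow_two] using (hω.2.2 s s.2 s s.2).1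
  · simp only [outCov, if_true]
    ring
  · filter_upwards [hmom] with ω hω
    have h1 := (hω.2.2 s s.2 r r.2).1
    rwa [outCov, if_neg fun e => hsr (Fin.ext e), add_zero] at h1
  · exact h.moments.mono fun ω hω => hω.2 s s.2 r r.2
  · filter_upwards [hmom] with ω hω
    convert (hω.2.2 s s.2 r r.2).2.1 using 2
    rw [outMean]
    ring
  · filter_upwards [hmom] with ω hω
    convert (hω.2.2 s s.2 r r.2).2.2 using 2
    ring
  · refine ⟨Matrix.of fun i j : Fin t => Q i j, (h.posDefUpTo_gram hR hw.gram hσ ht hN).posDef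
      fun i hi j hj => h.symm (by omega) (by omega), ?_⟩
    filter_upwards [h.moments] with ω hω
    exact tendsto_pi_nhds.2 fun i => tendsto_pi_nhds.2 fun j =>
      hω.2 i (by omega) j (by omega)
  -- The limit of $V_t^\top V_t/N$ is the mean product plus `outCov`, so subtracting the product of
  -- the means leaves exactly `outCov`.
  · refine ⟨Matrix.of fun i j : Fin t => outMean θ m i * outMean θ m j + outCov θ Q i j,
      fun i => outMean θ m i, ?_, ?_, ?_⟩
    · filter_upwards [hmom] with ω hω
      exact tendsto_pi_nhds.2 fun i => tendsto_pi_nhds.2 fun j =>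
        (hω.2.2 i (by omega) j (by omega)).1
    · filter_upwards [hmom] with ω hω
      exact tendsto_pi_nhds.2 fun i => hω.1 i (by omega)
    · have hpd := (h.posDefUpTo_outCov hR hw.gram ht hσ).posDef fun i hi j hj => by
        rw [← hw.gram i (by omega) j (by omega), ← hw.gram j (by omega) i (by omega)]
        exact Finset.sum_congr rfl fun q _ => mul_comm _ _
      convert hpd using 1
      ext i j
      simp [Matrix.vecMulVec_apply]
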